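/- Let $d\ge 1$, $z>0$, $C>0$, let $r$ be a probability measure on $\mathbb R$ with $\operatorname{supp} r\subseteq[-C,C]$ and $r\{0\}=0$, and put $\psi(t)=z\int_{\mathbb R}(e^{ist}-1)\,dr(s)$. Let $\mathcal S'(\mathbb R^d)$ be the space of real tempered distributions with its Borel $\sigma$-algebra $\mathcal B$, and let $\mu_0$ be the unique probability measure on $(\mathcal S'(\mathbb R^d),\mathcal B)$ with $$\int e^{i\langle\eta,f\rangle}\,d\mu_0(\eta)=e^{\int_{\mathbb R^d}\psi(f(x))\,dx}\qquad\text{for all real Schwartz functions } f .$$ Let $\Gamma\subseteq\mathcal S'(\mathbb R^d)$ be the set of signed measures $\eta=\sum_{y}s_y\delta_y$ with finitely many support points in every compact set, $|s_y|\le C$ for all $y$, and $\sum_y|s_y|(1+|y|^2)^{-(d+\epsilon)/2}<\infty$ for all $\epsilon>0$. The measure $\mu_0$ is carried by $\Gamma$ and is regarded as a measure on $\Gamma$ with the trace $\sigma$-algebra. For $\eta\in\Gamma$ and a function $h$ on $\mathbb R^d$ write $\langle\eta,h\rangle=\sum_y s_y h(y)$. Let $G\in L^1(\mathbb R^d)$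 satisfy $G\ge0$ and $G(-x)=G(x)$; let $v\in C^2(\mathbb R)$ be concave with $v(0)=0$ and $|v'|<b$ for some constant $b>0$; let $g\ge0$ be a continuous function on $\mathbb R^d$ with compact support. For $\mu_0$-almost every $\eta\in\Gamma$ the field $\phi=G*\eta$, $\phi(x)=\sum_y s_yG(x-y)$, is defined by an absolutely convergent sum for almost every $x$ and is locally integrable; put $U_g(\eta)=\int_{\mathbb R^d}v(\phi(x))\,g(x)\,dx$. Then $$d\mu_g=\frac{e^{-U_g}}{\int_\Gamma e^{-U_g}\,d\mu_0}\,d\mu_0$$ is a well-defined probability measure on $\Gamma$. An observable is a function $F:\Gamma\to\mathbb R$ of the form $F(\eta)=H(\langle\eta,h_1\rangle,\ldots,\langle\eta,h_n\rangle)$, where $n\in\mathbb N$, $H:\mathbb R^n\to\mathbb R$ is continuous with $|H(x)|\le Ke^{\kappa(|x_1|+\cdots+|x_n|)}$ for some $\kappa,K>0$, and each $h_l:\mathbb R^d\to\mathbb R$ is continuous with $\sup_x(1+|x|^2)^N|h_l(x)|<\infty$ for all $N\in\mathbb N$. It is called monotonically increasing if such $H$ and $h_l$ can be chosen so that moreover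 $h_l\ge0$ for all $l$ and $H$ is monotonically increasing in each of its arguments. All observables are square integrable with respect to $\mu_g$. **Theorem.** The measure $\mu_g$ satisfies the FKG inequality: for all monotonically increasing observables $F_1,F_2$, $$\int_\Gamma F_1F_2\,d\mu_g\ \ge\ \int_\Gamma F_1\,d\mu_g\int_\Gamma F_2\,d\mu_g .$$ -/

import Mathlib

open MeasureTheory
open scoped SchwartzMap

namespace ParticleSystem

/-- Euclidean space `ℝ^d`. -/
abbrev Space (d : ℕ) : Type := EuclideanSpace ℝ (Fin d)

/-- The space `𝓢'(ℝ^d)` of real tempered distributions, the topological dual of the space of real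
Schwartz functions, with the weak-* topology. -/
abbrev TempDist (d : ℕ) : Type := WeakDual ℝ 𝓢(Space d, ℝ)

/-- `𝓢'(ℝ^d)` carries its Borel σ-algebra. -/
noncomputable instance instMeasurableSpaceTempDist (d : ℕ) : MeasurableSpace (TempDist d) := borel _

instance instBorelSpaceTempDist (d : ℕ) : BorelSpace (TempDist d) := ⟨rfl⟩

/-! ### The free gas -/

/-- The purely Poisson Lévy characteristic `ψ(t) = z ∫ (e^{ist} - 1) dr(s)`. -/
noncomputable def levyChar (z : ℝ) (r : Measure ℝ) (t : ℝ) : ℂ :=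
  z * ∫ s, (Complex.exp (Complex.I * s * t) - 1) ∂r

/-- `μ₀` is the probability measure on `𝓢'(ℝ^d)` with characteristic functional
`f ↦ exp (∫ ψ(f(x)) dx)`. -/
def IsFreeMeasure {d : ℕ} (z : ℝ) (r : Measure ℝ) (μ₀ : Measure (TempDist d)) : Prop :=
  IsProbabilityMeasure μ₀ ∧
    ∀ f : 𝓢(Space d, ℝ),
      ∫ T : TempDist d, Complex.exp (Complex.I * ((T f : ℝ) : ℂ)) ∂μ₀ =
        Complex.exp (∫ x, levyChar z r (f x))

/-! ### Particle configurations -/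

/-- `s` is the charge function `y ↦ η{y}` of a signed measure `η = ∑ s_y δ_y` with finitely many
support points in every compact set, with charges bounded by `C`, and such that
`∫ (1 + |y|²)^{-(d+ε)/2} d|η|(y) < ∞` for all `ε > 0`. -/
structure IsConfiguration (d : ℕ) (C : ℝ) (s : Space d → ℝ) : Prop where
  finite_inter : ∀ K : Set (Space d), IsCompact K → {y ∈ K | s y ≠ 0}.Finite
  abs_le : ∀ y, |s y| ≤ C
  summable : ∀ ε : ℝ, 0 < ε →
    Summable fun y => |s y| * (1 + ‖y‖ ^ 2) ^ (-((d : ℝ) + ε) / 2)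

/-- The tempered distribution `T` is the signed measure `∑ s_y δ_y`. -/
def Represents {d : ℕ} (s : Space d → ℝ) (T : TempDist d) : Prop :=
  ∀ f : 𝓢(Space d, ℝ), T f = ∑' y, s y * f y

/-- The configuration space `Γ = Γ^C ⊆ 𝓢'(ℝ^d)`. As a subtype it carries the trace of the Borel
σ-algebra of `𝓢'(ℝ^d)`. -/
def Γ (d : ℕ) (C : ℝ) : Set (TempDist d) :=
  {T | ∃ s : Space d → ℝ, IsConfiguration d C s ∧ Represents s T}

/-- The charge `η{y}` that `η ∈ Γ` has at the point `y`. -/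
noncomputable def charge {d : ℕ} {C : ℝ} (η : Γ d C) : Space d → ℝ := Classical.choose η.2

/-- The charge function is the only one that represents `η`, so the choice in `charge` is
immaterial. -/
theorem charge_unique {d : ℕ} {C : ℝ} (η : Γ d C) (s : Space d → ℝ)
    (hs : IsConfiguration d C s) (hT : Represents s η.1) : charge η = s := by
  obtain ⟨hs', hT'⟩ := Classical.choose_spec η.2
  change IsConfiguration d C (charge η) at hs'
  change Represents (charge η) η.1 at hT'
  funext y₀
  have key : ∃ f : 𝓢(Space d, ℝ), f y₀ = 1 ∧
      ∀ y, y ≠ y₀ → f y ≠ 0 → charge η y = 0 ∧ s y = 0 := by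
    have hK := isCompact_closedBall y₀ (1 : ℝ)
    have hfin : (({y ∈ Metric.closedBall y₀ 1 | charge η y ≠ 0} ∪
        {y ∈ Metric.closedBall y₀ 1 | s y ≠ 0}) \ {y₀}).Finite :=
      ((hs'.finite_inter _ hK).union (hs.finite_inter _ hK)).subset Set.sdiff_subset
    have hU := Filter.inter_mem (Metric.closedBall_mem_nhds y₀ one_pos)
      (hfin.isClosed.isOpen_compl.mem_nhds (x := y₀) (by simp))
    obtain ⟨f, hf, hfc, hfs, -, h1⟩ := exists_contDiff_tsupport_subset (n := ⊤) hU
    refine ⟨hfc.toSchwartzMap hfs, h1, fun y hy hfy => ?_⟩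
    have hy' := hf (subset_tsupport f (show y ∈ Function.support f from hfy))
    have h2 : y ∈ Metric.closedBall y₀ 1 := hy'.1
    have h3 := hy'.2
    simp only [Set.mem_compl_iff, Set.mem_sdiff, Set.mem_union, Set.mem_ofPred_eq,
      Set.mem_singleton_iff, h2, true_and, hy, not_false_eq_true, and_true, not_or,
      not_not] at h3
    exact h3
  obtain ⟨f, h1, h0⟩ := key
  have e := (hT' f).symm.trans (hT f)
  rw [tsum_eq_single y₀, tsum_eq_single y₀, h1, mul_one, mul_one] at e
  · exact e
  · intro y hy
    by_cases hfy : f y = 0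
    · simp [hfy]
    · simp [(h0 y hy hfy).2]
  · intro y hy
    by_cases hfy : f y = 0
    · simp [hfy]
    · simp [(h0 y hy hfy).1]

/-- The pairing `⟨η, h⟩ = ∑ η{y} h(y)` of a configuration with a function. -/
noncomputable def pairing {d : ℕ} {C : ℝ} (η : Γ d C) (h : Space d → ℝ) : ℝ :=
  ∑' y, charge η y * h y

/-! ### The interacting measure -/

/-- The static field `φ = G * η`, i.e. `φ(x) = ∑ η{y} G(x - y)`. -/
noncomputable def field {d : ℕ} {C : ℝ} (G : Space d → ℝ) (η : Γ d C) (x : Space d) : ℝ :=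
  pairing η fun y => G (x - y)

/-- The interaction `U_g(η) = ∫ v(φ(x)) g(x) dx` with infrared cut-off `g`, where `φ = G * η`. -/
noncomputable def energy {d : ℕ} {C : ℝ} (G : Space d → ℝ) (v : ℝ → ℝ) (g : Space d → ℝ)
    (η : Γ d C) : ℝ :=
  ∫ x, v (field G η x) * g x

/-- The Gibbs measure `dμ_g = e^{-U_g} dμ₀ / ∫ e^{-U_g} dμ₀` on `Γ`. -/
noncomputable def gibbs {d : ℕ} {C : ℝ} (μ₀ : Measure (Γ d C)) (G : Space d → ℝ) (v : ℝ → ℝ)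
    (g : Space d → ℝ) : Measure (Γ d C) :=
  μ₀.tilted fun η => -energy G v g η

/-! ### Observables and the FKG inequality -/

/-- Fast falling functions: continuous, with `sup |(1 + |x|²)^N h(x)| < ∞` for all `N`. -/
def FastFalling {d : ℕ} (h : Space d → ℝ) : Prop :=
  Continuous h ∧ ∀ N : ℕ, ∃ M : ℝ, ∀ x, |(1 + ‖x‖ ^ 2) ^ N * h x| ≤ M

/-- Exponentially bounded functions on `ℝ^n`. -/
def ExpBounded {n : ℕ} (H : (Fin n → ℝ) → ℝ) : Prop :=
  ∃ κ K : ℝ, 0 < κ ∧ 0 < K ∧ ∀ x, |H x| ≤ K * Real.exp (κ * ∑ i, |x i|)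

/-- The class `𝒪(Γ)`: functions `F(η) = H(⟨η,h₁⟩, …, ⟨η,hₙ⟩)` with `H` continuous and
exponentially bounded and `h₁, …, hₙ` fast falling. -/
def IsObservable {d : ℕ} {C : ℝ} (F : Γ d C → ℝ) : Prop :=
  ∃ (n : ℕ) (H : (Fin n → ℝ) → ℝ) (h : Fin n → Space d → ℝ),
    Continuous H ∧ ExpBounded H ∧ (∀ l, FastFalling (h l)) ∧
    ∀ η, F η = H fun l => pairing η (h l)

/-- The class of monotonically increasing observables: there is a representation as above with
`h_l ≥ 0` and `H` increasing in each argument (equivalently, monotone for the product order). -/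
def IsIncreasingObservable {d : ℕ} {C : ℝ} (F : Γ d C → ℝ) : Prop :=
  ∃ (n : ℕ) (H : (Fin n → ℝ) → ℝ) (h : Fin n → Space d → ℝ),
    Continuous H ∧ ExpBounded H ∧ (∀ l, FastFalling (h l)) ∧
    (∀ l x, 0 ≤ h l x) ∧ Monotone H ∧
    ∀ η, F η = H fun l => pairing η (h l)

/-- The FKG inequality for a measure on `Γ`. -/
def SatisfiesFKG {d : ℕ} {C : ℝ} (μ : Measure (Γ d C)) : Prop :=
  ∀ F₁ F₂ : Γ d C → ℝ, IsIncreasingObservable F₁ → IsIncreasingObservable F₂ →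
    (∫ η, F₁ η ∂μ) * (∫ η, F₂ η ∂μ) ≤ ∫ η, F₁ η * F₂ η ∂μ

end ParticleSystem

/-! Under the free measure, the total charges of disjoint cells of space are independent. If every
source point is moved to a representative of its cell, the field is `φ(x) = ∑ t_q G(x - q)`, linear
in the vector `t` of cell charges with nonnegative coefficients. Hence the fields of `s ⊓ t` and `s
⊔ t` enclose those of `s` and `t` and have the same sum, and concavity of `v` gives `U(s ⊓ t) + U(s
⊔ t) ≤ U(s) + U(t)` (`concave_spread`, `finiteEnergy_inf_add_sup_le`). The density `e^{-U}` is
therefore log-supermodular with respect to a product measure, and increasing observables are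
increasing in `t`. The order is that of the signed cell charges, so charges of both signs are
allowed.

For product measures on `ℝ^n` the inequality comes from the FKG theorem on finite distributive
lattices by rounding the coordinates (`fkg_quantised`, `fkg_pi`). With independence
(`IsPoissonSample.map_cellCharge`) this yields the discretized inequality
`IsPoissonSample.fkg_discretize`. The cells are then refined. Observables converge by continuity of
the `h_l`; the energy converges because `v` is Lipschitz and translation is continuous in `L¹`.
Everything is dominated by exponentials of `∑ |s_y| m(y)` with `m` bounded and integrable, and these
have finite mean for a compound Poisson process (`IsPoissonSample.fkg`).

The free measure is built explicitly: a Poisson number of uniform points with independent charges in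
each spherical shell, mapped to `Γ` by `config`. Any other free measure agrees with it because the
Borel σ-algebra of the tempered distributions is generated by countably many evaluations
(`borel_eq_comap_denseEval`), so that characteristic functionals determine measures. Measurability
on `Γ` is checked on samples, since `config` is a measurable surjection from a standard Borel space
onto a countably separated one (`measurable_comp_config_iff`). -/

namespace ParticleSystem

open Filter Topology ProbabilityTheory

/-! ### Second countability of the Schwartz space -/

section SchwartzSeparable

variable {E : Type*} [NormedAddCommGroup E] [NormedSpace ℝ E] [FiniteDimensional ℝ E]

/-- The weighted derivative `‖x‖ ^ k • D^n f (x)` of a Schwartz function vanishes at infinity and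
hence extends to the one point compactification. -/
noncomputable def weightedDeriv (k n : ℕ) (f : 𝓢(E, ℝ)) :
    C(OnePoint E, ContinuousMultilinearMap ℝ (fun _ : Fin n => E) ℝ) :=
  OnePoint.continuousMapMk
    ⟨fun x => ‖x‖ ^ k • iteratedFDeriv ℝ n f x,
      (continuous_norm.pow k).smul ((f.smooth ⊤).continuous_iteratedFDeriv (by exact_mod_cast le_top))⟩ 0 (by
    have : ProperSpace E := FiniteDimensional.proper ℝ E
    rw [coclosedCompact_eq_cocompact]
    -- One spare power of `‖x‖` in the decay estimate gives the bound `M / ‖x‖` outside the unit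
    -- ball.
    obtain ⟨M, hM⟩ := f.decay (k + 1) n
    refine squeeze_zero_norm' (a := fun x => M * ‖x‖⁻¹) ?_ ?_
    · have h1 : ∀ᶠ x : E in cocompact E, 1 ≤ ‖x‖ :=
        (tendsto_norm_cocompact_atTop (E := E)).eventually_ge_atTop 1
      filter_upwards [h1] with x hx
      have := hM.2 x
      simp only [ContinuousMap.coe_mk, norm_smul, norm_pow, norm_norm]
      rw [← div_eq_mul_inv, le_div_iff₀ (by linarith)]
      calc _ = ‖x‖ ^ (k + 1) * ‖iteratedFDeriv ℝ n f x‖ := by ring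
        _ ≤ M := this
    · simpa using (tendsto_inv_atTop_zero.comp (tendsto_norm_cocompact_atTop (E := E))).const_mul M)

theorem norm_weightedDeriv (k n : ℕ) (f : 𝓢(E, ℝ)) :
    ‖weightedDeriv k n f‖ = SchwartzMap.seminorm ℝ k n f := by
  apply le_antisymm
  · refine (ContinuousMap.norm_le _ (apply_nonneg _ _)).2 fun x => ?_
    induction x using OnePoint.rec with
    | infty =>
      change ‖(0 : ContinuousMultilinearMap ℝ (fun _ : Fin n => E) ℝ)‖ ≤ _
      rw [norm_zero]
      exact apply_nonneg _ _
    | coe x =>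
      change ‖‖x‖ ^ k • iteratedFDeriv ℝ n f x‖ ≤ _
      rw [norm_smul, norm_pow, norm_norm]
      exact SchwartzMap.le_seminorm ℝ k n f x
  · refine SchwartzMap.seminorm_le_bound ℝ k n f
      (norm_nonneg (weightedDeriv k n f)) fun x => ?_
    have h := (weightedDeriv k n f).norm_coe_le_norm (x : OnePoint E)
    change ‖‖x‖ ^ k • iteratedFDeriv ℝ n f x‖ ≤ _ at h
    rwa [norm_smul, norm_pow, norm_norm] at h

theorem weightedDeriv_add (k n : ℕ) (f g : 𝓢(E, ℝ)) :
    weightedDeriv k n (f + g) = weightedDeriv k n f + weightedDeriv k n g := by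
  ext1 x
  induction x using OnePoint.rec with
  | infty => exact (add_zero _).symm
  | coe x =>
    change ‖x‖ ^ k • iteratedFDeriv ℝ n (f + g) x =
      ‖x‖ ^ k • iteratedFDeriv ℝ n f x + ‖x‖ ^ k • iteratedFDeriv ℝ n g x
    rw [← smul_add]
    congr 1
    exact iteratedFDeriv_add_apply (f.smooth n).contDiffAt (g.smooth n).contDiffAt

/-- All weighted derivatives of a Schwartz function. -/
noncomputable def weightedDerivs :
    𝓢(E, ℝ) →+ ((p : ℕ × ℕ) →
      C(OnePoint E, ContinuousMultilinearMap ℝ (fun _ : Fin p.2 => E) ℝ)) :=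
  AddMonoidHom.mk' (fun f p => weightedDeriv p.1 p.2 f)
    fun f g => funext fun p => weightedDeriv_add p.1 p.2 f g

/-- Each Schwartz seminorm is the sup norm of one weighted derivative, so both topologies have the
same neighbourhoods of zero; for an additive map this suffices. -/
theorem isInducing_weightedDerivs : IsInducing (weightedDerivs (E := E)) := by
  rw [IsTopologicalAddGroup.isInducing_iff_nhds_zero]
  rw [(SeminormFamily.withSeminorms_iff_nhds_eq_iInf _).1 (schwartz_withSeminorms ℝ E ℝ), nhds_pi,
    Filter.pi, comap_iInf]
  refine iInf_congr fun p => ?_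
  rw [comap_comap, Pi.zero_apply]
  have h0 : 𝓝 (0 : C(OnePoint E, ContinuousMultilinearMap ℝ (fun _ : Fin p.2 => E) ℝ)) =
      comap norm (𝓝 0) :=
    (comap_norm_nhds_zero
      (E := C(OnePoint E, ContinuousMultilinearMap ℝ (fun _ : Fin p.2 => E) ℝ))).symm
  have hn : ⇑(schwartzSeminormFamily ℝ E ℝ p) = norm ∘ weightedDeriv p.1 p.2 :=
    funext fun f => (norm_weightedDeriv p.1 p.2 f).symm
  rw [hn, ← comap_comap, ← h0]
  rfl

theorem secondCountableTopology_continuousMultilinearMap (n : ℕ) :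
    SecondCountableTopology (ContinuousMultilinearMap ℝ (fun _ : Fin n => E) ℝ) := by
  have : FiniteDimensional ℝ (ContinuousMultilinearMap ℝ (fun _ : Fin n => E) ℝ) :=
    Module.Finite.of_injective
      (ContinuousMultilinearMap.toMultilinearMapLinear (R' := ℝ) (A := ℝ) (M₁ := fun _ : Fin n => E)
        (M₂ := ℝ)) ContinuousMultilinearMap.toMultilinearMap_injective
  have := FiniteDimensional.proper ℝ (ContinuousMultilinearMap ℝ (fun _ : Fin n => E) ℝ)
  infer_instance

/-- The one-point compactification is a sphere. Being compact and second countable, it makes the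
spaces of continuous functions in `weightedDerivs` second countable. -/
theorem secondCountableTopology_onePoint : SecondCountableTopology (OnePoint E) := by
  let e : OnePoint E ≃ₜ Metric.sphere (0 : EuclideanSpace ℝ (Fin (Module.finrank ℝ E + 1))) 1 :=
    onePointEquivSphereOfFinrankEq (by simp)
  exact e.secondCountableTopology

instance instSecondCountableTopologySchwartz : SecondCountableTopology 𝓢(E, ℝ) := by
  have h1 := secondCountableTopology_onePoint (E := E)
  have h2 := secondCountableTopology_continuousMultilinearMap (E := E)
  exact isInducing_weightedDerivs.secondCountableTopology

end SchwartzSeparable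

/-! ### Borel sets of tempered distributions and characteristic functionals -/

section BorelCylinder

variable {d : ℕ}

/-- The tempered distributions bounded by `n` times a finite supremum of Schwartz seminorms. -/
def polarSet (s : Finset (ℕ × ℕ)) (n : ℕ) : Set (TempDist d) :=
  {T | ∀ f : 𝓢(Space d, ℝ), |T f| ≤ n * s.sup (schwartzSeminormFamily ℝ (Space d) ℝ) f}

/-- Continuity of a functional means a bound by finitely many seminorms; the constant is rounded up
so that countably many polar sets cover the dual. -/
theorem exists_mem_polarSet (T : TempDist d) : ∃ s n, T ∈ polarSet s n := by
  obtain ⟨s, c, -, h⟩ := Seminorm.bound_of_continuous (schwartz_withSeminorms ℝ (Space d) ℝ)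
    (normSeminorm ℝ ℝ |>.comp (T.toLinearMap)) (continuous_norm.comp T.continuous)
  refine ⟨s, ⌈(c : ℝ)⌉₊, fun f => ?_⟩
  have h1 : |T f| ≤ c * s.sup (schwartzSeminormFamily ℝ (Space d) ℝ) f := h f
  exact h1.trans (mul_le_mul_of_nonneg_right (Nat.le_ceil _) (apply_nonneg _ _))

/-- Evaluation at a fixed dense sequence of Schwartz functions. -/
noncomputable def denseEval (T : TempDist d) (n : ℕ) : ℝ :=
  T (TopologicalSpace.denseSeq 𝓢(Space d, ℝ) n)

theorem continuous_seminorm_sup (s : Finset (ℕ × ℕ)) :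
    Continuous (s.sup (schwartzSeminormFamily ℝ (Space d) ℝ) : Seminorm ℝ 𝓢(Space d, ℝ)) := by
  induction s using Finset.induction_on with
  | empty => exact continuous_const (y := (0 : ℝ))
  | insert a s _ ih =>
    rw [Finset.sup_insert]
    exact ((schwartz_withSeminorms ℝ (Space d) ℝ).continuous_seminorm a).sup ih

theorem measurable_tempDist_apply (f : 𝓢(Space d, ℝ)) :
    Measurable fun T : TempDist d => T f :=
  (WeakDual.eval_continuous f).measurable

/-- Functionals in one polar set are equicontinuous, so an `ε / 3` argument controls the value at
any `f` by the value at a nearby member of the dense sequence. -/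
theorem isInducing_denseEval (s : Finset (ℕ × ℕ)) (n : ℕ) :
    IsInducing (fun T : polarSet (d := d) s n => denseEval T.1) := by
  refine isInducing_iff_nhds.2 fun T => le_antisymm ?_ ?_
  · refine (Continuous.continuousAt ?_).tendsto.le_comap
    exact continuous_pi fun k => (WeakDual.eval_continuous _).comp continuous_subtype_val
  · rw [nhds_subtype, ← tendsto_iff_comap]
    rw [show 𝓝 T.1 = comap (fun (S : TempDist d) (f : 𝓢(Space d, ℝ)) => S f) (𝓝 fun f => T.1 f) from
      nhds_induced _ _, tendsto_comap_iff, tendsto_pi_nhds]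
    intro f
    rw [Metric.tendsto_nhds]
    intro ε hε
    set q := s.sup (schwartzSeminormFamily ℝ (Space d) ℝ)
    have hq : Continuous q := continuous_seminorm_sup s
    obtain ⟨k, hk⟩ := (TopologicalSpace.denseRange_denseSeq 𝓢(Space d, ℝ)).exists_mem_open
      (s := {f' | n * q (f - f') < ε / 3})
      (isOpen_lt (continuous_const.mul (hq.comp (continuous_const.sub continuous_id)))
        continuous_const) ⟨f, by simp; positivity⟩
    have h1 : ∀ᶠ T' : polarSet (d := d) s n in
        comap (fun T : polarSet (d := d) s n => denseEval T.1) (𝓝 (denseEval T.1)),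
        |denseEval T'.1 k - denseEval T.1 k| < ε / 3 := by
      have := ((continuous_apply k).tendsto (denseEval T.1)).comp
        (tendsto_comap (f := fun T : polarSet (d := d) s n => denseEval T.1))
      exact (Metric.tendsto_nhds.1 this) (ε / 3) (by positivity)
    filter_upwards [h1] with T' hT'
    have h2 := T'.2 (f - TopologicalSpace.denseSeq 𝓢(Space d, ℝ) k)
    have h3 := T.2 (f - TopologicalSpace.denseSeq 𝓢(Space d, ℝ) k)
    rw [map_sub] at h2 h3
    have hk' : n * q (f - TopologicalSpace.denseSeq 𝓢(Space d, ℝ) k) < ε / 3 := hk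
    change |T'.1 f - T.1 f| < ε
    change |T'.1 (TopologicalSpace.denseSeq 𝓢(Space d, ℝ) k) -
      T.1 (TopologicalSpace.denseSeq 𝓢(Space d, ℝ) k)| < ε / 3 at hT'
    rw [abs_lt] at *
    rw [abs_le] at h2 h3
    constructor <;> linarith [h2.1, h2.2, h3.1, h3.2]

theorem measurable_denseEval : Measurable (denseEval (d := d)) :=
  measurable_pi_iff.2 fun _ => measurable_tempDist_apply _

theorem denseEval_injective : Function.Injective (denseEval (d := d)) := by
  intro S T h
  refine DFunLike.ext _ _ fun f => ?_
  refine DenseRange.induction_on (p := fun f => S f = T f)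
    (TopologicalSpace.denseRange_denseSeq 𝓢(Space d, ℝ)) f
    (isClosed_eq S.continuous T.continuous) fun k => congrFun h k

/-- Both sides of the defining inequality are continuous in `f`, so it need only be tested on the
dense sequence. -/
theorem measurableSet_polarSet (s : Finset (ℕ × ℕ)) (n : ℕ) :
    MeasurableSet[MeasurableSpace.comap denseEval inferInstance] (polarSet (d := d) s n) := by
  have : polarSet (d := d) s n = denseEval ⁻¹' (⋂ k, {x : ℕ → ℝ | |x k| ≤
      n * s.sup (schwartzSeminormFamily ℝ (Space d) ℝ)
        (TopologicalSpace.denseSeq 𝓢(Space d, ℝ) k)}) := by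
    ext T
    simp only [Set.mem_preimage, Set.mem_iInter]
    refine ⟨fun h k => h _, fun h f => ?_⟩
    exact DenseRange.induction_on (p := fun f => |T f| ≤
        n * s.sup (schwartzSeminormFamily ℝ (Space d) ℝ) f)
      (TopologicalSpace.denseRange_denseSeq 𝓢(Space d, ℝ)) f
      (isClosed_le T.continuous.abs (continuous_const.mul (continuous_seminorm_sup s))) h
  rw [this]
  refine ⟨_, MeasurableSet.iInter fun k => ?_, rfl⟩
  exact measurableSet_le (measurable_pi_apply k).abs measurable_const

/-- An open set is the countable union of its intersections with polar sets. On each polar set the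
topology is induced by the dense evaluations, so each piece is a cylinder set intersected with a
measurable polar set. -/
theorem borel_eq_comap_denseEval :
    instMeasurableSpaceTempDist d = MeasurableSpace.comap denseEval inferInstance := by
  refine le_antisymm ?_ measurable_denseEval.comap_le
  refine MeasurableSpace.generateFrom_le fun U hU => ?_
  have hU' : U = ⋃ p : Finset (ℕ × ℕ) × ℕ, U ∩ polarSet p.1 p.2 := by
    ext T
    obtain ⟨s, n, h⟩ := exists_mem_polarSet T
    simp only [Set.mem_iUnion, Set.mem_inter_iff]
    exact ⟨fun hT => ⟨(s, n), hT, h⟩, fun ⟨_, hT, _⟩ => hT⟩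
  rw [hU']
  refine MeasurableSet.iUnion fun p => ?_
  obtain ⟨V, hV, hVU⟩ := (isInducing_denseEval (d := d) p.1 p.2).isOpen_iff.1
    (IsOpen.preimage continuous_subtype_val (hU : IsOpen U))
  have : U ∩ polarSet p.1 p.2 = denseEval ⁻¹' V ∩ polarSet p.1 p.2 := by
    ext T
    refine and_congr_left fun hT => ?_
    exact (Set.ext_iff.1 hVU ⟨T, hT⟩).symm
  rw [this]
  exact MeasurableSet.inter ⟨V, hV.measurableSet, rfl⟩ (measurableSet_polarSet p.1 p.2)

/-- Preimages of a countable separating family still separate points. Countable separation is what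
`measurable_comp_config_iff` requires of `Γ`. -/
theorem countablySeparated_of_injective {α β : Type*} [MeasurableSpace α] [MeasurableSpace β]
    [MeasurableSpace.CountablySeparated β] {f : α → β} (hf : Measurable f)
    (hinj : Function.Injective f) : MeasurableSpace.CountablySeparated α := by
  obtain ⟨S, hS, hSm, hsep⟩ := MeasurableSpace.CountablySeparated.countably_separated (α := β)
  refine ⟨⟨⟨(fun s => f ⁻¹' s) '' S, hS.image _, ?_, ?_⟩⟩⟩
  · rintro _ ⟨s, hs, rfl⟩
    exact hf (hSm s hs)
  · intro x _ y _ h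
    exact hinj (hsep _ trivial _ trivial fun s hs => h _ ⟨s, hs, rfl⟩)

instance : MeasurableSpace.CountablySeparated (TempDist d) :=
  countablySeparated_of_injective measurable_denseEval denseEval_injective

theorem measurable_tempDist_of_apply {α : Type*} [MeasurableSpace α] {X : α → TempDist d}
    (h : ∀ f, Measurable fun a => X a f) : Measurable X := by
  rw [measurable_iff_comap_le, borel_eq_comap_denseEval, MeasurableSpace.comap_comp,
    ← measurable_iff_comap_le]
  exact measurable_pi_iff.2 fun k => h _

/-- A finite measure on tempered distributions is determined by its characteristic functional. -/
theorem measure_tempDist_ext {μ ν : Measure (TempDist d)} [IsFiniteMeasure μ] [IsFiniteMeasure ν]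
    (h : ∀ f : 𝓢(Space d, ℝ), ∫ T : TempDist d, Complex.exp (Complex.I * ((T f : ℝ) : ℂ)) ∂μ =
      ∫ T : TempDist d, Complex.exp (Complex.I * ((T f : ℝ) : ℂ)) ∂ν) : μ = ν := by
  have key : μ.map denseEval = ν.map denseEval := by
    -- A finite measure on a sequence space is determined by its finite-dimensional marginals, and
    -- these by their characteristic functions.
    refine IsProjectiveLimit.unique (P := fun J => (ν.map denseEval).map J.restrict)
      (fun J => ?_) (fun J => rfl)
    refine Measure.ext_of_charFunDual (funext fun L => ?_)
    -- By linearity, a functional of finitely many evaluations is evaluation at a single Schwartz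
    -- function, so the characteristic function of a marginal is a value of the characteristic
    -- functional.
    have hL : ∀ T : TempDist d, L (J.restrict (denseEval T)) =
        T (∑ j : J, L (Pi.single j 1) • TopologicalSpace.denseSeq 𝓢(Space d, ℝ) j) := by
      intro T
      rw [map_sum]
      simp only [map_smul, smul_eq_mul]
      have := LinearMap.pi_apply_eq_sum_univ (L : (J → ℝ) →ₗ[ℝ] ℝ) (J.restrict (denseEval T))
      refine this.trans (Finset.sum_congr rfl fun j _ => ?_)
      rw [smul_eq_mul, mul_comm]
      congr 1
      refine congrArg L (funext fun i => ?_)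
      simp [Pi.single_apply, eq_comm]
    have hm : Measurable fun x : ℕ → ℝ => J.restrict x := Finset.measurable_restrict J
    have hc : ∀ ρ : Measure (TempDist d), charFunDual ((ρ.map denseEval).map J.restrict) L =
        ∫ T, Complex.exp (Complex.I * ((T (∑ j : J, L (Pi.single j 1) •
          TopologicalSpace.denseSeq 𝓢(Space d, ℝ) j) : ℝ) : ℂ)) ∂ρ := by
      intro ρ
      rw [charFunDual_apply, Measure.map_map hm measurable_denseEval, integral_map]
      · refine integral_congr_ae (.of_forall fun T => ?_)
        simp only [Function.comp_apply]
        rw [hL, mul_comm]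
      · exact (hm.comp measurable_denseEval).aemeasurable
      · refine (Measurable.aestronglyMeasurable ?_)
        have : Measurable fun v => L v := L.continuous.measurable
        fun_prop
    rw [hc, hc, h]
  ext B hB
  rw [borel_eq_comap_denseEval] at hB
  obtain ⟨B', hB', rfl⟩ := hB
  rw [← Measure.map_apply measurable_denseEval hB', key, Measure.map_apply measurable_denseEval hB']

end BorelCylinder
-- The FKG inequality for product measures on `ℝ^n`
section FKG

variable {ι : Type*} [Fintype ι]

/-- The FKG inequality on a finite distributive lattice without sign assumptions on the
increasing functions. -/
theorem fkg_of_monotone {α : Type*} [DistribLattice α] [Fintype α] {w F₁ F₂ : α → ℝ} (hw : 0 ≤ w)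
    (h₁ : Monotone F₁) (h₂ : Monotone F₂)
    (hsup : ∀ a b, w a * w b ≤ w (a ⊓ b) * w (a ⊔ b)) :
    (∑ a, w a * F₁ a) * ∑ a, w a * F₂ a ≤ (∑ a, w a) * ∑ a, w a * (F₁ a * F₂ a) := by
  obtain ⟨c₁, hc₁⟩ := (Set.finite_range F₁).bddBelow
  obtain ⟨c₂, hc₂⟩ := (Set.finite_range F₂).bddBelow
  -- The lattice theorem asks for nonnegative functions. Subtracting lower bounds achieves this, and
  -- the constants cancel from the covariance.
  have key := fkg (μ := w) (f := fun a => F₁ a - c₁) (g := fun a => F₂ a - c₂) hw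
    (fun a => sub_nonneg.2 (hc₁ ⟨a, rfl⟩)) (fun a => sub_nonneg.2 (hc₂ ⟨a, rfl⟩))
    (fun a b h => sub_le_sub_right (h₁ h) _) (fun a b h => sub_le_sub_right (h₂ h) _) hsup
  have e₁ : ∑ a, w a * (F₁ a - c₁) = ∑ a, w a * F₁ a - c₁ * ∑ a, w a := by
    rw [Finset.mul_sum, ← Finset.sum_sub_distrib]
    exact Finset.sum_congr rfl fun a _ => by ring
  have e₂ : ∑ a, w a * (F₂ a - c₂) = ∑ a, w a * F₂ a - c₂ * ∑ a, w a := by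
    rw [Finset.mul_sum, ← Finset.sum_sub_distrib]
    exact Finset.sum_congr rfl fun a _ => by ring
  have e₃ : ∑ a, w a * ((F₁ a - c₁) * (F₂ a - c₂)) = ∑ a, w a * (F₁ a * F₂ a) -
      c₂ * ∑ a, w a * F₁ a - c₁ * ∑ a, w a * F₂ a + c₁ * c₂ * ∑ a, w a := by
    rw [Finset.mul_sum, Finset.mul_sum, Finset.mul_sum, ← Finset.sum_sub_distrib,
      ← Finset.sum_sub_distrib, ← Finset.sum_add_distrib]
    exact Finset.sum_congr rfl fun a _ => by ring
  rw [e₁, e₂, e₃] at key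
  linarith

/-- The integral of a function of the quantised coordinates as a finite sum. -/
theorem integral_pi_simpleFunc [DecidableEq ι] (μ : ι → Measure ℝ)
    [∀ i, IsProbabilityMeasure (μ i)] (q : SimpleFunc ℝ ℝ) (f : (ι → ℝ) → ℝ) :
    ∫ x, f (fun i => q (x i)) ∂Measure.pi μ =
      ∑ a : ι → q.range, (∏ i, (μ i).real (q ⁻¹' {(a i : ℝ)})) * f fun i => a i := by
  let q' : ℝ → q.range := fun x => ⟨q x, q.mem_range_self x⟩
  have hq' : Measurable q' := q.measurable.subtype_mk
  have hpi : (Measure.pi μ).map (fun x i => q' (x i)) = Measure.pi fun i => (μ i).map q' :=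
    (Measure.pi_map_pi (fun i => hq'.aemeasurable))
  have hm : Measurable fun (x : ι → ℝ) i => q' (x i) :=
    measurable_pi_iff.2 fun i => hq'.comp (measurable_pi_apply i)
  have h1 : ∫ x, f (fun i => q (x i)) ∂Measure.pi μ =
      ∫ a : ι → q.range, f (fun i => a i) ∂(Measure.pi μ).map (fun x i => q' (x i)) := by
    rw [integral_map hm.aemeasurable]
    exact (Measurable.of_discrete).aestronglyMeasurable
  have (i : ι) : IsProbabilityMeasure ((μ i).map q') := Measure.isProbabilityMeasure_map hq'.aemeasurable
  rw [h1, hpi, integral_fintype .of_finite]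
  refine Finset.sum_congr rfl fun a _ => ?_
  rw [smul_eq_mul]
  congr 1
  rw [measureReal_def, Measure.pi_singleton, ENNReal.toReal_prod]
  refine Finset.prod_congr rfl fun i _ => ?_
  rw [Measure.map_apply hq' (measurableSet_singleton _), measureReal_def]
  congr 2
  ext x
  simp [q', Subtype.ext_iff]

/-- After rounding, the integrals are sums over `ι → q.range`, a finite product of chains and so a
finite distributive lattice. The product weights satisfy the lattice condition with equality, so
only the supermodularity of `ρ` is used. -/
theorem fkg_quantised (μ : ι → Measure ℝ) [∀ i, IsProbabilityMeasure (μ i)] (q : SimpleFunc ℝ ℝ)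
    {F₁ F₂ ρ : (ι → ℝ) → ℝ} (h₁ : Monotone F₁) (h₂ : Monotone F₂) (hρ : 0 ≤ ρ)
    (hsup : ∀ a b, ρ a * ρ b ≤ ρ (a ⊓ b) * ρ (a ⊔ b)) :
    (∫ x, ρ (fun i => q (x i)) * F₁ (fun i => q (x i)) ∂Measure.pi μ) *
        ∫ x, ρ (fun i => q (x i)) * F₂ (fun i => q (x i)) ∂Measure.pi μ ≤
      (∫ x, ρ (fun i => q (x i)) ∂Measure.pi μ) *
        ∫ x, ρ (fun i => q (x i)) * (F₁ (fun i => q (x i)) * F₂ fun i => q (x i)) ∂Measure.pi μ := by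
  classical
  rw [integral_pi_simpleFunc μ q (fun x => ρ x * F₁ x),
    integral_pi_simpleFunc μ q (fun x => ρ x * F₂ x), integral_pi_simpleFunc μ q ρ,
    integral_pi_simpleFunc μ q (fun x => ρ x * (F₁ x * F₂ x))]
  simp only [← mul_assoc]
  simp only [mul_assoc _ (F₁ _) (F₂ _)]
  let val : (ι → q.range) → ι → ℝ := fun a i => a i
  have hval : Monotone val := fun a b h i => h i
  refine fkg_of_monotone (w := fun a : ι → q.range =>
    (∏ i, (μ i).real (q ⁻¹' {(a i : ℝ)})) * ρ (val a)) (F₁ := F₁ ∘ val) (F₂ := F₂ ∘ val)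
    (fun a => mul_nonneg (Finset.prod_nonneg fun i _ => measureReal_nonneg) (hρ _))
    (h₁.comp hval) (h₂.comp hval) fun a b => ?_
  -- In each coordinate the pair of the minimum and the maximum is the original pair, possibly
  -- swapped.
  have hprod : (∏ i, (μ i).real (q ⁻¹' {(a i : ℝ)})) * (∏ i, (μ i).real (q ⁻¹' {(b i : ℝ)})) =
      (∏ i, (μ i).real (q ⁻¹' {((a ⊓ b) i : ℝ)})) *
        ∏ i, (μ i).real (q ⁻¹' {((a ⊔ b) i : ℝ)}) := by
    rw [← Finset.prod_mul_distrib, ← Finset.prod_mul_distrib]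
    refine Finset.prod_congr rfl fun i _ => ?_
    rw [Pi.inf_apply, Pi.sup_apply]
    rcases le_total (a i) (b i) with h | h
    · rw [inf_eq_left.2 h, sup_eq_right.2 h]
    · rw [inf_eq_right.2 h, sup_eq_left.2 h, mul_comm]
  have hinf : val (a ⊓ b) = val a ⊓ val b := by
    funext i
    rcases le_total (a i) (b i) with h | h
    · simpa [val, inf_eq_left.2 h] using h
    · simpa [val, inf_eq_right.2 h] using h
  have hsup' : val (a ⊔ b) = val a ⊔ val b := by
    funext i
    rcases le_total (a i) (b i) with h | h
    · simpa [val, sup_eq_right.2 h] using h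
    · simpa [val, sup_eq_left.2 h] using h
  rw [mul_mul_mul_comm, mul_mul_mul_comm _ (ρ (val (a ⊓ b))), hprod, hinf, hsup']
  exact mul_le_mul_of_nonneg_left (hsup _ _)
    (mul_nonneg (Finset.prod_nonneg fun i _ => measureReal_nonneg)
      (Finset.prod_nonneg fun i _ => measureReal_nonneg))

/-- Quantisation of real numbers by simple functions. -/
noncomputable def quantise (n : ℕ) : SimpleFunc ℝ ℝ :=
  SimpleFunc.approxOn (id : ℝ → ℝ) measurable_id Set.univ 0 (Set.mem_univ 0) n

theorem tendsto_quantise (x : ℝ) : Tendsto (fun n => quantise n x) atTop (𝓝 x) :=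
  SimpleFunc.tendsto_approxOn (f := (id : ℝ → ℝ)) measurable_id (Set.mem_univ 0) (by simp)

/-- Approximation starts from the value `0`, so the error is at most `|x|`. The factor `2` is
uniform in `n`, hence usable in a majorant; it doubles the exponent in `tendsto_integral_quantise`.
-/
theorem abs_quantise_le (n : ℕ) (x : ℝ) : |quantise n x| ≤ 2 * |x| := by
  have h := SimpleFunc.edist_approxOn_y0_le (f := (id : ℝ → ℝ)) measurable_id
    (Set.mem_univ 0) x n
  rw [edist_comm, edist_dist, edist_dist, ← ENNReal.ofReal_add dist_nonneg dist_nonneg,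
    ENNReal.ofReal_le_ofReal_iff (by positivity)] at h
  simp only [Real.dist_eq, id, sub_zero, zero_sub, abs_neg] at h
  change |quantise n x| ≤ _ at h
  linarith

theorem integrable_exp_sum_abs (μ : ι → Measure ℝ) [∀ i, IsProbabilityMeasure (μ i)]
    (hμ : ∀ i, ∀ κ : ℝ, Integrable (fun x => Real.exp (κ * |x|)) (μ i)) (κ : ℝ) :
    Integrable (fun x : ι → ℝ => Real.exp (κ * ∑ i, |x i|)) (Measure.pi μ) := by
  simp only [Finset.mul_sum, Real.exp_sum]
  exact Integrable.fintype_prod (f := fun i x => Real.exp (κ * |x|)) fun i => hμ i κ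

theorem tendsto_integral_quantise (μ : ι → Measure ℝ) [∀ i, IsProbabilityMeasure (μ i)]
    (hμ : ∀ i, ∀ κ : ℝ, Integrable (fun x => Real.exp (κ * |x|)) (μ i)) {f : (ι → ℝ) → ℝ}
    (hf : Continuous f) {K κ : ℝ} (hκ : 0 ≤ κ) (hK : 0 ≤ K)
    (hb : ∀ x, |f x| ≤ K * Real.exp (κ * ∑ i, |x i|)) :
    Tendsto (fun n => ∫ x, f (fun i => quantise n (x i)) ∂Measure.pi μ) atTop
      (𝓝 (∫ x, f x ∂Measure.pi μ)) := by
  refine tendsto_integral_of_dominated_convergence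
    (fun x => K * Real.exp ((2 * κ) * ∑ i, |x i|)) (fun n => ?_)
    ((integrable_exp_sum_abs μ hμ _).const_mul K) (fun n => .of_forall fun x => ?_)
    (.of_forall fun x => ?_)
  · refine (hf.measurable.comp ?_).aestronglyMeasurable
    exact measurable_pi_iff.2 fun i => (quantise n).measurable.comp (measurable_pi_apply i)
  · refine (hb _).trans (mul_le_mul_of_nonneg_left (Real.exp_le_exp.2 ?_) hK)
    rw [mul_comm 2 κ, mul_assoc, Finset.mul_sum (a := (2 : ℝ))]
    exact mul_le_mul_of_nonneg_left (Finset.sum_le_sum fun i _ => abs_quantise_le n (x i)) hκ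
  · exact (hf.tendsto x).comp (tendsto_pi_nhds.2 fun i => tendsto_quantise (x i))

/-- The FKG inequality for a log-supermodular density with respect to a product measure. -/
theorem fkg_pi (μ : ι → Measure ℝ) [∀ i, IsProbabilityMeasure (μ i)]
    (hμ : ∀ i, ∀ κ : ℝ, Integrable (fun x => Real.exp (κ * |x|)) (μ i))
    {F₁ F₂ ρ : (ι → ℝ) → ℝ} (hc₁ : Continuous F₁) (hc₂ : Continuous F₂) (hcρ : Continuous ρ)
    (h₁ : Monotone F₁) (h₂ : Monotone F₂) (hρ : 0 ≤ ρ)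
    (hsup : ∀ a b, ρ a * ρ b ≤ ρ (a ⊓ b) * ρ (a ⊔ b))
    {K₁ K₂ K₃ κ₁ κ₂ κ₃ : ℝ} (hK₁ : 0 ≤ K₁) (hK₂ : 0 ≤ K₂) (hK₃ : 0 ≤ K₃) (hκ₁ : 0 ≤ κ₁)
    (hκ₂ : 0 ≤ κ₂) (hκ₃ : 0 ≤ κ₃)
    (hb₁ : ∀ x, |F₁ x| ≤ K₁ * Real.exp (κ₁ * ∑ i, |x i|))
    (hb₂ : ∀ x, |F₂ x| ≤ K₂ * Real.exp (κ₂ * ∑ i, |x i|))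
    (hb₃ : ∀ x, |ρ x| ≤ K₃ * Real.exp (κ₃ * ∑ i, |x i|)) :
    (∫ x, ρ x * F₁ x ∂Measure.pi μ) * ∫ x, ρ x * F₂ x ∂Measure.pi μ ≤
      (∫ x, ρ x ∂Measure.pi μ) * ∫ x, ρ x * (F₁ x * F₂ x) ∂Measure.pi μ := by
  have hmul : ∀ {f g : (ι → ℝ) → ℝ} {K K' κ κ' : ℝ}, 0 ≤ K →
      (∀ x, |f x| ≤ K * Real.exp (κ * ∑ i, |x i|)) →
      (∀ x, |g x| ≤ K' * Real.exp (κ' * ∑ i, |x i|)) →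
      ∀ x, |f x * g x| ≤ (K * K') * Real.exp ((κ + κ') * ∑ i, |x i|) := by
    intro f g K K' κ κ' hK hf hg x
    rw [abs_mul, add_mul, Real.exp_add, mul_mul_mul_comm]
    exact mul_le_mul (hf x) (hg x) (abs_nonneg _) (by positivity)
  refine le_of_tendsto_of_tendsto'
    ((tendsto_integral_quantise μ hμ (hcρ.mul hc₁) (by positivity) (by positivity)
      (hmul hK₃ hb₃ hb₁)).mul
      (tendsto_integral_quantise μ hμ (hcρ.mul hc₂) (by positivity) (by positivity)
      (hmul hK₃ hb₃ hb₂)))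
    ((tendsto_integral_quantise μ hμ hcρ hκ₃ hK₃ hb₃).mul
      (tendsto_integral_quantise μ hμ (hcρ.mul (hc₁.mul hc₂)) (by positivity) (by positivity)
      (hmul hK₃ hb₃ (hmul hK₁ hb₁ hb₂)))) fun n => ?_
  exact fkg_quantised μ (quantise n) h₁ h₂ hρ hsup

end FKG
-- Independent Poisson blocks: generating functions and exponential moments
section PoissonProducts

theorem integral_prod_infinitePi {ι : Type*} {E : ι → Type*} [∀ i, MeasurableSpace (E i)]
    (ν : ∀ i, Measure (E i)) [∀ i, IsProbabilityMeasure (ν i)] (s : Finset ι)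
    {u : ∀ i, E i → ℂ} (hu : ∀ i, Measurable (u i)) :
    ∫ e, ∏ i ∈ s, u i (e i) ∂Measure.infinitePi ν = ∏ i ∈ s, ∫ x, u i x ∂ν i := by
  have h1 : ∀ e : ∀ i, E i, ∏ i ∈ s, u i (e i) = ∏ i : s, u i (s.restrict e i) := fun e =>
    (Finset.prod_coe_sort s fun i => u i (e i)).symm
  simp_rw [h1]
  rw [integral_restrict_infinitePi ν (f := fun e : (i : s) → E i => ∏ i : s, u i (e i)),
    integral_fintype_prod_eq_prod (f := fun (i : s) x => u i x),
    Finset.prod_coe_sort s fun i => ∫ x, u i x ∂ν i]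
  exact (Finset.measurable_fun_prod (f := fun (i : s) (e : (i : s) → E i) => u i (e i)) _ fun i _ =>
    (hu i).comp (measurable_pi_apply i)).aestronglyMeasurable

theorem lintegral_prod_infinitePi {ι : Type*} {E : ι → Type*} [∀ i, MeasurableSpace (E i)]
    (ν : ∀ i, Measure (E i)) [∀ i, IsProbabilityMeasure (ν i)] (s : Finset ι)
    {u : ∀ i, E i → ENNReal} (hu : ∀ i, Measurable (u i)) :
    ∫⁻ e, ∏ i ∈ s, u i (e i) ∂Measure.infinitePi ν = ∏ i ∈ s, ∫⁻ x, u i x ∂ν i := by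
  refine (lintegral_prod_eq_prod_lintegral_of_indepFun s (fun i (e : ∀ i, E i) => u i (e i))
    (iIndepFun_infinitePi hu) fun i => (hu i).comp (measurable_pi_apply i)).trans ?_
  refine Finset.prod_congr rfl fun i _ => ?_
  exact (measurePreserving_eval_infinitePi ν i).lintegral_comp (hu i)

theorem integral_pow_poissonMeasure (m : NNReal) (a : ℂ) :
    ∫ n, a ^ n ∂poissonMeasure m = Complex.exp (m * (a - 1)) := by
  rw [integral_poissonMeasure, mul_sub, mul_one, sub_eq_neg_add, Complex.exp_add,
    congrFun Complex.exp_eq_exp_ℂ (m * a), NormedSpace.exp_eq_tsum_div, ← tsum_mul_left]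
  refine tsum_congr fun n => ?_
  rw [Complex.real_smul]
  push_cast
  ring

theorem lintegral_pow_poissonMeasure (m : NNReal) {a : ℝ} (ha : 0 ≤ a) :
    ∫⁻ n, ENNReal.ofReal a ^ n ∂poissonMeasure m = ENNReal.ofReal (Real.exp (m * (a - 1))) := by
  have hint : Integrable (fun n : ℕ => a ^ n) (poissonMeasure m) := by
    rw [integrable_poissonMeasure_iff]
    have := (Real.summable_pow_div_factorial (m * a)).mul_left (Real.exp (-m))
    refine this.congr fun n => ?_
    rw [Real.norm_of_nonneg (pow_nonneg ha n), mul_pow]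
    ring
  simp_rw [← ENNReal.ofReal_pow ha]
  rw [← ofReal_integral_eq_lintegral_ofReal hint (.of_forall fun n => pow_nonneg ha n)]
  congr 1
  have h := integral_pow_poissonMeasure m a
  rw [← Complex.ofReal_inj]
  push_cast
  rw [← h, ← integral_complex_ofReal]
  simp

variable {E : Type*} [MeasurableSpace E] (m : ℕ → NNReal) (ν : ℕ → Measure E)
  [∀ k, IsProbabilityMeasure (ν k)]

/-- The law of independent Poisson numbers `n k` with means `m k` and independent points `e (k, j)`
with laws `ν k`. -/
noncomputable def poissonLaw : Measure ((ℕ → ℕ) × (ℕ × ℕ → E)) :=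
  (Measure.infinitePi fun k => poissonMeasure (m k)).prod (Measure.infinitePi fun i => ν i.1)

instance : IsProbabilityMeasure (poissonLaw m ν) := by
  unfold poissonLaw
  infer_instance

/-- The indices of the points present in the first `K` blocks. -/
def blockIndices (K : ℕ) (n : ℕ → ℕ) : Finset (ℕ × ℕ) :=
  (Finset.range K).biUnion fun k => (Finset.range (n k)).image (Prod.mk k)

theorem prod_blockIndices {M : Type*} [CommMonoid M] (K : ℕ) (n : ℕ → ℕ) (f : ℕ × ℕ → M) :
    ∏ i ∈ blockIndices K n, f i = ∏ k ∈ Finset.range K, ∏ j ∈ Finset.range (n k), f (k, j) := by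
  rw [blockIndices, Finset.prod_biUnion]
  · refine Finset.prod_congr rfl fun k _ => ?_
    rw [Finset.prod_image fun a _ b _ h => (Prod.mk.inj h).2]
  · intro k _ l _ hkl
    simp only [Function.onFun, Finset.disjoint_left, Finset.mem_image]
    rintro _ ⟨a, -, rfl⟩ ⟨b, -, h⟩
    exact hkl (Prod.mk.inj h).1.symm

theorem mem_blockIndices {K : ℕ} {n : ℕ → ℕ} {i : ℕ × ℕ} :
    i ∈ blockIndices K n ↔ i.1 < K ∧ i.2 < n i.1 := by
  obtain ⟨k, j⟩ := i
  simp [blockIndices]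

theorem measurable_prod_blockIndices {M : Type*} [CommMonoid M] [MeasurableSpace M]
    [MeasurableMul₂ M] {u : E → M} (hu : Measurable u) (K : ℕ) :
    Measurable fun ω : (ℕ → ℕ) × (ℕ × ℕ → E) => ∏ i ∈ blockIndices K ω.1, u (ω.2 i) := by
  simp_rw [prod_blockIndices]
  refine Finset.measurable_fun_prod _ fun k _ => ?_
  have h : Measurable fun p : ℕ × (ℕ × ℕ → E) => ∏ j ∈ Finset.range p.1, u (p.2 (k, j)) := by
    refine measurable_from_prod_countable_right fun n => ?_
    exact Finset.measurable_fun_prod (f := fun j (e : ℕ × ℕ → E) => u (e (k, j)))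
      (Finset.range n) fun j _ =>
      hu.comp (measurable_pi_apply (k, j))
  have hk : Measurable fun ω : (ℕ → ℕ) × (ℕ × ℕ → E) => (ω.1 k, ω.2) :=
    ((measurable_pi_apply k).comp measurable_fst).prodMk measurable_snd
  exact h.comp hk

/-- Given the numbers of points, the points are independent and the mean of the product is `∏ (∫
u)^(n k)`; the Poisson generating function turns each factor into an exponential. Restriction to `K`
blocks keeps the products finite. -/
theorem integral_prod_poissonLaw {u : E → ℂ} (hu : Measurable u) (hu1 : ∀ x, ‖u x‖ ≤ 1) (K : ℕ) :
    ∫ ω, ∏ i ∈ blockIndices K ω.1, u (ω.2 i) ∂poissonLaw m ν =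
      Complex.exp (∑ k ∈ Finset.range K, m k * (∫ x, u x ∂ν k - 1)) := by
  rw [poissonLaw, integral_prod]
  · have h1 : ∀ n : ℕ → ℕ, ∫ e, ∏ i ∈ blockIndices K n, u (e i) ∂(Measure.infinitePi fun i : ℕ × ℕ =>
        ν i.1) = ∏ k ∈ Finset.range K, (∫ x, u x ∂ν k) ^ n k := by
      intro n
      rw [integral_prod_infinitePi (fun i : ℕ × ℕ => ν i.1) _ (u := fun _ => u) fun _ => hu,
        prod_blockIndices]
      simp
    simp_rw [h1]
    rw [integral_prod_infinitePi (fun k => poissonMeasure (m k)) (Finset.range K)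
      (u := fun k n => (∫ x, u x ∂ν k) ^ n) fun _ => .of_discrete, Complex.exp_sum]
    simp_rw [integral_pow_poissonMeasure]
  · refine Integrable.of_bound (measurable_prod_blockIndices hu K).aestronglyMeasurable 1
      (.of_forall fun ω => ?_)
    rw [norm_prod]
    exact Finset.prod_le_one (fun _ _ => norm_nonneg _) fun _ _ => hu1 _

/-- The same computation in `[0, ∞]`, where unbounded `u` needs no prior integrability of the
product. -/
theorem lintegral_prod_poissonLaw {u : E → ENNReal} (hu : Measurable u) {a : ℕ → ℝ}
    (ha : ∀ k, 0 ≤ a k) (hua : ∀ k, ∫⁻ x, u x ∂ν k = ENNReal.ofReal (a k)) (K : ℕ) :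
    ∫⁻ ω, ∏ i ∈ blockIndices K ω.1, u (ω.2 i) ∂poissonLaw m ν =
      ENNReal.ofReal (Real.exp (∑ k ∈ Finset.range K, m k * (a k - 1))) := by
  rw [poissonLaw, lintegral_prod _ (measurable_prod_blockIndices hu K).aemeasurable]
  have h1 : ∀ n : ℕ → ℕ, ∫⁻ e, ∏ i ∈ blockIndices K n, u (e i) ∂(Measure.infinitePi fun i : ℕ × ℕ =>
      ν i.1) = ∏ k ∈ Finset.range K, (ENNReal.ofReal (a k)) ^ n k := by
    intro n
    rw [lintegral_prod_infinitePi (fun i : ℕ × ℕ => ν i.1) _ (u := fun _ => u) fun _ => hu,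
      prod_blockIndices]
    simp [hua]
  simp_rw [h1]
  rw [lintegral_prod_infinitePi (fun k => poissonMeasure (m k)) (Finset.range K)
    (u := fun k n => (ENNReal.ofReal (a k)) ^ n) fun _ => .of_discrete, Real.exp_sum,
    ENNReal.ofReal_prod_of_nonneg fun _ _ => (Real.exp_pos _).le]
  exact Finset.prod_congr rfl fun k _ => lintegral_pow_poissonMeasure (m k) (ha k)

/-- Exponential moments of nonnegative sums over the points. -/
theorem exists_exp_moment_poissonLaw {ψ : E → ℝ} (hψ : Measurable ψ) (h0 : ∀ x, 0 ≤ ψ x)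
    (hint : ∀ k, Integrable (fun x => Real.exp (ψ x)) (ν k)) {c : ℝ}
    (hc : ∀ K, ∑ k ∈ Finset.range K, m k * (∫ x, Real.exp (ψ x) ∂ν k - 1) ≤ c) :
    (∀ᵐ ω ∂poissonLaw m ν, Summable fun i : ℕ × ℕ => if i.2 < ω.1 i.1 then ψ (ω.2 i) else 0) ∧
      Integrable (fun ω : (ℕ → ℕ) × (ℕ × ℕ → E) =>
        Real.exp (∑' i : ℕ × ℕ, if i.2 < ω.1 i.1 then ψ (ω.2 i) else 0)) (poissonLaw m ν) := by
  set D : ℕ → (ℕ → ℕ) × (ℕ × ℕ → E) → ENNReal := fun K ω =>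
    ∏ i ∈ blockIndices K ω.1, ENNReal.ofReal (Real.exp (ψ (ω.2 i))) with hD
  have hDm : ∀ K, Measurable (D K) := fun K =>
    measurable_prod_blockIndices (Real.measurable_exp.comp hψ).ennreal_ofReal K
  have hmono : Monotone D := by
    intro K L hKL ω
    refine Finset.prod_le_prod_of_subset_of_one_le' (fun i hi => ?_) fun i _ _ => ?_
    · rw [mem_blockIndices] at *
      exact ⟨hi.1.trans_le hKL, hi.2⟩
    · rw [ENNReal.one_le_ofReal]
      exact Real.one_le_exp (h0 _)
  -- The products increase with the number of blocks, so monotone convergence transfers the uniform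
  -- bound `exp c` to their supremum.
  have hbound : ∫⁻ ω, ⨆ K, D K ω ∂poissonLaw m ν ≤ ENNReal.ofReal (Real.exp c) := by
    rw [lintegral_iSup hDm hmono]
    refine iSup_le fun K => ?_
    rw [hD, lintegral_prod_poissonLaw m ν (u := fun x => ENNReal.ofReal (Real.exp (ψ x)))
      (Real.measurable_exp.comp hψ).ennreal_ofReal
      (a := fun k => ∫ x, Real.exp (ψ x) ∂ν k) (fun k => integral_nonneg fun _ => (Real.exp_pos _).le)
      fun k => (ofReal_integral_eq_lintegral_ofReal (hint k)
        (.of_forall fun _ => (Real.exp_pos _).le)).symm]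
    exact ENNReal.ofReal_le_ofReal (Real.exp_le_exp.2 (hc K))
  have hfin : ∀ᵐ ω ∂poissonLaw m ν, ⨆ K, D K ω < ⊤ :=
    ae_lt_top (Measurable.iSup hDm) (hbound.trans_lt ENNReal.ofReal_lt_top).ne
  -- Every finite partial sum lies below the sum over some number of blocks. Finiteness of the
  -- supremum then gives both summability and the bound on the total sum.
  have hsum : ∀ ω, ⨆ K, D K ω < ⊤ → ∀ s : Finset (ℕ × ℕ),
      Real.exp (∑ i ∈ s, if i.2 < ω.1 i.1 then ψ (ω.2 i) else 0) ≤ (⨆ K, D K ω).toReal := by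
    intro ω hω s
    obtain ⟨K, hK⟩ : ∃ K, ∀ i ∈ s, i.1 < K :=
      -- One more than the largest block index, since `blockIndices K` stops before `K`.
      ⟨s.sup (fun i => i.1) + 1, fun i hi => Nat.lt_succ_of_le (Finset.le_sup (f := fun i => i.1) hi)⟩
    have h1 : ENNReal.ofReal (Real.exp (∑ i ∈ s, if i.2 < ω.1 i.1 then ψ (ω.2 i) else 0)) ≤
        D K ω := by
      rw [hD]
      dsimp only
      rw [← ENNReal.ofReal_prod_of_nonneg fun _ _ => (Real.exp_pos _).le, ← Real.exp_sum,
        ← Finset.sum_filter]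
      refine ENNReal.ofReal_le_ofReal (Real.exp_le_exp.2 ?_)
      refine Finset.sum_le_sum_of_subset_of_nonneg (fun i hi => ?_) fun _ _ _ => h0 _
      rw [Finset.mem_filter] at hi
      exact mem_blockIndices.2 ⟨hK i hi.1, hi.2⟩
    exact (ENNReal.ofReal_le_iff_le_toReal hω.ne).1 (h1.trans (le_iSup (fun K => D K ω) K))
  have hnn : ∀ ω : (ℕ → ℕ) × (ℕ × ℕ → E),
      0 ≤ fun i : ℕ × ℕ => if i.2 < ω.1 i.1 then ψ (ω.2 i) else 0 := by
    intro ω i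
    dsimp only
    split_ifs
    exacts [h0 _, le_rfl]
  have hpos : ∀ ω, ⨆ K, D K ω < ⊤ → 0 < (⨆ K, D K ω).toReal := fun ω hω =>
    (Real.exp_pos _).trans_le (hsum ω hω ∅)
  refine ⟨?_, ?_⟩
  · filter_upwards [hfin] with ω hω
    exact summable_of_sum_le (c := Real.log (⨆ K, D K ω).toReal) (hnn ω) fun s =>
      (Real.le_log_iff_exp_le (hpos ω hω)).2 (hsum ω hω s)
  · have hm : Measurable fun ω : (ℕ → ℕ) × (ℕ × ℕ → E) =>
        ∑' i : ℕ × ℕ, if i.2 < ω.1 i.1 then ψ (ω.2 i) else 0 := by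
      refine Measurable.tsum fun i => Measurable.ite ?_ ?_ measurable_const
      · exact measurableSet_lt measurable_const ((measurable_pi_apply i.1).comp measurable_fst)
      · exact hψ.comp ((measurable_pi_apply i).comp measurable_snd)
    refine ⟨(Real.measurable_exp.comp hm).aestronglyMeasurable, ?_⟩
    refine lt_of_le_of_lt (lintegral_mono_ae ?_) (hbound.trans_lt ENNReal.ofReal_lt_top)
    filter_upwards [hfin] with ω hω
    rw [Real.enorm_of_nonneg (Real.exp_pos _).le, ENNReal.ofReal_le_iff_le_toReal hω.ne,
      ← Real.le_log_iff_exp_le (hpos ω hω)]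
    exact Real.tsum_le_of_sum_le (hnn ω) fun s =>
      (Real.le_log_iff_exp_le (hpos ω hω)).2 (hsum ω hω s)

end PoissonProducts
-- The Lévy characteristic and the decomposition of space into shells
section Levy

variable {z C : ℝ} {r : Measure ℝ}

theorem ae_abs_le_of_compl_Icc (hr : r (Set.Icc (-C) C)ᶜ = 0) : ∀ᵐ s ∂r, |s| ≤ C := by
  have h : ∀ᵐ s ∂r, s ∈ Set.Icc (-C) C := mem_ae_iff.2 hr
  filter_upwards [h] with s hs
  exact abs_le.2 hs

variable [IsProbabilityMeasure r]

/-- Follows from `|e^{ist} - 1| ≤ |s t|` and the bounded charges. It makes `ψ ∘ f` integrable for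
every integrable `f`. -/
theorem norm_levyChar_le (hr : r (Set.Icc (-C) C)ᶜ = 0) (t : ℝ) :
    ‖levyChar z r t‖ ≤ |z| * (C * |t|) := by
  rw [levyChar, norm_mul, Complex.norm_real, Real.norm_eq_abs]
  refine mul_le_mul_of_nonneg_left ?_ (abs_nonneg z)
  have h : ∀ᵐ s : ℝ ∂r, ‖Complex.exp (Complex.I * s * t) - 1‖ ≤ C * |t| := by
    filter_upwards [ae_abs_le_of_compl_Icc hr] with s hs
    have h1 := Real.norm_exp_I_mul_ofReal_sub_one_le (x := s * t)
    rw [Complex.ofReal_mul, ← mul_assoc, Real.norm_eq_abs, abs_mul] at h1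
    exact h1.trans (mul_le_mul_of_nonneg_right hs (abs_nonneg t))
  have := norm_integral_le_of_norm_le_const h
  simpa using this

theorem continuous_levyChar : Continuous (levyChar z r) := by
  refine continuous_const.mul (continuous_of_dominated (bound := fun _ => 2) (fun t => ?_)
    (fun t => .of_forall fun s => ?_) (integrable_const _) (.of_forall fun s => ?_))
  · exact (by fun_prop : Continuous fun s : ℝ =>
      Complex.exp (Complex.I * s * t) - 1).aestronglyMeasurable
  · refine (norm_sub_le _ _).trans ?_
    have : Complex.I * s * t = ((s * t : ℝ) : ℂ) * Complex.I := by push_cast; ring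
    rw [this, Complex.norm_exp_ofReal_mul_I, norm_one]
    norm_num
  · fun_prop

end Levy

section Shells

variable (d : ℕ)

/-- The spherical shells `k ≤ |y| < k + 1`. -/
def shell (k : ℕ) : Set (Space d) := Metric.ball 0 (k + 1) \ Metric.ball 0 k

theorem mem_shell {k : ℕ} {y : Space d} : y ∈ shell d k ↔ ⌊‖y‖⌋₊ = k := by
  rw [Nat.floor_eq_iff (norm_nonneg y), shell]
  simp [and_comm]

theorem measurableSet_shell (k : ℕ) : MeasurableSet (shell d k) :=
  measurableSet_ball.diff measurableSet_ball

theorem iUnion_shell : ⋃ k, shell d k = Set.univ :=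
  Set.eq_univ_of_forall fun _ => Set.mem_iUnion.2 ⟨_, (mem_shell d).2 rfl⟩

theorem pairwise_disjoint_shell : Pairwise (Function.onFun Disjoint (shell d)) := by
  intro k l hkl
  refine Set.disjoint_left.2 fun y hk hl => hkl ?_
  rw [mem_shell] at hk hl
  exact hk.symm.trans hl

theorem volume_shell_lt_top (k : ℕ) : volume (shell d k) < ⊤ :=
  (measure_mono Set.sdiff_subset).trans_lt measure_ball_lt_top

/-- Positive volume permits conditioning on the shell. The assumption `0 < d` is essential: in
dimension zero all shells but the first are empty. -/
theorem volume_shell_pos (hd : 0 < d) (k : ℕ) : 0 < volume (shell d k) := by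
  have : Nonempty (Fin d) := ⟨⟨0, hd⟩⟩
  have hsub : Metric.ball (0 : Space d) k ⊆ Metric.ball 0 (k + 1) :=
    Metric.ball_subset_ball (by linarith)
  rw [shell, measure_sdiff hsub measurableSet_ball.nullMeasurableSet measure_ball_lt_top.ne,
    tsub_pos_iff_lt, Measure.addHaar_ball volume (0 : Space d) (r := (k : ℝ)) k.cast_nonneg,
    Measure.addHaar_ball volume (0 : Space d) (r := (k : ℝ) + 1) (by positivity)]
  have h0 : volume (Metric.ball (0 : Space d) 1) ≠ 0 :=
    (Metric.measure_ball_pos volume (0 : Space d) one_pos).ne'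
  have h1 : volume (Metric.ball (0 : Space d) 1) ≠ ⊤ := measure_ball_lt_top.ne
  refine (ENNReal.mul_lt_mul_iff_left h0 h1).2 ((ENNReal.ofReal_lt_ofReal_iff_of_nonneg (pow_nonneg k.cast_nonneg _)).2 ?_)
  exact pow_lt_pow_left₀ (by linarith) (by positivity) (by simpa using hd.ne')

variable (r : Measure ℝ)

/-- The law of a point uniform in a shell with an independent charge. -/
noncomputable def shellLaw (k : ℕ) : Measure (Space d × ℝ) := (volume[|shell d k]).prod r

/-- The mean number of points in a shell. -/
noncomputable def shellMean (z : ℝ) (k : ℕ) : NNReal := z.toNNReal * (volume (shell d k)).toNNReal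

variable {d r}

theorem isProbabilityMeasure_cond_shell (hd : 0 < d) (k : ℕ) :
    IsProbabilityMeasure (volume[|shell d k]) :=
  cond_isProbabilityMeasure_of_finite (volume_shell_pos d hd k).ne' (volume_shell_lt_top d k).ne

theorem isProbabilityMeasure_shellLaw [IsProbabilityMeasure r] (hd : 0 < d) (k : ℕ) :
    IsProbabilityMeasure (shellLaw d r k) := by
  have := isProbabilityMeasure_cond_shell hd k
  unfold shellLaw
  infer_instance

/-- The mean number of points is `z` times the volume, which cancels the normalization of the
uniform law. Poisson exponents of the shells thus become pieces of one integral over space. -/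
theorem shellMean_smul_integral {F : Type*} [NormedAddCommGroup F] [NormedSpace ℝ F]
    [CompleteSpace F] [IsProbabilityMeasure r] (hd : 0 < d) {z : ℝ} (hz : 0 < z) (k : ℕ)
    {u : Space d × ℝ → F} (hu : Integrable u (shellLaw d r k)) :
    (shellMean d z k : ℝ) • ∫ x, u x ∂shellLaw d r k =
      ∫ y in shell d k, z • ∫ s, u (y, s) ∂r := by
  have := isProbabilityMeasure_cond_shell hd k
  rw [shellLaw, integral_prod _ hu, ProbabilityTheory.cond, integral_smul_measure, smul_smul,
    integral_smul, shellMean]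
  congr 1
  have h0 : (volume (shell d k)).toReal ≠ 0 :=
    (ENNReal.toReal_pos (volume_shell_pos d hd k).ne' (volume_shell_lt_top d k).ne).ne'
  rw [ENNReal.toReal_inv]
  push_cast
  rw [Real.coe_toNNReal _ hz.le, mul_assoc, mul_inv_cancel₀ h0,
    mul_one]

theorem norm_le_one_char {x : ℝ} : ‖Complex.exp (Complex.I * x)‖ ≤ 1 := by
  rw [mul_comm, Complex.norm_exp_ofReal_mul_I]

theorem sum_shellMean_char [IsProbabilityMeasure r] (hd : 0 < d) {z C : ℝ} (hz : 0 < z)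
    (hr : r (Set.Icc (-C) C)ᶜ = 0) {f : Space d → ℝ} (hf : Measurable f) (hfi : Integrable f) :
    Tendsto (fun K => ∑ k ∈ Finset.range K, (shellMean d z k : ℂ) *
      (∫ x, Complex.exp (Complex.I * ((x.2 * f x.1 : ℝ) : ℂ)) ∂shellLaw d r k - 1)) atTop
      (𝓝 (∫ y, levyChar z r (f y))) := by
  have hint : Integrable fun y => levyChar z r (f y) := by
    refine Integrable.mono' ((hfi.abs.const_mul C).const_mul |z|)
      (continuous_levyChar.measurable.comp hf).aestronglyMeasurable
      (.of_forall fun y => norm_levyChar_le hr _)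
  have h := hasSum_integral_iUnion (measurableSet_shell d) (pairwise_disjoint_shell d)
    (hint.integrableOn (s := ⋃ k, shell d k))
  rw [iUnion_shell, setIntegral_univ] at h
  refine h.tendsto_sum_nat.congr fun K => Finset.sum_congr rfl fun k _ => ?_
  have := isProbabilityMeasure_shellLaw (r := r) hd k
  have hu : Measurable fun x : Space d × ℝ => Complex.exp (Complex.I * ((x.2 * f x.1 : ℝ) : ℂ)) := by
    fun_prop
  have hui : Integrable (fun x : Space d × ℝ => Complex.exp (Complex.I * ((x.2 * f x.1 : ℝ) : ℂ)))
      (shellLaw d r k) :=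
    Integrable.of_bound hu.aestronglyMeasurable 1 (.of_forall fun _ => norm_le_one_char)
  have h1 := shellMean_smul_integral hd hz k (hui.sub (integrable_const (1 : ℂ)))
  rw [integral_sub' hui (integrable_const _)] at h1
  simp only [integral_const, probReal_univ, one_smul, Complex.real_smul, Pi.sub_apply] at h1
  rw [show ((shellMean d z k : ℝ) : ℂ) = (shellMean d z k : ℂ) from rfl] at h1
  rw [h1]
  refine integral_congr_ae (.of_forall fun y => ?_)
  simp only [levyChar, Complex.ofReal_mul, mul_assoc]

theorem sum_shellMean_exp_le [IsProbabilityMeasure r] (hd : 0 < d) {z : ℝ} (hz : 0 < z)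
    {m : Space d → ℝ} (hm : Measurable m) (h0 : ∀ y, 0 ≤ m y) {B : ℝ} (hB : ∀ y, m y ≤ B)
    (hmi : Integrable m) :
    (∀ k, Integrable (fun x : Space d × ℝ => Real.exp (m x.1)) (shellLaw d r k)) ∧
    ∀ K, ∑ k ∈ Finset.range K, shellMean d z k * (∫ x, Real.exp (m x.1) ∂shellLaw d r k - 1) ≤
      ∫ y, z * (Real.exp (m y) - 1) := by
  have hexp1 : ∀ y, 0 ≤ Real.exp (m y) - 1 := fun y => by linarith [Real.add_one_le_exp (m y), h0 y]
  -- Obtained from `1 - m ≤ e^{-m}`, that is `e^m - 1 ≤ m e^m`; boundedness and integrability of `m`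
  -- then make `e^m - 1` integrable.
  have hexp : ∀ y, Real.exp (m y) - 1 ≤ Real.exp B * m y := by
    intro y
    have h1 : Real.exp (m y) * (1 - m y) ≤ 1 := by
      calc Real.exp (m y) * (1 - m y) ≤ Real.exp (m y) * Real.exp (-m y) := by
            refine mul_le_mul_of_nonneg_left ?_ (Real.exp_pos _).le
            linarith [Real.add_one_le_exp (-m y)]
        _ = 1 := by rw [← Real.exp_add]; simp
    have h2 : Real.exp (m y) * m y ≤ Real.exp B * m y :=
      mul_le_mul_of_nonneg_right (Real.exp_le_exp.2 (hB y)) (h0 y)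
    linarith
  have hint : Integrable fun y => z * (Real.exp (m y) - 1) := by
    refine Integrable.const_mul (Integrable.mono' (hmi.const_mul (Real.exp B))
      ((Real.measurable_exp.comp hm).sub_const 1).aestronglyMeasurable (.of_forall fun y => ?_)) z
    rw [Function.comp_apply, Real.norm_of_nonneg (hexp1 y)]
    exact hexp y
  have hki : ∀ k, Integrable (fun x : Space d × ℝ => Real.exp (m x.1)) (shellLaw d r k) := by
    intro k
    have := isProbabilityMeasure_shellLaw (r := r) hd k
    refine Integrable.of_bound (Real.measurable_exp.comp (hm.comp measurable_fst)).aestronglyMeasurable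
      (Real.exp B) (.of_forall fun x => ?_)
    rw [Real.norm_of_nonneg (Real.exp_pos _).le]
    exact Real.exp_le_exp.2 (hB _)
  refine ⟨hki, fun K => ?_⟩
  have h := hasSum_integral_iUnion (measurableSet_shell d) (pairwise_disjoint_shell d)
    (hint.integrableOn (s := ⋃ k, shell d k))
  rw [iUnion_shell, setIntegral_univ] at h
  refine le_trans (le_of_eq (Finset.sum_congr rfl fun k _ => ?_))
    (sum_le_hasSum (Finset.range K) (fun k _ => integral_nonneg fun y =>
      mul_nonneg hz.le (hexp1 y)) h)
  have := isProbabilityMeasure_shellLaw (r := r) hd k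
  have h1 := shellMean_smul_integral hd hz k ((hki k).sub (integrable_const (1 : ℝ)))
  rw [integral_sub' (hki k) (integrable_const _)] at h1
  simpa using h1

end Shells

/-! ### Samples and the construction of the compound Poisson process -/

section SampleLaw

/-- Sequences of positions and charges; charge zero stands for the absence of a particle. -/
abbrev Sample (d : ℕ) : Type := ℕ × ℕ → Space d × ℝ

variable {d : ℕ}

/-- The samples that describe an element of `Γ d C`. -/
def goodSamples (d : ℕ) (C : ℝ) : Set (Sample d) :=
  {w | (∀ i, |(w i).2| ≤ C) ∧
    (∀ i j, i ≠ j → (w i).2 = 0 ∨ (w j).2 = 0 ∨ (w i).1 ≠ (w j).1) ∧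
    (∀ R : ℕ, ∃ s : Finset (ℕ × ℕ), ∀ i, i ∉ s → (w i).2 = 0 ∨ (R : ℝ) < ‖(w i).1‖) ∧
    ∀ n : ℕ, Summable fun i =>
      |(w i).2| * (1 + ‖(w i).1‖ ^ 2) ^ (-((d : ℝ) + 1 / ((n : ℝ) + 1)) / 2)}

theorem measurable_position (i : ℕ × ℕ) : Measurable fun w : Sample d => (w i).1 :=
  measurable_fst.comp (measurable_pi_apply i)

theorem measurable_charge (i : ℕ × ℕ) : Measurable fun w : Sample d => (w i).2 :=
  measurable_snd.comp (measurable_pi_apply i)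

theorem measurableSet_summable_real {α ι : Type*} [Countable ι] [MeasurableSpace α]
    {f : ι → α → ℝ} (hf : ∀ i, Measurable (f i)) : MeasurableSet {a | Summable fun i => f i a} := by
  have : {a | Summable fun i => f i a} = {a | ∑' i, ‖f i a‖ₑ ≠ ⊤} := by
    ext a
    exact summable_norm_iff.symm.trans tsum_enorm_ne_top_iff_summable_norm.symm
  rw [this]
  exact (Measurable.tsum fun i => (hf i).enorm) (measurableSet_singleton _).compl

/-- All quantifiers run over countable sets: indices, integer radii, finite index sets, and the
exponents `ε = 1 / (n + 1)`, which suffice by monotonicity in `ε`. -/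
theorem measurableSet_goodSamples (C : ℝ) : MeasurableSet (goodSamples d C) := by
  have h0 : ∀ i, MeasurableSet {w : Sample d | (w i).2 = 0} := fun i =>
    measurable_charge i (measurableSet_singleton 0)
  refine MeasurableSet.inter ?_ (MeasurableSet.inter ?_ (MeasurableSet.inter ?_ ?_))
  · change MeasurableSet {w : Sample d | ∀ i, |(w i).2| ≤ C}
    simp only [Set.ofPred_forall]
    exact MeasurableSet.iInter fun i => measurableSet_le (measurable_charge i).abs measurable_const
  · change MeasurableSet {w : Sample d | ∀ i j, i ≠ j →
      (w i).2 = 0 ∨ (w j).2 = 0 ∨ (w i).1 ≠ (w j).1}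
    simp only [Set.ofPred_forall]
    refine MeasurableSet.iInter fun i => MeasurableSet.iInter fun j => MeasurableSet.iInter fun _ =>
      (h0 i).union ((h0 j).union ?_)
    exact (measurableSet_eq_fun (measurable_position i) (measurable_position j)).compl
  · change MeasurableSet {w : Sample d | ∀ R : ℕ, ∃ s : Finset (ℕ × ℕ), ∀ i, i ∉ s →
      (w i).2 = 0 ∨ (R : ℝ) < ‖(w i).1‖}
    simp only [Set.ofPred_forall, Set.ofPred_exists]
    refine MeasurableSet.iInter fun R => MeasurableSet.iUnion fun s => MeasurableSet.iInter fun i =>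
      MeasurableSet.iInter fun _ => (h0 i).union ?_
    exact measurableSet_lt measurable_const (measurable_position i).norm
  · change MeasurableSet {w : Sample d | ∀ n : ℕ, Summable fun i =>
      |(w i).2| * (1 + ‖(w i).1‖ ^ 2) ^ (-((d : ℝ) + 1 / ((n : ℝ) + 1)) / 2)}
    simp only [Set.ofPred_forall]
    refine MeasurableSet.iInter fun n => measurableSet_summable_real fun i => ?_
    have := measurable_position (d := d) i
    have := measurable_charge (d := d) i
    fun_prop

/-- A law on samples with the properties of the compound Poisson process. -/
structure IsPoissonSample (z C : ℝ) (r : Measure ℝ) (P : Measure (Sample d)) : Prop where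
  isProbabilityMeasure : IsProbabilityMeasure P
  ae_good : ∀ᵐ w ∂P, w ∈ goodSamples d C
  exp_moment : ∀ {m : Space d → ℝ} {B : ℝ}, Measurable m → (∀ y, 0 ≤ m y) → (∀ y, m y ≤ B) →
    Integrable m → (∀ᵐ w ∂P, Summable fun i => |(w i).2| * m (w i).1) ∧
      Integrable (fun w => Real.exp (∑' i, |(w i).2| * m (w i).1)) P
  char : ∀ {f : Space d → ℝ} {B : ℝ}, Measurable f → (∀ y, |f y| ≤ B) → Integrable f →
    ∫ w, Complex.exp (Complex.I * ((∑' i, (w i).2 * f (w i).1 : ℝ) : ℂ)) ∂P =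
      Complex.exp (∫ y, levyChar z r (f y))

end SampleLaw
section Existence

variable {d : ℕ} {z C : ℝ} {r : Measure ℝ}

/-- Delete the points whose index exceeds the Poisson number of their shell. -/
def sampleMap (ω : (ℕ → ℕ) × (ℕ × ℕ → Space d × ℝ)) : Sample d :=
  fun i => ((ω.2 i).1, if i.2 < ω.1 i.1 then (ω.2 i).2 else 0)

theorem measurable_sampleMap : Measurable (sampleMap (d := d)) := by
  refine measurable_pi_iff.2 fun i => ?_
  have h : Measurable fun ω : (ℕ → ℕ) × (ℕ × ℕ → Space d × ℝ) => ω.2 i :=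
    (measurable_pi_apply i).comp measurable_snd
  refine (measurable_fst.comp h).prodMk (Measurable.ite ?_ (measurable_snd.comp h) measurable_const)
  exact measurableSet_lt measurable_const ((measurable_pi_apply i.1).comp measurable_fst)

theorem poissonLaw_map_eval (m : ℕ → NNReal) {E : Type*} [MeasurableSpace E] (ν : ℕ → Measure E)
    [∀ k, IsProbabilityMeasure (ν k)] (i : ℕ × ℕ) :
    MeasurePreserving (fun ω : (ℕ → ℕ) × (ℕ × ℕ → E) => ω.2 i) (poissonLaw m ν) (ν i.1) :=
  (measurePreserving_eval_infinitePi (fun i : ℕ × ℕ => ν i.1) i).comp measurePreserving_snd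

theorem ae_abs_charge_le [IsProbabilityMeasure r] (hd : 0 < d) (m : ℕ → NNReal)
    [∀ k, IsProbabilityMeasure (shellLaw d r k)]
    (hr : r (Set.Icc (-C) C)ᶜ = 0) :
    ∀ᵐ ω ∂poissonLaw m (shellLaw d r), ∀ i : ℕ × ℕ, |(ω.2 i).2| ≤ C := by
  rw [ae_all_iff]
  intro i
  have := isProbabilityMeasure_cond_shell hd i.1
  have h : MeasurePreserving Prod.snd (shellLaw d r i.1) r := measurePreserving_snd
  exact (h.comp (poissonLaw_map_eval m (shellLaw d r) i)).quasiMeasurePreserving.ae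
    (ae_abs_le_of_compl_Icc hr)

/-- Positions at distinct indices are independent and have no atoms because `0 < d`, so by Fubini
the diagonal is null. -/
theorem ae_position_ne [IsProbabilityMeasure r] (hd : 0 < d) (m : ℕ → NNReal)
    [∀ k, IsProbabilityMeasure (shellLaw d r k)] :
    ∀ᵐ ω ∂poissonLaw m (shellLaw d r), ∀ i j : ℕ × ℕ, i ≠ j → (ω.2 i).1 ≠ (ω.2 j).1 := by
  have : Nonempty (Fin d) := ⟨⟨0, hd⟩⟩
  simp only [ae_all_iff]
  intro i j hij
  have hmap : MeasurePreserving (fun ω : (ℕ → ℕ) × (ℕ × ℕ → Space d × ℝ) => (ω.2 i, ω.2 j))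
      (poissonLaw m (shellLaw d r)) ((shellLaw d r i.1).prod (shellLaw d r j.1)) := by
    have h1 : MeasurePreserving (fun e : ℕ × ℕ → Space d × ℝ => (e i, e j))
        (Measure.infinitePi fun i => shellLaw d r i.1)
        ((shellLaw d r i.1).prod (shellLaw d r j.1)) :=
      ⟨(measurable_pi_apply i).prodMk (measurable_pi_apply j),
        Measure.infinitePi_map_eval_prod (P := fun i : ℕ × ℕ => shellLaw d r i.1) hij⟩
    exact h1.comp measurePreserving_snd
  refine hmap.quasiMeasurePreserving.ae (p := fun p => p.1.1 ≠ p.2.1) ?_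
  have hmeas : MeasurableSet {p : (Space d × ℝ) × (Space d × ℝ) | p.1.1 = p.2.1} :=
    measurableSet_eq_fun (measurable_fst.comp measurable_fst) (measurable_fst.comp measurable_snd)
  rw [ae_iff]
  simp only [not_not]
  rw [Measure.measure_prod_null hmeas]
  refine .of_forall fun p => ?_
  have hp : Prod.mk p ⁻¹' {p : (Space d × ℝ) × (Space d × ℝ) | p.1.1 = p.2.1} =
      {p.1} ×ˢ Set.univ := by
    ext q
    simp [eq_comm]
  beta_reduce
  rw [hp, shellLaw, Measure.prod_prod, Pi.zero_apply]
  have h0 : volume[|shell d j.1] {p.1} = 0 := cond_absolutelyContinuous (measure_singleton p.1)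
  rw [h0, zero_mul]

theorem exp_moment_points [IsProbabilityMeasure r] (hd : 0 < d) (hz : 0 < z)
    [∀ k, IsProbabilityMeasure (shellLaw d r k)]
    {m : Space d → ℝ} {B : ℝ} (hm : Measurable m) (h0 : ∀ y, 0 ≤ m y) (hB : ∀ y, m y ≤ B)
    (hmi : Integrable m) :
    (∀ᵐ ω ∂poissonLaw (shellMean d z) (shellLaw d r),
      Summable fun i : ℕ × ℕ => if i.2 < ω.1 i.1 then m (ω.2 i).1 else 0) ∧
      Integrable (fun ω : (ℕ → ℕ) × (ℕ × ℕ → Space d × ℝ) =>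
        Real.exp (∑' i : ℕ × ℕ, if i.2 < ω.1 i.1 then m (ω.2 i).1 else 0))
        (poissonLaw (shellMean d z) (shellLaw d r)) := by
  obtain ⟨h1, h2⟩ := sum_shellMean_exp_le (r := r) hd hz hm h0 hB hmi
  exact exists_exp_moment_poissonLaw (shellMean d z) (shellLaw d r) (ψ := fun x => m x.1)
    (hm.comp measurable_fst) (fun _ => h0 _) h1 h2

/-- Charges are bounded by `C`, so the sum is dominated by the sum of `C * m` over the points
present, for which Poisson exponential moments are known. -/
theorem summable_charge_mul [IsProbabilityMeasure r] (hd : 0 < d) (hz : 0 < z) (hC : 0 ≤ C)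
    [∀ k, IsProbabilityMeasure (shellLaw d r k)] (hr : r (Set.Icc (-C) C)ᶜ = 0)
    {m : Space d → ℝ} {B : ℝ} (hm : Measurable m) (h0 : ∀ y, 0 ≤ m y) (hB : ∀ y, m y ≤ B)
    (hmi : Integrable m) :
    (∀ᵐ ω ∂poissonLaw (shellMean d z) (shellLaw d r),
      Summable fun i : ℕ × ℕ => |(sampleMap ω i).2| * m (sampleMap ω i).1) ∧
      Integrable (fun ω : (ℕ → ℕ) × (ℕ × ℕ → Space d × ℝ) =>
        Real.exp (∑' i : ℕ × ℕ, |(sampleMap ω i).2| * m (sampleMap ω i).1))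
        (poissonLaw (shellMean d z) (shellLaw d r)) := by
  obtain ⟨h1, h2⟩ := exp_moment_points (r := r) hd hz (m := fun y => C * m y) (B := C * B)
    (hm.const_mul C) (fun y => mul_nonneg hC (h0 y))
    (fun y => mul_le_mul_of_nonneg_left (hB y) hC) (hmi.const_mul C)
  have hle : ∀ ω : (ℕ → ℕ) × (ℕ × ℕ → Space d × ℝ), (∀ i, |(ω.2 i).2| ≤ C) → ∀ i : ℕ × ℕ,
      |(sampleMap ω i).2| * m (sampleMap ω i).1 ≤
        if i.2 < ω.1 i.1 then C * m (ω.2 i).1 else 0 := by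
    intro ω hω i
    simp only [sampleMap]
    split_ifs
    · exact mul_le_mul_of_nonneg_right (hω i) (h0 _)
    · simp
  have hnn : ∀ ω : (ℕ → ℕ) × (ℕ × ℕ → Space d × ℝ), ∀ i : ℕ × ℕ,
      0 ≤ |(sampleMap ω i).2| * m (sampleMap ω i).1 := fun ω i =>
    mul_nonneg (abs_nonneg _) (h0 _)
  have hs : ∀ᵐ ω ∂poissonLaw (shellMean d z) (shellLaw d r),
      Summable fun i : ℕ × ℕ => |(sampleMap ω i).2| * m (sampleMap ω i).1 := by
    filter_upwards [h1, ae_abs_charge_le hd (shellMean d z) hr] with ω hω hCω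
    exact Summable.of_nonneg_of_le (hnn ω) (hle ω hCω) hω
  refine ⟨hs, h2.mono' ?_ ?_⟩
  · have hmeas : Measurable fun ω : (ℕ → ℕ) × (ℕ × ℕ → Space d × ℝ) =>
        ∑' i : ℕ × ℕ, |(sampleMap ω i).2| * m (sampleMap ω i).1 :=
      Measurable.tsum fun i => ((measurable_charge i).comp measurable_sampleMap).abs.mul
        (hm.comp ((measurable_position i).comp measurable_sampleMap))
    exact (Real.measurable_exp.comp hmeas).aestronglyMeasurable
  · filter_upwards [h1, hs, ae_abs_charge_le hd (shellMean d z) hr] with ω hω hsω hCω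
    rw [Real.norm_of_nonneg (Real.exp_pos _).le]
    exact Real.exp_le_exp.2 (hsω.tsum_le_tsum (hle ω hCω) hω)

theorem tendsto_sum_blockIndices {n : ℕ → ℕ} {a : ℕ × ℕ → ℝ} {s : ℝ}
    (h : HasSum (fun i : ℕ × ℕ => if i.2 < n i.1 then a i else 0) s) :
    Tendsto (fun K => ∑ i ∈ blockIndices K n, a i) atTop (𝓝 s) := by
  have h1 : HasSum (fun k => ∑ j ∈ Finset.range (n k), a (k, j)) s := by
    refine h.prod_fiberwise fun k => ?_
    have h2 := hasSum_sum_of_ne_finset_zero (s := Finset.range (n k)) (L := .unconditional ℕ)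
      (f := fun j => if j < n k then a (k, j) else 0) fun j hj => by
        rw [Finset.mem_range] at hj
        exact if_neg hj
    rwa [Finset.sum_congr rfl fun j hj => if_pos (Finset.mem_range.1 hj)] at h2
  refine h1.tendsto_sum_nat.congr fun K => ?_
  have h3 := prod_blockIndices K n fun i => Multiplicative.ofAdd (a i)
  exact (congrArg Multiplicative.toAdd h3).symm

/-- The blockwise formula passes to the limit by dominated convergence with majorant `1`; the
exponents converge by countable additivity over the shells. -/
theorem char_sampleMap [IsProbabilityMeasure r] (hd : 0 < d) (hz : 0 < z) (hC : 0 ≤ C)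
    [∀ k, IsProbabilityMeasure (shellLaw d r k)] (hr : r (Set.Icc (-C) C)ᶜ = 0)
    {f : Space d → ℝ} {B : ℝ} (hf : Measurable f) (hB : ∀ y, |f y| ≤ B) (hfi : Integrable f) :
    ∫ ω, Complex.exp (Complex.I * ((∑' i, (sampleMap ω i).2 * f (sampleMap ω i).1 : ℝ) : ℂ))
        ∂poissonLaw (shellMean d z) (shellLaw d r) =
      Complex.exp (∫ y, levyChar z r (f y)) := by
  have hu : Measurable fun x : Space d × ℝ => Complex.exp (Complex.I * ((x.2 * f x.1 : ℝ) : ℂ)) := by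
    fun_prop
  have h1 := fun K => integral_prod_poissonLaw (shellMean d z) (shellLaw d r) hu
    (fun _ => norm_le_one_char) K
  have hlim := (Complex.continuous_exp.tendsto _).comp (sum_shellMean_char hd hz hr hf hfi)
  refine tendsto_nhds_unique ?_ (hlim.congr fun K => (h1 K).symm)
  refine tendsto_integral_of_dominated_convergence (fun _ => 1) (fun K => ?_) (integrable_const _)
    (fun K => .of_forall fun ω => ?_) ?_
  · exact (measurable_prod_blockIndices hu K).aestronglyMeasurable
  · rw [norm_prod]
    exact Finset.prod_le_one (fun _ _ => norm_nonneg _) fun _ _ => norm_le_one_char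
  · have hs := (summable_charge_mul (z := z) hd hz hC hr hf.abs (fun _ => abs_nonneg _) hB
      hfi.abs).1
    filter_upwards [hs] with ω hω
    simp_rw [← abs_mul] at hω
    have h2 := hω.of_abs.hasSum
    have h3 : HasSum (fun i : ℕ × ℕ => if i.2 < ω.1 i.1 then (ω.2 i).2 * f (ω.2 i).1 else 0)
        (∑' i, (sampleMap ω i).2 * f (sampleMap ω i).1) := by
      have h6 : (fun i : ℕ × ℕ => if i.2 < ω.1 i.1 then (ω.2 i).2 * f (ω.2 i).1 else 0) =
          fun i => (sampleMap ω i).2 * f (sampleMap ω i).1 := by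
        funext i
        simp only [sampleMap]
        split_ifs <;> simp
      rwa [h6]
    have h4 := tendsto_sum_blockIndices (a := fun i => (ω.2 i).2 * f (ω.2 i).1) h3
    have h5 : Continuous fun t : ℝ => Complex.exp (Complex.I * (t : ℂ)) := by fun_prop
    refine ((h5.tendsto _).comp h4).congr fun K => ?_
    simp only [Function.comp_apply]
    rw [Complex.ofReal_sum, Finset.mul_sum, Complex.exp_sum]

theorem ae_sampleMap_mem_goodSamples [IsProbabilityMeasure r] (hd : 0 < d) (hz : 0 < z)
    (hC : 0 ≤ C) [∀ k, IsProbabilityMeasure (shellLaw d r k)] (hr : r (Set.Icc (-C) C)ᶜ = 0) :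
    ∀ᵐ ω ∂poissonLaw (shellMean d z) (shellLaw d r), sampleMap ω ∈ goodSamples d C := by
  -- A summable series with values `0` and `1` has finitely many nonzero terms, so this is local
  -- finiteness of the point process.
  have hfin : ∀ R : ℕ, ∀ᵐ ω ∂poissonLaw (shellMean d z) (shellLaw d r),
      Summable fun i : ℕ × ℕ => if i.2 < ω.1 i.1 then
        (Metric.closedBall (0 : Space d) R).indicator (fun _ => (1 : ℝ)) (ω.2 i).1 else 0 := by
    intro R
    refine (exp_moment_points (r := r) hd hz (B := 1)
      (measurable_const.indicator measurableSet_closedBall)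
      (fun y => Set.indicator_nonneg (fun _ _ => zero_le_one) y)
      (fun y => Set.indicator_le_self' (fun _ _ => zero_le_one) y) ?_).1
    exact (integrable_indicator_iff measurableSet_closedBall).2
      (integrableOn_const measure_closedBall_lt_top.ne)
  have htemp : ∀ n : ℕ, ∀ᵐ ω ∂poissonLaw (shellMean d z) (shellLaw d r),
      Summable fun i : ℕ × ℕ => |(sampleMap ω i).2| *
        (1 + ‖(sampleMap ω i).1‖ ^ 2) ^ (-((d : ℝ) + 1 / ((n : ℝ) + 1)) / 2) := by
    intro n
    have hn : (0 : ℝ) < 1 / ((n : ℝ) + 1) := by positivity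
    refine (summable_charge_mul (z := z) hd hz hC hr (B := 1)
      (m := fun y : Space d => (1 + ‖y‖ ^ 2) ^ (-((d : ℝ) + 1 / ((n : ℝ) + 1)) / 2))
      (by fun_prop) (fun y => by positivity) (fun y => ?_) ?_).1
    · refine Real.rpow_le_one_of_one_le_of_nonpos (by nlinarith [sq_nonneg ‖y‖]) ?_
      have : (0 : ℝ) ≤ d := d.cast_nonneg
      linarith
    · exact integrable_rpow_neg_one_add_norm_sq (by simpa using hn)
  filter_upwards [ae_abs_charge_le hd (shellMean d z) hr, ae_position_ne hd (shellMean d z),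
    ae_all_iff.2 hfin, ae_all_iff.2 htemp] with ω h1 h2 h3 h4
  refine ⟨fun i => ?_, fun i j hij => Or.inr (Or.inr (h2 i j hij)), fun R => ?_, h4⟩
  · simp only [sampleMap]
    split_ifs
    · exact h1 i
    · simpa using hC
  · have h5 := (h3 R).tendsto_cofinite_zero.eventually (gt_mem_nhds one_pos)
    rw [Filter.eventually_cofinite] at h5
    refine ⟨h5.toFinset, fun i hi => ?_⟩
    rw [Set.Finite.mem_toFinset] at hi
    simp only [sampleMap, Set.mem_ofPred_eq, not_not] at hi ⊢
    by_cases hj : i.2 < ω.1 i.1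
    · right
      rw [if_pos hj] at hi
      by_contra! hle
      rw [Set.indicator_of_mem (by simpa using hle)] at hi
      exact lt_irrefl _ hi
    · exact Or.inl (if_neg hj)

theorem exists_isPoissonSample [IsProbabilityMeasure r] (hd : 0 < d) (hz : 0 < z) (hC : 0 ≤ C)
    (hr : r (Set.Icc (-C) C)ᶜ = 0) : ∃ P : Measure (Sample d), IsPoissonSample z C r P := by
  have (k : ℕ) := isProbabilityMeasure_shellLaw (r := r) hd k
  have hm := (measurable_sampleMap (d := d)).aemeasurable
    (μ := poissonLaw (shellMean d z) (shellLaw d r))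
  refine ⟨(poissonLaw (shellMean d z) (shellLaw d r)).map sampleMap,
    Measure.isProbabilityMeasure_map hm, ?_, ?_, ?_⟩
  · refine (ae_map_iff hm (p := fun w => w ∈ goodSamples d C) (measurableSet_goodSamples C)).2 ?_
    exact ae_sampleMap_mem_goodSamples hd hz hC hr
  · intro m B hmm h0 hB hmi
    obtain ⟨h1, h2⟩ := summable_charge_mul (z := z) hd hz hC hr hmm h0 hB hmi
    have hterm : ∀ i, Measurable fun w : Sample d => |(w i).2| * m (w i).1 := fun i =>
      (measurable_charge i).abs.mul (hmm.comp (measurable_position i))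
    refine ⟨(ae_map_iff hm (measurableSet_summable_real hterm)).2 h1, ?_⟩
    rw [integrable_map_measure _ hm]
    · exact h2
    · exact (Real.measurable_exp.comp (Measurable.tsum hterm)).aestronglyMeasurable
  · intro f B hf hB hfi
    have hterm : ∀ i, Measurable fun w : Sample d => (w i).2 * f (w i).1 := fun i =>
      (measurable_charge i).mul (hf.comp (measurable_position i))
    rw [integral_map hm]
    · exact char_sampleMap hd hz hC hr hf hB hfi
    · have := Measurable.tsum hterm (L := .unconditional _)
      exact Measurable.aestronglyMeasurable (by fun_prop)

end Existence
-- From samples to configurations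
section ConfigurationMap

variable {d : ℕ} {C : ℝ}

/-- The weight `(1 + |y|²)^{-(d+1)/2}`. -/
noncomputable def tempWeight (d : ℕ) (y : Space d) : ℝ := (1 + ‖y‖ ^ 2) ^ (-((d : ℝ) + 1) / 2)

theorem tempWeight_pos (y : Space d) : 0 < tempWeight d y := by
  unfold tempWeight
  positivity

theorem summable_tempWeight {w : Sample d} (hw : w ∈ goodSamples d C) :
    Summable fun i => |(w i).2| * tempWeight d (w i).1 := by
  have := hw.2.2.2 0
  simpa [tempWeight] using this

theorem abs_le_mul_tempWeight {t M : ℝ} {y : Space d} (h : (1 + ‖y‖ ^ 2) ^ (d + 1) * |t| ≤ M) :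
    |t| ≤ M * tempWeight d y := by
  have h1 : (1 : ℝ) ≤ 1 + ‖y‖ ^ 2 := by nlinarith [sq_nonneg ‖y‖]
  -- The integer power `d + 1` exceeds the needed exponent `(d + 1) / 2`, which keeps the hypothesis
  -- free of real exponents.
  have h2 : (1 + ‖y‖ ^ 2) ^ (((d : ℝ) + 1) / 2) ≤ (1 + ‖y‖ ^ 2) ^ (d + 1) := by
    rw [← Real.rpow_natCast (1 + ‖y‖ ^ 2) (d + 1)]
    refine Real.rpow_le_rpow_of_exponent_le h1 ?_
    push_cast
    linarith [(d.cast_nonneg : (0 : ℝ) ≤ d)]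
  rw [tempWeight, neg_div, Real.rpow_neg (by positivity), ← div_eq_mul_inv,
    le_div_iff₀ (by positivity), mul_comm]
  exact (mul_le_mul_of_nonneg_right h2 (abs_nonneg _)).trans h

theorem FastFalling.exists_bound {h : Space d → ℝ} (hh : FastFalling h) :
    ∃ M, 0 ≤ M ∧ ∀ y, |h y| ≤ M * tempWeight d y := by
  obtain ⟨M, hM⟩ := hh.2 (d + 1)
  refine ⟨M, (abs_nonneg _).trans (hM 0), fun y => abs_le_mul_tempWeight ?_⟩
  have := hM y
  rwa [abs_mul, abs_of_nonneg (by positivity)] at this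

theorem schwartz_abs_le (f : 𝓢(Space d, ℝ)) (y : Space d) :
    |f y| ≤ 2 ^ (2 * (d + 1)) * (Finset.Iic (2 * (d + 1), 0)).sup
      (schwartzSeminormFamily ℝ (Space d) ℝ) f * tempWeight d y := by
  refine abs_le_mul_tempWeight ?_
  have h := SchwartzMap.one_add_le_sup_seminorm_apply (𝕜 := ℝ) (m := (2 * (d + 1), 0))
    (k := 2 * (d + 1)) (n := 0) le_rfl le_rfl f y
  rw [norm_iteratedFDeriv_zero, Real.norm_eq_abs] at h
  refine le_trans (mul_le_mul_of_nonneg_right ?_ (abs_nonneg _)) h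
  -- The order `2 * (d + 1)` comes from `1 + ‖y‖ ^ 2 ≤ (1 + ‖y‖) ^ 2`.
  rw [pow_mul]
  exact pow_le_pow_left₀ (by positivity) (by nlinarith [norm_nonneg y]) _

theorem summable_of_abs_le_tempWeight {w : Sample d} (hw : w ∈ goodSamples d C) {h : Space d → ℝ}
    {M : ℝ} (hM : ∀ y, |h y| ≤ M * tempWeight d y) :
    Summable fun i => (w i).2 * h (w i).1 := by
  refine Summable.of_norm_bounded ((summable_tempWeight hw).mul_left M) fun i => ?_
  rw [norm_mul, Real.norm_eq_abs, Real.norm_eq_abs, mul_left_comm]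
  exact mul_le_mul_of_nonneg_left (hM _) (abs_nonneg _)

/-- The tempered distribution `∑ s_i δ_{y_i}`. -/
noncomputable def sampleDist (w : Sample d) (hw : w ∈ goodSamples d C) : TempDist d :=
  SchwartzMap.mkCLMtoNormedSpace (𝕜 := ℝ) (𝕜' := ℝ) (σ := RingHom.id ℝ)
    (fun f : 𝓢(Space d, ℝ) => ∑' i, (w i).2 * f (w i).1)
    (fun f g => by
      rw [← Summable.tsum_add (summable_of_abs_le_tempWeight hw (schwartz_abs_le f))
        (summable_of_abs_le_tempWeight hw (schwartz_abs_le g))]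
      exact tsum_congr fun i => by rw [add_apply, mul_add])
    (fun a f => by
      rw [RingHom.id_apply, smul_eq_mul, ← tsum_mul_left]
      exact tsum_congr fun i => by rw [smul_apply, smul_eq_mul, mul_left_comm])
    ⟨Finset.Iic (2 * (d + 1), 0), 2 ^ (2 * (d + 1)) * ∑' i, |(w i).2| * tempWeight d (w i).1,
      mul_nonneg (by positivity) (tsum_nonneg fun i =>
        mul_nonneg (abs_nonneg _) (tempWeight_pos _).le), fun f => by
      have h1 := summable_of_abs_le_tempWeight hw (schwartz_abs_le f)
      refine (norm_tsum_le_tsum_norm h1.norm).trans ?_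
      rw [mul_right_comm, ← tsum_mul_left]
      refine h1.norm.tsum_le_tsum (fun i => ?_) ((summable_tempWeight hw).mul_left _)
      rw [norm_mul, Real.norm_eq_abs, Real.norm_eq_abs, mul_left_comm]
      exact mul_le_mul_of_nonneg_left (schwartz_abs_le f _) (abs_nonneg _)⟩

theorem sampleDist_apply (w : Sample d) (hw : w ∈ goodSamples d C) (f : 𝓢(Space d, ℝ)) :
    sampleDist w hw f = ∑' i, (w i).2 * f (w i).1 := rfl

/-- The charge function of a sample. -/
noncomputable def sampleCharge (w : Sample d) (y : Space d) : ℝ :=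
  open Classical in ∑' i, if (w i).1 = y then (w i).2 else 0

theorem sampleCharge_position {w : Sample d} (hw : w ∈ goodSamples d C) {i : ℕ × ℕ}
    (hi : (w i).2 ≠ 0) : sampleCharge w (w i).1 = (w i).2 := by
  rw [sampleCharge, tsum_eq_single i, if_pos rfl]
  intro j hj
  rcases hw.2.1 j i hj with h | h | h
  · rw [h, ite_self]
  · exact absurd h hi
  · rw [if_neg h]

theorem exists_of_sampleCharge_ne_zero {w : Sample d} {y : Space d} (h : sampleCharge w y ≠ 0) :
    ∃ i, (w i).2 ≠ 0 ∧ (w i).1 = y := by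
  by_contra! H
  refine h ((tsum_congr fun i => ?_).trans tsum_zero)
  split_ifs with hi
  · by_contra h0
    exact H i h0 hi
  · rfl

/-- Sums over sites and sums over the indices of a sample agree. -/
theorem hasSum_sample_iff {w : Sample d} {s : Space d → ℝ}
    (hinj : ∀ i j, i ≠ j → (w i).2 = 0 ∨ (w j).2 = 0 ∨ (w i).1 ≠ (w j).1)
    (hs : ∀ i, (w i).2 ≠ 0 → s (w i).1 = (w i).2)
    (hs' : ∀ y, s y ≠ 0 → ∃ i, (w i).2 ≠ 0 ∧ (w i).1 = y)
    {g : Space d → ℝ → ℝ} (hg : ∀ y, g y 0 = 0) (a : ℝ) :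
    HasSum (fun y => g y (s y)) a ↔ HasSum (fun i => g (w i).1 (w i).2) a := by
  -- Both sums live on the indices of nonzero charge, where the position map is injective with image
  -- the support of `s`.
  let J := {i // (w i).2 ≠ 0}
  have h1 : Function.Injective fun j : J => (w j).1 := by
    intro i j hij
    by_contra hne
    rcases hinj i j fun h => hne (Subtype.ext h) with h | h | h
    exacts [i.2 h, j.2 h, h hij]
  rw [← h1.hasSum_iff (f := fun y => g y (s y)),
    ← (Subtype.val_injective (p := fun i => (w i).2 ≠ 0)).hasSum_iff
      (f := fun i => g (w i).1 (w i).2)]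
  · refine iff_of_eq (congrArg (HasSum · a) (funext fun j : J => ?_))
    simp only [Function.comp_apply]
    rw [hs j j.2]
  · intro i hi
    have : (w i).2 = 0 := by
      by_contra h
      exact hi ⟨⟨i, h⟩, rfl⟩
    rw [this, hg]
  · intro y hy
    have : s y = 0 := by
      by_contra h
      obtain ⟨i, hi, hiy⟩ := hs' y h
      exact hy ⟨⟨i, hi⟩, hiy⟩
    rw [this, hg]

theorem tsum_sampleCharge {w : Sample d} (hw : w ∈ goodSamples d C) {g : Space d → ℝ → ℝ}
    (hg : ∀ y, g y 0 = 0) :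
    ∑' y, g y (sampleCharge w y) = ∑' i, g (w i).1 (w i).2 := by
  -- The two series are summable simultaneously; otherwise both sums take the default value `0`.
  have h := hasSum_sample_iff hw.2.1 (fun _ => sampleCharge_position hw)
    (fun _ => exists_of_sampleCharge_ne_zero) hg
  by_cases hs : Summable fun i => g (w i).1 (w i).2
  · exact ((h _).2 hs.hasSum).tsum_eq
  · rw [tsum_eq_zero_of_not_summable hs, tsum_eq_zero_of_not_summable]
    rintro ⟨a, ha⟩
    exact hs ⟨a, (h a).1 ha⟩

theorem summable_sampleCharge_iff {w : Sample d} (hw : w ∈ goodSamples d C)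
    {g : Space d → ℝ → ℝ} (hg : ∀ y, g y 0 = 0) :
    (Summable fun y => g y (sampleCharge w y)) ↔ Summable fun i => g (w i).1 (w i).2 :=
  exists_congr (hasSum_sample_iff hw.2.1 (fun _ => sampleCharge_position hw)
    (fun _ => exists_of_sampleCharge_ne_zero) hg)

theorem isConfiguration_sampleCharge {w : Sample d} (hw : w ∈ goodSamples d C) (hC : 0 ≤ C) :
    IsConfiguration d C (sampleCharge w) := by
  refine ⟨fun K hK => ?_, fun y => ?_, fun ε hε => ?_⟩
  · obtain ⟨R, hR⟩ := hK.isBounded.exists_norm_le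
    obtain ⟨s, hs⟩ := hw.2.2.1 ⌈R⌉₊
    refine (s.finite_toSet.image fun i => (w i).1).subset ?_
    rintro y ⟨hy, h0⟩
    obtain ⟨i, hi, rfl⟩ := exists_of_sampleCharge_ne_zero h0
    refine ⟨i, ?_, rfl⟩
    by_contra his
    rcases hs i his with h | h
    · exact hi h
    · exact absurd ((hR _ hy).trans (Nat.le_ceil R)) (not_le.2 h)
  · by_cases h : sampleCharge w y = 0
    · rw [h, abs_zero]
      exact hC
    · obtain ⟨i, hi, rfl⟩ := exists_of_sampleCharge_ne_zero h
      rw [sampleCharge_position hw hi]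
      exact hw.1 i
  · rw [summable_sampleCharge_iff hw
      (g := fun y s => |s| * (1 + ‖y‖ ^ 2) ^ (-((d : ℝ) + ε) / 2)) (by simp)]
    obtain ⟨n, hn⟩ := exists_nat_one_div_lt hε
    refine Summable.of_nonneg_of_le (fun i => by positivity) (fun i => ?_) (hw.2.2.2 n)
    refine mul_le_mul_of_nonneg_left ?_ (abs_nonneg _)
    refine Real.rpow_le_rpow_of_exponent_le (by nlinarith [sq_nonneg ‖(w i).1‖]) ?_
    linarith

theorem represents_sampleCharge {w : Sample d} (hw : w ∈ goodSamples d C) :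
    Represents (sampleCharge w) (sampleDist w hw) := fun f => by
  rw [sampleDist_apply, tsum_sampleCharge hw (g := fun y s => s * f y) (by simp)]

/-- Replace samples that do not describe a configuration by the empty one. -/
noncomputable def cleanSample (C : ℝ) (w : Sample d) : Sample d :=
  open Classical in if w ∈ goodSamples d C then w else fun _ => (0, 0)

theorem zero_mem_goodSamples (hC : 0 ≤ C) : (fun _ => (0, 0) : Sample d) ∈ goodSamples d C :=
  ⟨fun i => by simpa using hC, fun i j _ => Or.inl rfl, fun R => ⟨∅, fun i _ => Or.inl rfl⟩,
    fun n => by simp⟩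

theorem cleanSample_mem (hC : 0 ≤ C) (w : Sample d) : cleanSample C w ∈ goodSamples d C := by
  unfold cleanSample
  split_ifs with h
  exacts [h, zero_mem_goodSamples hC]

theorem cleanSample_of_mem {w : Sample d} (hw : w ∈ goodSamples d C) : cleanSample C w = w :=
  if_pos hw

theorem measurable_cleanSample : Measurable (cleanSample (d := d) C) :=
  Measurable.ite (measurableSet_goodSamples C) measurable_id measurable_const

/-- The configuration described by a sample. -/
noncomputable def config (hC : 0 ≤ C) (w : Sample d) : Γ d C :=
  ⟨sampleDist (cleanSample C w) (cleanSample_mem hC w), sampleCharge (cleanSample C w),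
    isConfiguration_sampleCharge (cleanSample_mem hC w) hC,
    represents_sampleCharge (cleanSample_mem hC w)⟩

theorem charge_config (hC : 0 ≤ C) (w : Sample d) :
    charge (config hC w) = sampleCharge (cleanSample C w) :=
  charge_unique _ _ (isConfiguration_sampleCharge (cleanSample_mem hC w) hC)
    (represents_sampleCharge (cleanSample_mem hC w))

theorem tsum_charge_config (hC : 0 ≤ C) (w : Sample d) {g : Space d → ℝ → ℝ}
    (hg : ∀ y, g y 0 = 0) : ∑' y, g y (charge (config hC w) y) =
      ∑' i, g (cleanSample C w i).1 (cleanSample C w i).2 := by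
  rw [charge_config, tsum_sampleCharge (cleanSample_mem hC w) hg]

theorem pairing_config (hC : 0 ≤ C) (w : Sample d) (h : Space d → ℝ) :
    pairing (config hC w) h = ∑' i, (cleanSample C w i).2 * h (cleanSample C w i).1 :=
  tsum_charge_config hC w (g := fun y s => s * h y) (by simp)

theorem measurable_tsum_sample {m : Space d → ℝ} (hm : Measurable m) :
    Measurable fun w : Sample d => ∑' i, (w i).2 * m (w i).1 :=
  Measurable.tsum fun i => (measurable_charge i).mul (hm.comp (measurable_position i))

theorem measurable_config (hC : 0 ≤ C) : Measurable (config (d := d) hC) := by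
  refine Measurable.subtype_mk (measurable_tempDist_of_apply fun f => ?_)
  exact (measurable_tsum_sample f.continuous.measurable).comp measurable_cleanSample

theorem countable_support {s : Space d → ℝ} (hs : IsConfiguration d C s) :
    {y | s y ≠ 0}.Countable := by
  have : {y | s y ≠ 0} = ⋃ n : ℕ, {y ∈ Metric.closedBall (0 : Space d) n | s y ≠ 0} := by
    ext y
    simp only [Set.mem_ofPred_eq, Set.mem_iUnion]
    obtain ⟨n, hn⟩ := exists_nat_ge ‖y‖
    exact ⟨fun h => ⟨n, by simpa using hn, h⟩, fun ⟨_, _, h⟩ => h⟩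
  rw [this]
  exact Set.countable_iUnion fun n => (hs.finite_inter _ (isCompact_closedBall 0 n)).countable

/-- A locally finite support is countable, so its points can be injected into `ℕ × ℕ`; unused
indices receive charge `0` and do not count. -/
theorem config_surjective (hC : 0 ≤ C) : Function.Surjective (config (d := d) hC) := by
  rintro ⟨T, s, hs, hT⟩
  have := (countable_support hs).to_subtype
  obtain ⟨e₀, he₀⟩ := exists_injective_nat {y | s y ≠ 0}
  let e : {y | s y ≠ 0} → ℕ × ℕ := fun y => (e₀ y, 0)
  have he : Function.Injective e := fun x y h => he₀ (Prod.mk.inj h).1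
  let w : Sample d := Function.extend e (fun y => ((y : Space d), s y)) fun _ => (0, 0)
  have hwe : ∀ y, w (e y) = ((y : Space d), s y) := fun y => he.extend_apply _ _ _
  have hw0 : ∀ i, (w i).2 ≠ 0 → ∃ y, e y = i := by
    intro i hi
    by_contra h
    refine hi ?_
    exact congrArg Prod.snd (Function.extend_apply' _ _ _ h)
  have hinj : ∀ i j, i ≠ j → (w i).2 = 0 ∨ (w j).2 = 0 ∨ (w i).1 ≠ (w j).1 := by
    intro i j hij
    by_contra! H
    obtain ⟨x, rfl⟩ := hw0 i H.1
    obtain ⟨y, rfl⟩ := hw0 j H.2.1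
    rw [hwe, hwe] at H
    exact hij (congrArg e (Subtype.ext H.2.2))
  have hsw : ∀ i, (w i).2 ≠ 0 → s (w i).1 = (w i).2 := by
    intro i hi
    obtain ⟨y, rfl⟩ := hw0 i hi
    rw [hwe]
  have hsw' : ∀ y, s y ≠ 0 → ∃ i, (w i).2 ≠ 0 ∧ (w i).1 = y := fun y hy =>
    ⟨e ⟨y, hy⟩, by rw [hwe]; exact hy, by rw [hwe]⟩
  have hw : w ∈ goodSamples d C := by
    refine ⟨fun i => ?_, hinj, fun R => ?_, fun n => ?_⟩
    · by_cases hi : (w i).2 = 0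
      · rw [hi, abs_zero]
        exact hC
      · rw [← hsw i hi]
        exact hs.abs_le _
    · have hfin := (hs.finite_inter _ (isCompact_closedBall (0 : Space d) R))
      have hfin' : {i | (w i).2 ≠ 0 ∧ ‖(w i).1‖ ≤ R}.Finite := by
        refine Set.Finite.of_finite_image (f := fun i => (w i).1) (hfin.subset ?_) ?_
        · rintro _ ⟨i, ⟨hi, hiR⟩, rfl⟩
          exact ⟨by simpa using hiR, by rw [hsw i hi]; exact hi⟩
        · intro i hi j hj hij
          by_contra hne
          rcases hinj i j hne with h | h | h
          exacts [hi.1 h, hj.1 h, h hij]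
      refine ⟨hfin'.toFinset, fun i hi => ?_⟩
      rw [Set.Finite.mem_toFinset] at hi
      by_contra! H
      exact hi ⟨H.1, H.2⟩
    · obtain ⟨a, ha⟩ := hs.summable (1 / ((n : ℝ) + 1)) (by positivity)
      exact ⟨a, (hasSum_sample_iff hinj hsw hsw'
        (g := fun y s => |s| * (1 + ‖y‖ ^ 2) ^ (-((d : ℝ) + 1 / ((n : ℝ) + 1)) / 2))
        (by simp) a).1 ha⟩
  refine ⟨w, Subtype.ext (DFunLike.ext _ _ fun f => ?_)⟩
  change ∑' i, (cleanSample C w i).2 * f (cleanSample C w i).1 = T f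
  rw [cleanSample_of_mem hw, hT f]
  have hsum := summable_of_abs_le_tempWeight hw (schwartz_abs_le f)
  exact ((hasSum_sample_iff hinj hsw hsw' (g := fun y s => s * f y) (by simp) _).2
    hsum.hasSum).tsum_eq.symm

instance : MeasurableSpace.CountablySeparated (Γ d C) :=
  countablySeparated_of_injective measurable_subtype_coe Subtype.val_injective

/-- For a measurable surjection from a standard Borel space onto a countably separated space, a set
is measurable as soon as its preimage is. Functions on `Γ` defined through the chosen charges can
thus be tested as explicit series on samples. -/
theorem measurable_comp_config_iff (hC : 0 ≤ C) {β : Type*} [MeasurableSpace β] {F : Γ d C → β} :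
    Measurable (F ∘ config hC) ↔ Measurable F :=
  (measurable_config hC).measurable_comp_iff_of_surjective (config_surjective hC)

end ConfigurationMap

/-! ### Identification of the free measure -/

section FreeMeasure

variable {d : ℕ} {z C : ℝ} {r : Measure ℝ} {P : Measure (Sample d)}

theorem IsPoissonSample.ae_cleanSample_eq (hP : IsPoissonSample z C r P) :
    ∀ᵐ w ∂P, cleanSample C w = w :=
  hP.ae_good.mono fun _ hw => cleanSample_of_mem hw

theorem IsPoissonSample.isFreeMeasure (hP : IsPoissonSample z C r P) (hC : 0 ≤ C) :
    IsFreeMeasure z r ((P.map (config hC)).map Subtype.val) := by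
  have := hP.isProbabilityMeasure
  have hm := measurable_config (d := d) hC
  have h1 : IsProbabilityMeasure (P.map (config hC)) := Measure.isProbabilityMeasure_map hm.aemeasurable
  refine ⟨Measure.isProbabilityMeasure_map measurable_subtype_coe.aemeasurable, fun f => ?_⟩
  obtain ⟨B, hB⟩ := f.toBoundedContinuousFunction.bddAbove_range_norm_comp
  rw [Measure.map_map measurable_subtype_coe hm, integral_map
    (measurable_subtype_coe.comp hm).aemeasurable,
    ← hP.char f.continuous.measurable (B := B) (fun y => hB ⟨y, rfl⟩) f.integrable]
  · refine integral_congr_ae ?_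
    filter_upwards [hP.ae_cleanSample_eq] with w hw
    change Complex.exp (Complex.I * ((∑' i, (cleanSample C w i).2 * f (cleanSample C w i).1 : ℝ) : ℂ)) = _
    rw [hw]
  · exact (Complex.measurable_exp.comp (measurable_const.mul
      (Complex.measurable_ofReal.comp (measurable_tempDist_apply f)))).aestronglyMeasurable

theorem IsFreeMeasure.eq {μ ν : Measure (TempDist d)} (hμ : IsFreeMeasure z r μ)
    (hν : IsFreeMeasure z r ν) : μ = ν := by
  have := hμ.1
  have := hν.1
  exact measure_tempDist_ext fun f => (hμ.2 f).trans (hν.2 f).symm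

/-- Every set of the trace σ-algebra is the preimage of a Borel set, so no measurability of `Γ`
itself is needed. -/
theorem measure_config_ext {μ ν : Measure (Γ d C)}
    (h : μ.map Subtype.val = ν.map Subtype.val) : μ = ν := by
  ext s hs
  obtain ⟨t, ht, rfl⟩ := hs
  rw [← Measure.map_apply measurable_subtype_coe ht, h, Measure.map_apply measurable_subtype_coe ht]

end FreeMeasure
-- Analytic tools: series in `L¹`, concavity, translations, windows
section SeriesOfFunctions

variable {X ι : Type*} [MeasurableSpace X] {ν : Measure X} [Countable ι]

/-- A series of functions with summable `L¹` norms. -/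
theorem integrable_tsum_of_summable {F : ι → X → ℝ} (hF : ∀ i, Integrable (F i) ν)
    (hs : Summable fun i => ∫ x, |F i x| ∂ν) :
    (∀ᵐ x ∂ν, Summable fun i => F i x) ∧ Integrable (fun x => ∑' i, F i x) ν ∧
      ∫ x, |∑' i, F i x| ∂ν ≤ ∑' i, ∫ x, |F i x| ∂ν := by
  have hlin : ∀ i, ∫⁻ x, ‖F i x‖ₑ ∂ν = ENNReal.ofReal (∫ x, |F i x| ∂ν) := fun i =>
    (ofReal_integral_norm_eq_lintegral_enorm (hF i)).symm
  have hsum : ∑' i, ∫⁻ x, ‖F i x‖ₑ ∂ν = ENNReal.ofReal (∑' i, ∫ x, |F i x| ∂ν) := by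
    simp_rw [hlin]
    exact (ENNReal.ofReal_tsum_of_nonneg
      (fun i => integral_nonneg fun x => abs_nonneg (F i x)) hs).symm
  have hle : ∫⁻ x, ‖∑' i, F i x‖ₑ ∂ν ≤ ENNReal.ofReal (∑' i, ∫ x, |F i x| ∂ν) := by
    rw [← hsum, ← lintegral_tsum fun i => (hF i).1.enorm]
    exact lintegral_mono fun x => enorm_tsum_le_tsum_enorm
  have hint : Integrable (fun x => ∑' i, F i x) ν :=
    ⟨(AEMeasurable.tsum fun i => (hF i).1.aemeasurable).aestronglyMeasurable,
      hle.trans_lt ENNReal.ofReal_lt_top⟩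
  refine ⟨?_, hint, ?_⟩
  · have := summable_norm_of_tsum_eLpNorm_ne_top (μ := ν) le_rfl (fun i => (hF i).1) (by
      simp_rw [eLpNorm_one_eq_lintegral_enorm]
      rw [hsum]
      exact ENNReal.ofReal_ne_top)
    exact this.mono fun x hx => hx.of_norm
  · have h1 := ofReal_integral_norm_eq_lintegral_enorm hint
    simp only [Real.norm_eq_abs] at h1
    rw [← h1, ENNReal.ofReal_le_ofReal_iff
      (tsum_nonneg fun i => integral_nonneg fun x => abs_nonneg (F i x))] at hle
    exact hle

/-- Energies of two series of functions under a Lipschitz energy density. -/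
theorem abs_integral_lipschitz_tsum_sub_le {v : ℝ → ℝ} {b : ℝ} (hb : 0 ≤ b)
    (hv : ∀ s t, |v s - v t| ≤ b * |s - t|) (hv0 : v 0 = 0) (hvm : Measurable v)
    {F F' : ι → X → ℝ} (hF : ∀ i, Integrable (F i) ν) (hF' : ∀ i, Integrable (F' i) ν)
    (hs : Summable fun i => ∫ x, |F i x| ∂ν) (hs' : Summable fun i => ∫ x, |F' i x| ∂ν) :
    |∫ x, v (∑' i, F i x) ∂ν - ∫ x, v (∑' i, F' i x) ∂ν| ≤ b * ∑' i, ∫ x, |F i x - F' i x| ∂ν := by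
  obtain ⟨h1, h2, -⟩ := integrable_tsum_of_summable hF hs
  obtain ⟨h1', h2', -⟩ := integrable_tsum_of_summable hF' hs'
  have hvi : ∀ {φ : X → ℝ}, Integrable φ ν → Integrable (fun x => v (φ x)) ν := by
    intro φ hφ
    refine (hφ.abs.const_mul b).mono' (hvm.comp_aemeasurable hφ.1.aemeasurable).aestronglyMeasurable
      (.of_forall fun x => ?_)
    have := hv (φ x) 0
    rwa [hv0, sub_zero, sub_zero] at this
  have hd : Summable fun i => ∫ x, |F i x - F' i x| ∂ν := by
    refine Summable.of_nonneg_of_le (fun i => integral_nonneg fun x => abs_nonneg _) (fun i => ?_)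
      (hs.add hs')
    rw [← integral_add (hF i).abs (hF' i).abs]
    exact integral_mono ((hF i).sub (hF' i)).abs ((hF i).abs.add (hF' i).abs) fun x => abs_sub _ _
  obtain ⟨-, h2d, h3⟩ := integrable_tsum_of_summable (fun i => (hF i).sub (hF' i)) hd
  rw [← integral_sub (hvi h2) (hvi h2')]
  refine (abs_integral_le_integral_abs).trans ?_
  refine le_trans ?_ (mul_le_mul_of_nonneg_left h3 hb)
  rw [← integral_const_mul]
  refine integral_mono_ae ((hvi h2).sub (hvi h2')).abs (h2d.abs.const_mul b) ?_
  filter_upwards [h1, h1'] with x hx hx'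
  simp only [Pi.sub_apply]
  rw [hx.tsum_sub hx']
  exact hv _ _

end SeriesOfFunctions

section EnergyDensity

variable {v : ℝ → ℝ} {b : ℝ}

theorem lipschitz_of_deriv_lt (hv : ContDiff ℝ 2 v) (hd : ∀ φ, |deriv v φ| < b) (s t : ℝ) :
    |v s - v t| ≤ b * |s - t| :=
  Convex.norm_image_sub_le_of_norm_deriv_le (𝕜 := ℝ) (s := Set.univ)
    (fun x _ => (hv.differentiable (by norm_num)).differentiableAt) (fun x _ => (hd x).le)
    convex_univ trivial trivial

/-- Concave functions decrease the sum of their values when the arguments are spread. -/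
theorem concave_spread (hv : ConcaveOn ℝ Set.univ v) {m a a' M : ℝ} (h₁ : m ≤ a) (h₂ : a ≤ M)
    (hsum : a + a' = m + M) : v m + v M ≤ v a + v a' := by
  rcases h₁.eq_or_lt with rfl | h
  · rw [add_left_cancel hsum]
  · have hmM : 0 < M - m := by linarith
    have hM : M - m ≠ 0 := hmM.ne'
    have p₁ : 0 ≤ (M - a) / (M - m) := div_nonneg (by linarith) hmM.le
    have p₂ : 0 ≤ (a - m) / (M - m) := div_nonneg (by linarith) hmM.le
    -- The points `a` and `a'` are convex combinations of `m` and `M` with interchanged weights; the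
    -- two concavity inequalities are added.
    have e₁ := hv.2 (Set.mem_univ m) (Set.mem_univ M) p₁ p₂ (by field_simp; ring)
    have e₂ := hv.2 (Set.mem_univ m) (Set.mem_univ M) p₂ p₁ (by field_simp; ring)
    simp only [smul_eq_mul] at e₁ e₂
    have x₁ : (M - a) / (M - m) * m + (a - m) / (M - m) * M = a := by field_simp; ring
    have x₂ : (a - m) / (M - m) * m + (M - a) / (M - m) * M = a' := by
      have : a' = m + M - a := by linarith
      rw [this]
      field_simp
      ring
    rw [x₁] at e₁
    rw [x₂] at e₂
    have hone : (M - a) / (M - m) + (a - m) / (M - m) = 1 := by field_simp; ring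
    have : v m + v M = ((M - a) / (M - m) + (a - m) / (M - m)) * (v m + v M) := by rw [hone, one_mul]
    rw [this]
    linarith

end EnergyDensity

section Translation

variable {d : ℕ} {G : Space d → ℝ}

theorem tendsto_integral_translation (hG : Integrable G) (y : Space d) {u : ℕ → Space d}
    (hu : Tendsto u atTop (𝓝 y)) :
    Tendsto (fun n => ∫ x, |G (x - u n) - G (x - y)|) atTop (𝓝 0) := by
  have hGL : MemLp G 1 volume := memLp_one_iff_integrable.2 hG
  have : Fact ((1 : ENNReal) ≠ ⊤) := ⟨ENNReal.one_ne_top⟩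
  have hmk : ∀ c : Space d, MemLp (fun x => G (x - c)) 1 volume := fun c =>
    hGL.comp_measurePreserving (measurePreserving_sub_right volume c)
  -- Translation acts continuously on `L¹`; no regularity of `G` is required.
  have h1 : Tendsto (fun n => DomAddAct.mk (-u n) +ᵥ hGL.toLp G) atTop
      (𝓝 (DomAddAct.mk (-y) +ᵥ hGL.toLp G)) :=
    Tendsto.vadd ((DomAddAct.continuous_mk.tendsto _).comp hu.neg) tendsto_const_nhds
  have h2 : ∀ c : Space d, DomAddAct.mk (-c) +ᵥ hGL.toLp G = (hmk c).toLp _ := by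
    intro c
    rw [DomAddAct.mk_vadd_toLp]
    congr 1
    funext x
    simp [sub_eq_neg_add]
  simp_rw [h2] at h1
  rw [tendsto_iff_dist_tendsto_zero] at h1
  refine h1.congr fun n => ?_
  rw [dist_eq_norm, ← MemLp.toLp_sub, L1.norm_eq_integral_norm]
  refine integral_congr_ae ?_
  filter_upwards [MemLp.coeFn_toLp ((hmk (u n)).sub (hmk y))] with x hx
  rw [hx]
  rfl

end Translation

section Window

variable {d : ℕ} {G : Space d → ℝ}

/-- The mass that the kernel `G(· - y)` puts on a ball. -/
noncomputable def windowWeight (G : Space d → ℝ) (R : ℝ) (y : Space d) : ℝ :=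
  ∫ x in Metric.closedBall (0 : Space d) R, G (x - y)

theorem integrable_translate (hG : Integrable G) (y : Space d) :
    Integrable fun x => G (x - y) := hG.comp_sub_right y

theorem windowWeight_nonneg (h0 : ∀ x, 0 ≤ G x) (R : ℝ) (y : Space d) : 0 ≤ windowWeight G R y :=
  integral_nonneg fun _ => h0 _

theorem windowWeight_le (hG : Integrable G) (h0 : ∀ x, 0 ≤ G x) (R : ℝ) (y : Space d) :
    windowWeight G R y ≤ ∫ x, G x := by
  rw [← integral_sub_right_eq_self G y]
  exact setIntegral_le_integral (integrable_translate hG y) (.of_forall fun _ => h0 _)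

theorem measurable_windowWeight (hGm : Measurable G) (R : ℝ) : Measurable (windowWeight G R) :=
  (StronglyMeasurable.integral_prod_right (f := fun y x : Space d => G (x - y))
    (hGm.comp (measurable_snd.sub measurable_fst)).stronglyMeasurable).measurable

/-- By Tonelli the integral is the volume of the ball times the mass of `G`. Being bounded and
integrable, the weight qualifies for exponential moments, which then control the field on the ball.
-/
theorem integrable_windowWeight (hG : Integrable G) (hGm : Measurable G) (h0 : ∀ x, 0 ≤ G x)
    (R : ℝ) : Integrable (windowWeight G R) := by
  refine ⟨(measurable_windowWeight hGm R).aestronglyMeasurable, ?_⟩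
  have h1 : ∀ y, ‖windowWeight G R y‖ₑ =
      ∫⁻ x in Metric.closedBall (0 : Space d) R, ENNReal.ofReal (G (x - y)) := by
    intro y
    rw [Real.enorm_of_nonneg (windowWeight_nonneg h0 R y)]
    exact ofReal_integral_eq_lintegral_ofReal (integrable_translate hG y).integrableOn
      (.of_forall fun _ => h0 _)
  have hm : Measurable fun p : Space d × Space d => ENNReal.ofReal (G (p.2 - p.1)) :=
    (hGm.comp (measurable_snd.sub measurable_fst)).ennreal_ofReal
  have h2 : ∀ x, ∫⁻ y, ENNReal.ofReal (G (x - y)) = ENNReal.ofReal (∫ y, G y) := by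
    intro x
    rw [lintegral_sub_left_eq_self (fun y => ENNReal.ofReal (G y)) x]
    exact (ofReal_integral_eq_lintegral_ofReal hG (.of_forall h0)).symm
  simp only [HasFiniteIntegral, h1]
  rw [lintegral_lintegral_swap hm.aemeasurable]
  simp only [h2, lintegral_const, Measure.restrict_apply_univ]
  exact ENNReal.mul_lt_top ENNReal.ofReal_lt_top measure_closedBall_lt_top

/-- Moving the source point by at most one enlarges the window by at most one. -/
theorem windowWeight_le_of_dist_le (hG : Integrable G) (h0 : ∀ x, 0 ≤ G x) (R : ℝ) {u y : Space d}
    (h : dist u y ≤ 1) : windowWeight G R u ≤ windowWeight G (R + 1) y := by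
  -- Substitution moves the translation from `G` to the indicator of the ball, so only an inclusion
  -- of shifted balls has to be checked.
  have e : ∀ (R : ℝ) y, windowWeight G R y =
      ∫ x, (Metric.closedBall (0 : Space d) R).indicator (fun _ => (1 : ℝ)) (x + y) * G x := by
    intro R y
    have h1 := integral_sub_right_eq_self
      (fun x => (Metric.closedBall (0 : Space d) R).indicator (fun _ => (1 : ℝ)) (x + y) * G x) y
      (μ := volume)
    rw [← h1, windowWeight, ← integral_indicator measurableSet_closedBall]
    refine integral_congr_ae (.of_forall fun x => ?_)
    simp only [sub_add_cancel]
    by_cases hx : x ∈ Metric.closedBall (0 : Space d) R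
    · simp [Set.indicator_of_mem hx]
    · simp [Set.indicator_of_notMem hx]
  have hint : ∀ (R : ℝ) y, Integrable fun x =>
      (Metric.closedBall (0 : Space d) R).indicator (fun _ => (1 : ℝ)) (x + y) * G x := by
    intro R y
    refine hG.bdd_mul (c := 1) ?_ (.of_forall fun x => ?_)
    · exact ((measurable_const.indicator measurableSet_closedBall).comp
        (measurable_id.add_const y)).aestronglyMeasurable
    · refine (norm_indicator_le_norm_self _ _).trans ?_
      simp
  rw [e, e]
  refine integral_mono (hint _ _) (hint _ _) fun x => mul_le_mul_of_nonneg_right ?_ (h0 x)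
  refine Set.indicator_apply_le' (fun hx => ?_) fun _ =>
    Set.indicator_nonneg (fun _ _ => zero_le_one) _
  rw [Set.indicator_of_mem]
  rw [mem_closedBall_zero_iff] at *
  calc ‖x + y‖ = ‖(x + u) + (y - u)‖ := by congr 1; abel
    _ ≤ ‖x + u‖ + ‖y - u‖ := norm_add_le _ _
    _ ≤ R + 1 := add_le_add hx (by rwa [← dist_eq_norm, dist_comm])

end Window
-- The cut-off measure and exponential domination of energies and observables
section Cutoff

variable {d : ℕ} {g : Space d → ℝ}

/-- The measure `g(x) dx`. -/
noncomputable def cutoffMeasure (g : Space d → ℝ) : Measure (Space d) :=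
  volume.withDensity fun x => ENNReal.ofReal (g x)

theorem integral_cutoffMeasure (hg : Continuous g) (h0 : ∀ x, 0 ≤ g x) (f : Space d → ℝ) :
    ∫ x, f x ∂cutoffMeasure g = ∫ x, f x * g x := by
  rw [cutoffMeasure, integral_withDensity_eq_integral_toReal_smul hg.measurable.ennreal_ofReal
    (.of_forall fun x => ENNReal.ofReal_lt_top)]
  refine integral_congr_ae (.of_forall fun x => ?_)
  simp only [ENNReal.toReal_ofReal (h0 x), smul_eq_mul, mul_comm]

theorem exists_cutoffMeasure_le (hg : Continuous g) (hs : HasCompactSupport g) :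
    ∃ c R : ℝ, 0 ≤ c ∧
      cutoffMeasure g ≤ ENNReal.ofReal c • volume.restrict (Metric.closedBall 0 R) := by
  obtain ⟨c, hc⟩ := hs.exists_bound_of_continuous hg
  obtain ⟨R, hR⟩ := hs.isCompact.isBounded.subset_closedBall (0 : Space d)
  refine ⟨c, R, (norm_nonneg _).trans (hc 0), ?_⟩
  rw [← withDensity_const, ← withDensity_indicator measurableSet_closedBall]
  refine withDensity_mono (.of_forall fun x => ?_)
  by_cases hx : x ∈ Metric.closedBall (0 : Space d) R
  · rw [Set.indicator_of_mem hx]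
    exact ENNReal.ofReal_le_ofReal ((le_abs_self _).trans (hc x))
  · beta_reduce
    rw [Set.indicator_of_notMem hx, image_eq_zero_of_notMem_tsupport fun h => hx (hR h)]
    simp

end Cutoff

section Domination

variable {d : ℕ} {z C : ℝ} {r : Measure ℝ} {P : Measure (Sample d)}

/-- The sum of a weight over the particles, with absolute values of the charges. -/
noncomputable def weightSum (m : Space d → ℝ) (w : Sample d) : ℝ := ∑' i, |(w i).2| * m (w i).1

theorem IsPoissonSample.integrable_exp (hP : IsPoissonSample z C r P) {m : Space d → ℝ} {B : ℝ}
    (hm : Measurable m) (h0 : ∀ y, 0 ≤ m y) (hB : ∀ y, m y ≤ B) (hmi : Integrable m) {κ : ℝ}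
    (hκ : 0 ≤ κ) : Integrable (fun w => Real.exp (κ * weightSum m w)) P := by
  have := (hP.exp_moment (m := fun y => κ * m y) (B := κ * B) (hm.const_mul κ)
    (fun y => mul_nonneg hκ (h0 y)) (fun y => mul_le_mul_of_nonneg_left (hB y) hκ)
    (hmi.const_mul κ)).2
  refine this.congr (.of_forall fun w => ?_)
  simp only [weightSum, ← tsum_mul_left]
  congr 1
  exact tsum_congr fun i => by ring

theorem abs_tsum_le_weightSum {m h : Space d → ℝ} {M : ℝ} (hM : ∀ y, |h y| ≤ M * m y)
    {w : Sample d} (hw : Summable fun i => |(w i).2| * m (w i).1) :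
    (Summable fun i => (w i).2 * h (w i).1) ∧
      |∑' i, (w i).2 * h (w i).1| ≤ M * weightSum m w := by
  have hle : ∀ i, ‖(w i).2 * h (w i).1‖ ≤ M * (|(w i).2| * m (w i).1) := by
    intro i
    rw [norm_mul, Real.norm_eq_abs, Real.norm_eq_abs, mul_left_comm]
    exact mul_le_mul_of_nonneg_left (hM _) (abs_nonneg _)
  have hs : Summable fun i => ‖(w i).2 * h (w i).1‖ :=
    Summable.of_nonneg_of_le (fun _ => norm_nonneg _) hle (hw.mul_left M)
  refine ⟨hs.of_norm, (norm_tsum_le_tsum_norm hs).trans ?_⟩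
  rw [weightSum, ← tsum_mul_left]
  exact hs.tsum_le_tsum hle (hw.mul_left M)

/-- An exponentially bounded function of linear statistics. -/
noncomputable def statistic {n : ℕ} (H : (Fin n → ℝ) → ℝ) (h : Fin n → Space d → ℝ)
    (w : Sample d) : ℝ := H fun l => ∑' i, (w i).2 * h l (w i).1

theorem measurable_statistic {n : ℕ} {H : (Fin n → ℝ) → ℝ} (hH : Continuous H)
    {h : Fin n → Space d → ℝ} (hh : ∀ l, Measurable (h l)) : Measurable (statistic H h) :=
  hH.measurable.comp (measurable_pi_iff.2 fun l => measurable_tsum_sample (hh l))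

theorem abs_statistic_le {n : ℕ} {H : (Fin n → ℝ) → ℝ} {κ K : ℝ} (hκ : 0 ≤ κ) (hK : 0 ≤ K)
    (hH : ∀ x, |H x| ≤ K * Real.exp (κ * ∑ i, |x i|)) {m : Space d → ℝ}
    {h : Fin n → Space d → ℝ} {M : Fin n → ℝ} (hM : ∀ l y, |h l y| ≤ M l * m y)
    {w : Sample d} (hw : Summable fun i => |(w i).2| * m (w i).1) :
    |statistic H h w| ≤ K * Real.exp ((κ * ∑ l, M l) * weightSum m w) := by
  refine (hH _).trans (mul_le_mul_of_nonneg_left (Real.exp_le_exp.2 ?_) hK)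
  rw [mul_assoc, Finset.sum_mul]
  exact mul_le_mul_of_nonneg_left
    (Finset.sum_le_sum fun l _ => (abs_tsum_le_weightSum (hM l) hw).2) hκ

/-- The energy of the field with kernel `γ`. -/
noncomputable def kernelEnergy (v : ℝ → ℝ) (ν : Measure (Space d)) (γ : Space d → Space d → ℝ)
    (w : Sample d) : ℝ := ∫ x, v (∑' i, (w i).2 * γ (w i).1 x) ∂ν

variable {v : ℝ → ℝ} {ν : Measure (Space d)} {γ γ' : Space d → Space d → ℝ}

theorem measurable_kernelEnergy [SFinite ν] (hv : Measurable v)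
    (hγ : Measurable (Function.uncurry γ)) : Measurable (kernelEnergy v ν γ) := by
  refine (StronglyMeasurable.integral_prod_right
    (f := fun (w : Sample d) x => v (∑' i, (w i).2 * γ (w i).1 x)) ?_).measurable
  refine Measurable.stronglyMeasurable (hv.comp (Measurable.tsum fun i => ?_))
  have hp : Measurable fun p : Sample d × Space d => ((p.1 i).1, p.2) :=
    ((measurable_position i).comp measurable_fst).prodMk measurable_snd
  exact ((measurable_charge i).comp measurable_fst).mul (hγ.comp hp)

theorem integral_abs_const_mul (a : ℝ) (f : Space d → ℝ) :
    ∫ x, |a * f x| ∂ν = |a| * ∫ x, |f x| ∂ν := by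
  rw [← integral_const_mul]
  simp only [abs_mul]

theorem summable_integral_kernel {m : Space d → ℝ} {c : ℝ} (hc : ∀ y, ∫ x, |γ y x| ∂ν ≤ c * m y)
    {w : Sample d} (hw : Summable fun i => |(w i).2| * m (w i).1) :
    Summable fun i => ∫ x, |(w i).2 * γ (w i).1 x| ∂ν := by
  refine Summable.of_nonneg_of_le (fun i => integral_nonneg fun _ => abs_nonneg _) (fun i => ?_)
    (hw.mul_left c)
  rw [integral_abs_const_mul, mul_left_comm]
  exact mul_le_mul_of_nonneg_left (hc _) (abs_nonneg _)

/-- The Lipschitz bound on `v` makes the energy Lipschitz in the kernel, in the `L¹(ν)` norm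
weighted by the charges. Comparison with the zero kernel yields the growth bound, comparison with
the discretized kernel the convergence. -/
theorem abs_kernelEnergy_sub_le {b : ℝ} (hb : 0 ≤ b) (hv : ∀ s t, |v s - v t| ≤ b * |s - t|)
    (hv0 : v 0 = 0) (hvm : Measurable v) (hγ : ∀ y, Integrable (γ y) ν)
    (hγ' : ∀ y, Integrable (γ' y) ν) {m : Space d → ℝ} {c : ℝ}
    (hc : ∀ y, ∫ x, |γ y x| ∂ν ≤ c * m y) (hc' : ∀ y, ∫ x, |γ' y x| ∂ν ≤ c * m y)
    {w : Sample d} (hw : Summable fun i => |(w i).2| * m (w i).1) :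
    |kernelEnergy v ν γ w - kernelEnergy v ν γ' w| ≤
      b * ∑' i, |(w i).2| * ∫ x, |γ (w i).1 x - γ' (w i).1 x| ∂ν := by
  have h := abs_integral_lipschitz_tsum_sub_le hb hv hv0 hvm
    (F := fun i x => (w i).2 * γ (w i).1 x) (F' := fun i x => (w i).2 * γ' (w i).1 x)
    (fun i => (hγ _).const_mul _) (fun i => (hγ' _).const_mul _)
    (summable_integral_kernel hc hw) (summable_integral_kernel hc' hw)
  simp only [← mul_sub, integral_abs_const_mul] at h
  exact h

theorem abs_kernelEnergy_le {b : ℝ} (hb : 0 ≤ b) (hv : ∀ s t, |v s - v t| ≤ b * |s - t|)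
    (hv0 : v 0 = 0) (hvm : Measurable v) (hγ : ∀ y, Integrable (γ y) ν) {m : Space d → ℝ} {c : ℝ}
    (hc0 : 0 ≤ c) (hm : ∀ y, 0 ≤ m y)
    (hc : ∀ y, ∫ x, |γ y x| ∂ν ≤ c * m y)
    {w : Sample d} (hw : Summable fun i => |(w i).2| * m (w i).1) :
    |kernelEnergy v ν γ w| ≤ (b * c) * weightSum m w := by
  have h := abs_kernelEnergy_sub_le hb hv hv0 hvm hγ (γ' := fun _ _ => 0)
    (fun y => integrable_zero _ _ _) hc (fun y => by simpa using mul_nonneg hc0 (hm y)) hw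
  have hz : kernelEnergy v ν (fun _ _ => 0) w = 0 := by simp [kernelEnergy, hv0]
  simp only [hz, sub_zero] at h
  refine h.trans ?_
  rw [mul_assoc, weightSum, ← tsum_mul_left (a := c)]
  refine mul_le_mul_of_nonneg_left ?_ hb
  have hs := summable_integral_kernel hc hw
  simp only [integral_abs_const_mul] at hs
  refine hs.tsum_le_tsum (fun i => ?_) (hw.mul_left c)
  rw [mul_left_comm]
  exact mul_le_mul_of_nonneg_left (hc _) (abs_nonneg _)

end Domination

section Convolution

variable {d : ℕ} {G : Space d → ℝ}

theorem integrable_translate_cutoff {c R : ℝ} {ν : Measure (Space d)}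
    (hν : ν ≤ ENNReal.ofReal c • volume.restrict (Metric.closedBall 0 R)) (hG : Integrable G)
    (y : Space d) : Integrable (fun x => G (x - y)) ν :=
  ((integrable_translate hG y).integrableOn.smul_measure ENNReal.ofReal_ne_top).mono_measure hν

theorem integral_le_of_measure_le {c R : ℝ} (hc : 0 ≤ c) {ν : Measure (Space d)}
    (hν : ν ≤ ENNReal.ofReal c • volume.restrict (Metric.closedBall 0 R)) {f : Space d → ℝ}
    (hf : Integrable f) (h0 : ∀ x, 0 ≤ f x) :
    ∫ x, f x ∂ν ≤ c * ∫ x in Metric.closedBall 0 R, f x := by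
  have h := integral_mono_measure hν (.of_forall h0)
    (hf.integrableOn.smul_measure ENNReal.ofReal_ne_top)
  rwa [integral_smul_measure, ENNReal.toReal_ofReal hc, smul_eq_mul] at h

theorem integral_abs_translate_le {c R : ℝ} (hc : 0 ≤ c) {ν : Measure (Space d)}
    (hν : ν ≤ ENNReal.ofReal c • volume.restrict (Metric.closedBall 0 R)) (hG : Integrable G)
    (h0 : ∀ x, 0 ≤ G x) (y : Space d) :
    ∫ x, |G (x - y)| ∂ν ≤ c * windowWeight G R y := by
  simp only [abs_of_nonneg (h0 _)]
  exact integral_le_of_measure_le hc hν (integrable_translate hG y) fun _ => h0 _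

end Convolution
-- Cell charges and their independence
section Cells

variable {d : ℕ} {z C : ℝ} {r : Measure ℝ} {P : Measure (Sample d)}

/-- Simple functions that approximate the identity of `ℝ^d`. -/
noncomputable def lattice (d n : ℕ) : SimpleFunc (Space d) (Space d) :=
  SimpleFunc.approxOn (id : Space d → Space d) measurable_id Set.univ 0 (Set.mem_univ 0) n

theorem tendsto_lattice (y : Space d) : Tendsto (fun n => lattice d n y) atTop (𝓝 y) :=
  SimpleFunc.tendsto_approxOn (f := (id : Space d → Space d)) measurable_id (Set.mem_univ 0)
    (by simp)

/-- The points of the ball of radius `n` that are close to their lattice approximation. -/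
def latticeBox (d n : ℕ) : Set (Space d) := {y | ‖y‖ ≤ n ∧ dist (lattice d n y) y ≤ 1}

theorem measurableSet_latticeBox (n : ℕ) : MeasurableSet (latticeBox d n) :=
  (measurableSet_le measurable_norm measurable_const).inter
    (measurableSet_le ((lattice d n).measurable.dist measurable_id) measurable_const)

theorem eventually_mem_latticeBox (y : Space d) : ∀ᶠ n in atTop, y ∈ latticeBox d n := by
  have h1 : ∀ᶠ n : ℕ in atTop, ‖y‖ ≤ n := tendsto_natCast_atTop_atTop.eventually_ge_atTop _
  have h2 := Metric.tendsto_nhds.1 (tendsto_lattice y) 1 one_pos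
  filter_upwards [h1, h2] with n a b
  exact ⟨a, b.le⟩

/-- The cell of the box whose points are approximated by `q`. -/
def cell (n : ℕ) (q : Space d) : Set (Space d) := latticeBox d n ∩ lattice d n ⁻¹' {q}

theorem measurableSet_cell (n : ℕ) (q : Space d) : MeasurableSet (cell n q) :=
  (measurableSet_latticeBox n).inter ((lattice d n).measurableSet_preimage {q})

theorem volume_cell_lt_top (n : ℕ) (q : Space d) : volume (cell n q) < ⊤ := by
  refine (measure_mono (t := Metric.closedBall (0 : Space d) n) ?_).trans_lt
    measure_closedBall_lt_top
  intro y hy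
  simpa using hy.1.1

/-- The index type of the cells. -/
abbrev CellIndex (d n : ℕ) : Type := (lattice d n).range

/-- The indicator function of a cell. -/
noncomputable def cellInd (n : ℕ) (q : Space d) : Space d → ℝ := (cell n q).indicator fun _ => 1

theorem cellInd_of_mem {n : ℕ} {q y : Space d} (h : y ∈ cell n q) : cellInd n q y = 1 :=
  Set.indicator_of_mem h _

theorem cellInd_of_notMem {n : ℕ} {q y : Space d} (h : y ∉ cell n q) : cellInd n q y = 0 :=
  Set.indicator_of_notMem h _

theorem measurable_cellInd (n : ℕ) (q : Space d) : Measurable (cellInd n q) :=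
  measurable_const.indicator (measurableSet_cell n q)

theorem cellInd_nonneg (n : ℕ) (q y : Space d) : 0 ≤ cellInd n q y :=
  Set.indicator_nonneg (fun _ _ => zero_le_one) y

theorem abs_cellInd_le (n : ℕ) (q y : Space d) : |cellInd n q y| ≤ 1 := by
  by_cases h : y ∈ cell n q
  · rw [cellInd_of_mem h, abs_one]
  · rw [cellInd_of_notMem h, abs_zero]
    exact zero_le_one

theorem integrable_cellInd (n : ℕ) (q : Space d) : Integrable (cellInd n q) :=
  (integrable_indicator_iff (measurableSet_cell n q)).2
    (integrableOn_const (volume_cell_lt_top n q).ne)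

/-- The total charge in a cell. -/
noncomputable def cellCharge (n : ℕ) (w : Sample d) (q : CellIndex d n) : ℝ :=
  ∑' i, (w i).2 * cellInd n (q : Space d) (w i).1

theorem measurable_cellCharge (n : ℕ) : Measurable (cellCharge (d := d) n) :=
  measurable_pi_iff.2 fun q => measurable_tsum_sample (measurable_cellInd n (q : Space d))

/-- The function `a` is replaced by its values at the lattice points. -/
noncomputable def discretize (n : ℕ) (a : Space d → ℝ) : Space d → ℝ :=
  (latticeBox d n).indicator fun y => a (lattice d n y)

/-- The cells partition the box, so at each point of it exactly one term survives. -/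
theorem sum_cellInd (n : ℕ) (a : Space d → ℝ) (y : Space d) :
    ∑ q : CellIndex d n, a q * cellInd n (q : Space d) y = discretize n a y := by
  classical
  by_cases hy : y ∈ latticeBox d n
  · rw [Finset.sum_eq_single (⟨lattice d n y, SimpleFunc.mem_range_self _ _⟩ : CellIndex d n)]
    · rw [cellInd_of_mem ⟨hy, rfl⟩, mul_one, discretize, Set.indicator_of_mem hy]
    · intro q _ hq
      rw [cellInd_of_notMem, mul_zero]
      rintro ⟨-, h⟩
      exact hq (Subtype.ext (Set.mem_singleton_iff.1 h).symm)
    · exact fun h => absurd (Finset.mem_univ _) h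
  · rw [discretize, Set.indicator_of_notMem hy]
    refine Finset.sum_eq_zero fun q _ => ?_
    rw [cellInd_of_notMem fun h => hy h.1, mul_zero]

theorem IsPoissonSample.ae_summable (hP : IsPoissonSample z C r P) {h : Space d → ℝ} {B : ℝ}
    (hh : Measurable h) (hB : ∀ y, |h y| ≤ B) (hi : Integrable h) :
    ∀ᵐ w ∂P, Summable fun i => (w i).2 * h (w i).1 := by
  have := (hP.exp_moment hh.abs (fun y => abs_nonneg _) hB hi.abs).1
  filter_upwards [this] with w hw
  exact (abs_tsum_le_weightSum (M := 1) (fun y => (one_mul _).ge) hw).1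

/-- Linear combinations of the cell charges. -/
theorem IsPoissonSample.ae_sum_cellCharge (hP : IsPoissonSample z C r P) (n : ℕ) :
    ∀ᵐ w ∂P, ∀ a : CellIndex d n → ℝ, ∑ q, a q * cellCharge n w q =
      ∑' i, (w i).2 * ∑ q, a q * cellInd n (q : Space d) (w i).1 := by
  have hs : ∀ᵐ w ∂P, ∀ q : CellIndex d n, Summable fun i =>
      (w i).2 * cellInd n (q : Space d) (w i).1 :=
    ae_all_iff.2 fun q => hP.ae_summable (measurable_cellInd n (q : Space d)) (abs_cellInd_le n (q : Space d))
      (integrable_cellInd n (q : Space d))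
  filter_upwards [hs] with w hw a
  simp only [cellCharge, ← tsum_mul_left, Finset.mul_sum]
  rw [← Summable.tsum_finsetSum fun q _ => (hw q).mul_left (a q)]
  exact tsum_congr fun i => Finset.sum_congr rfl fun q _ => by ring

/-- The exceptional null set does not depend on `a`, so the identity may be used for `a = G (x - ·)`
at all `x` simultaneously. -/
theorem IsPoissonSample.ae_sum_cellCharge_eq (hP : IsPoissonSample z C r P) (n : ℕ) :
    ∀ᵐ w ∂P, ∀ a : Space d → ℝ, ∑ q : CellIndex d n, cellCharge n w q * a q =
      ∑' i, (w i).2 * discretize n a (w i).1 := by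
  filter_upwards [hP.ae_sum_cellCharge n] with w hw a
  simp only [mul_comm (cellCharge n w _), hw fun q => a q, sum_cellInd]

theorem levyChar_zero : levyChar z r 0 = 0 := by simp [levyChar]

/-- The characteristic function of the cell charges. -/
theorem IsPoissonSample.char_cellCharge [IsProbabilityMeasure r] (hP : IsPoissonSample z C r P)
    (hr : r (Set.Icc (-C) C)ᶜ = 0) (n : ℕ) (a : CellIndex d n → ℝ) :
    ∫ w, Complex.exp (((∑ q, a q * cellCharge n w q : ℝ) : ℂ) * Complex.I) ∂P =
      ∏ q, Complex.exp (∫ y, levyChar z r (a q * cellInd n (q : Space d) y)) := by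
  classical
  set f : Space d → ℝ := fun y =>
    ∑ q, a q * cellInd n (q : Space d) y with hf
  have hfm : Measurable f :=
    Finset.measurable_fun_sum _ fun q _ => (measurable_cellInd n (q : Space d)).const_mul _
  have hfB : ∀ y, |f y| ≤ ∑ q, |a q| := fun y =>
    (Finset.abs_sum_le_sum_abs _ _).trans (Finset.sum_le_sum fun q _ => by
      rw [abs_mul]
      exact mul_le_of_le_one_right (abs_nonneg _) (abs_cellInd_le n (q : Space d) _))
  have hfi : Integrable f :=
    integrable_finsetSum _ fun q _ => (integrable_cellInd n (q : Space d)).const_mul _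
  have h1 : ∫ w, Complex.exp (((∑ q, a q * cellCharge n w q : ℝ) : ℂ) * Complex.I) ∂P =
      ∫ w, Complex.exp (Complex.I * ((∑' i, (w i).2 * f (w i).1 : ℝ) : ℂ)) ∂P := by
    refine integral_congr_ae ?_
    filter_upwards [hP.ae_sum_cellCharge n] with w hw
    rw [hw a, mul_comm]
  rw [h1, hP.char hfm hfB hfi, ← Complex.exp_sum, ← integral_finsetSum]
  · congr 1
    refine integral_congr_ae (.of_forall fun y => ?_)
    -- At most one cell contains `y`, and `ψ(0) = 0`; hence `ψ` of the sum is the sum of the values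
    -- of `ψ`, and the characteristic function factorizes.
    by_cases hy : y ∈ latticeBox d n
    · set q₀ : CellIndex d n := ⟨lattice d n y, SimpleFunc.mem_range_self _ _⟩
      have hq : ∀ q : CellIndex d n, q ≠ q₀ →
          cellInd n (q : Space d) y = 0 := by
        intro q hq
        refine cellInd_of_notMem ?_
        rintro ⟨-, h⟩
        exact hq (Subtype.ext (Set.mem_singleton_iff.1 h).symm)
      simp only [hf]
      rw [Finset.sum_eq_single q₀ (fun q _ h => by rw [hq q h, mul_zero])
        (fun h => absurd (Finset.mem_univ _) h),
        Finset.sum_eq_single q₀ (fun q _ h => by rw [hq q h, mul_zero, levyChar_zero])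
        (fun h => absurd (Finset.mem_univ _) h)]
    · have hq : ∀ q : CellIndex d n,
          cellInd n (q : Space d) y = 0 := fun q =>
        cellInd_of_notMem fun h => hy h.1
      simp only [hf, hq, mul_zero, Finset.sum_const_zero, levyChar_zero]
  · intro q _
    refine Integrable.mono' (((integrable_cellInd n (q : Space d)).const_mul (a q)).abs.const_mul C
      |>.const_mul |z|) ((continuous_levyChar.measurable.comp
        ((measurable_cellInd n (q : Space d)).const_mul _)).aestronglyMeasurable)
      (.of_forall fun y => norm_levyChar_le hr _)

/-- The cell charges are independent. -/
theorem IsPoissonSample.map_cellCharge [IsProbabilityMeasure r] (hP : IsPoissonSample z C r P)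
    (hr : r (Set.Icc (-C) C)ᶜ = 0) (n : ℕ) :
    P.map (cellCharge n) = Measure.pi fun q => P.map fun w => cellCharge n w q := by
  classical
  have := hP.isProbabilityMeasure
  have hm : ∀ q : CellIndex d n, Measurable fun w : Sample d => cellCharge n w q := fun q =>
    measurable_pi_iff.1 (measurable_cellCharge n) q
  refine (iIndepFun_iff_map_fun_eq_pi_map fun q => (hm q).aemeasurable).1
    ((iIndepFun_iff_charFunDual_pi fun q => (hm q).aemeasurable).2 fun L => ?_)
  have hL : ∀ x : CellIndex d n → ℝ, L x = ∑ q, L (Pi.single q 1) * x q := by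
    intro x
    have := LinearMap.pi_apply_eq_sum_univ (L : (CellIndex d n → ℝ) →ₗ[ℝ] ℝ) x
    refine this.trans (Finset.sum_congr rfl fun q _ => ?_)
    rw [smul_eq_mul, mul_comm]
    congr 1
    refine congrArg L (funext fun i => ?_)
    simp [Pi.single_apply, eq_comm]
  have hexp : Measurable fun t : ℝ => Complex.exp ((t : ℂ) * Complex.I) := by fun_prop
  have hLm : AEStronglyMeasurable (fun x : CellIndex d n → ℝ =>
      Complex.exp ((L x : ℂ) * Complex.I)) (P.map (cellCharge n)) :=
    (hexp.comp L.continuous.measurable).aestronglyMeasurable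
  rw [charFunDual_apply]
  refine (integral_map (measurable_cellCharge n).aemeasurable hLm).trans ?_
  have h1 := hP.char_cellCharge hr n fun q => L (Pi.single q 1)
  simp only [← hL] at h1
  refine h1.trans (Finset.prod_congr rfl fun q _ => ?_)
  have hLq : AEStronglyMeasurable (fun x : ℝ => Complex.exp
      (((L ∘SL ContinuousLinearMap.single ℝ (fun _ : CellIndex d n => ℝ) q) x : ℂ) * Complex.I))
      (P.map fun w => cellCharge n w q) :=
    (hexp.comp (ContinuousLinearMap.continuous _).measurable).aestronglyMeasurable
  rw [charFunDual_apply]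
  refine Eq.trans ?_ (integral_map (hm q).aemeasurable hLq).symm
  -- The same formula with a coefficient vector supported at `q` identifies the marginal factor.
  have h2 := hP.char_cellCharge hr n (Pi.single q (L (Pi.single q 1)))
  rw [Finset.prod_eq_single q, Pi.single_eq_same] at h2
  · rw [← h2]
    refine integral_congr_ae (.of_forall fun w => ?_)
    beta_reduce
    congr 3
    rw [Finset.sum_eq_single q, Pi.single_eq_same]
    · change _ = L (Pi.single q (cellCharge n w q))
      have : (Pi.single q (cellCharge n w q) : CellIndex d n → ℝ) =
          cellCharge n w q • Pi.single q 1 := by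
        rw [← Pi.single_smul, smul_eq_mul, mul_one]
      rw [this, map_smul, smul_eq_mul, mul_comm]
    · intro p _ hp
      rw [Pi.single_eq_of_ne hp, zero_mul]
    · exact fun h => absurd (Finset.mem_univ _) h
  · intro p _ hp
    simp [Pi.single_eq_of_ne hp, levyChar_zero]
  · exact fun h => absurd (Finset.mem_univ _) h

theorem IsPoissonSample.integrable_exp_cellCharge (hP : IsPoissonSample z C r P) (n : ℕ)
    (q : CellIndex d n) (κ : ℝ) :
    Integrable (fun x => Real.exp (κ * |x|)) (P.map fun w => cellCharge n w q) := by
  have hm : Measurable fun w : Sample d => cellCharge n w q :=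
    measurable_pi_iff.1 (measurable_cellCharge n) q
  have he : Measurable fun x : ℝ => Real.exp (κ * |x|) := by fun_prop
  rw [integrable_map_measure he.aestronglyMeasurable hm.aemeasurable]
  have hnn : ∀ y, 0 ≤ cellInd n (q : Space d) y := cellInd_nonneg n (q : Space d)
  have h1 := hP.integrable_exp (measurable_cellInd n (q : Space d)) hnn
    (fun y => (le_abs_self _).trans (abs_cellInd_le n (q : Space d) y)) (integrable_cellInd n (q : Space d))
    (abs_nonneg κ)
  refine h1.mono' (he.comp hm).aestronglyMeasurable ?_
  have h2 := (hP.exp_moment (measurable_cellInd n (q : Space d)) hnn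
    (fun y => (le_abs_self _).trans (abs_cellInd_le n (q : Space d) y)) (integrable_cellInd n (q : Space d))).1
  filter_upwards [h2] with w hw
  have h3 := (abs_tsum_le_weightSum (M := 1)
    (fun y => (abs_of_nonneg (hnn y)).le.trans (one_mul _).ge) hw).2
  rw [Function.comp_apply, Real.norm_of_nonneg (Real.exp_pos _).le]
  refine Real.exp_le_exp.2 ?_
  rw [one_mul] at h3
  exact (mul_le_mul_of_nonneg_right (le_abs_self κ) (abs_nonneg _)).trans
    (mul_le_mul_of_nonneg_left h3 (abs_nonneg κ))

end Cells
-- Submodularity of the energy and the discretized FKG inequality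
section FiniteEnergy

variable {ι X : Type*} [Fintype ι] [MeasurableSpace X] {ν : Measure X} {v : ℝ → ℝ} {b : ℝ}
  {k : ι → X → ℝ}

/-- The energy of the field generated by charges at finitely many points. -/
noncomputable def finiteEnergy (v : ℝ → ℝ) (ν : Measure X) (k : ι → X → ℝ) (t : ι → ℝ) : ℝ :=
  ∫ x, v (∑ q, t q * k q x) ∂ν

/-- Supplies the continuity and, by comparison with `t = 0`, the linear growth of the energy that
`fkg_pi` needs for the density. -/
theorem abs_finiteEnergy_sub_le (hb : 0 ≤ b) (hv : ∀ s t, |v s - v t| ≤ b * |s - t|)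
    (hv0 : v 0 = 0) (hvm : Measurable v) (hk : ∀ q, Integrable (k q) ν) (s t : ι → ℝ) :
    |finiteEnergy v ν k s - finiteEnergy v ν k t| ≤ b * ∑ q, |s q - t q| * ∫ x, |k q x| ∂ν := by
  have h := abs_integral_lipschitz_tsum_sub_le hb hv hv0 hvm (F := fun q x => s q * k q x)
    (F' := fun q x => t q * k q x) (fun q => (hk q).const_mul _) (fun q => (hk q).const_mul _)
    (hasSum_fintype _).summable (hasSum_fintype _).summable
  simp only [tsum_fintype, ← sub_mul] at h
  refine h.trans_eq ?_
  congr 1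
  refine Finset.sum_congr rfl fun q _ => ?_
  rw [← integral_const_mul]
  simp only [abs_mul]

theorem continuous_finiteEnergy (hb : 0 ≤ b) (hv : ∀ s t, |v s - v t| ≤ b * |s - t|)
    (hv0 : v 0 = 0) (hvm : Measurable v) (hk : ∀ q, Integrable (k q) ν) :
    Continuous (finiteEnergy v ν k) := by
  refine continuous_iff_continuousAt.2 fun t => tendsto_iff_dist_tendsto_zero.2 ?_
  refine squeeze_zero (fun _ => dist_nonneg)
    (fun s => abs_finiteEnergy_sub_le hb hv hv0 hvm hk s t) ?_
  have : Continuous fun s : ι → ℝ => b * ∑ q, |s q - t q| * ∫ x, |k q x| ∂ν := by fun_prop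
  simpa using this.tendsto t

theorem abs_finiteEnergy_le (hb : 0 ≤ b) (hv : ∀ s t, |v s - v t| ≤ b * |s - t|)
    (hv0 : v 0 = 0) (hvm : Measurable v) (hk : ∀ q, Integrable (k q) ν) (t : ι → ℝ) :
    |finiteEnergy v ν k t| ≤ (b * ∑ q, ∫ x, |k q x| ∂ν) * ∑ q, |t q| := by
  have h := abs_finiteEnergy_sub_le hb hv hv0 hvm hk t 0
  have h0 : finiteEnergy v ν k 0 = 0 := by simp [finiteEnergy, hv0]
  simp only [h0, sub_zero, Pi.zero_apply] at h
  refine h.trans ?_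
  rw [mul_assoc, Finset.mul_sum _ _ (∑ q, ∫ x, |k q x| ∂ν)]
  refine mul_le_mul_of_nonneg_left (Finset.sum_le_sum fun q _ => ?_) hb
  rw [mul_comm]
  exact mul_le_mul_of_nonneg_right (Finset.single_le_sum (f := fun q => ∫ x, |k q x| ∂ν)
    (fun q _ => integral_nonneg fun _ => abs_nonneg _) (Finset.mem_univ q)) (abs_nonneg _)

/-- The energy is submodular when the energy density is concave and the kernel nonnegative. -/
theorem finiteEnergy_inf_add_sup_le (hv : ∀ s t, |v s - v t| ≤ b * |s - t|)
    (hv0 : v 0 = 0) (hvm : Measurable v) (hvc : ConcaveOn ℝ Set.univ v)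
    (hk : ∀ q, Integrable (k q) ν) (h0 : ∀ q x, 0 ≤ k q x) (s t : ι → ℝ) :
    finiteEnergy v ν k (s ⊓ t) + finiteEnergy v ν k (s ⊔ t) ≤
      finiteEnergy v ν k s + finiteEnergy v ν k t := by
  have hi : ∀ u : ι → ℝ, Integrable (fun x => v (∑ q, u q * k q x)) ν := by
    intro u
    have hs : Integrable (fun x => ∑ q, u q * k q x) ν :=
      integrable_finsetSum _ fun q _ => (hk q).const_mul _
    refine (hs.abs.const_mul b).mono' (hvm.comp_aemeasurable hs.1.aemeasurable).aestronglyMeasurable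
      (.of_forall fun x => ?_)
    simpa [hv0] using hv (∑ q, u q * k q x) 0
  unfold finiteEnergy
  rw [← integral_add (hi _) (hi _), ← integral_add (hi _) (hi _)]
  refine integral_mono ((hi _).add (hi _)) ((hi _).add (hi _)) fun x => ?_
  -- Nonnegativity of the kernel places the field of `s` between those of `s ⊓ t` and `s ⊔ t`; `min
  -- + max` preserves the sum of the fields.
  refine concave_spread hvc ?_ ?_ ?_
  · exact Finset.sum_le_sum fun q _ => mul_le_mul_of_nonneg_right inf_le_left (h0 q x)
  · exact Finset.sum_le_sum fun q _ => mul_le_mul_of_nonneg_right le_sup_left (h0 q x)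
  · rw [← Finset.sum_add_distrib, ← Finset.sum_add_distrib]
    refine Finset.sum_congr rfl fun q _ => ?_
    rw [← add_mul, ← add_mul, Pi.inf_apply, Pi.sup_apply]
    congr 1
    exact (min_add_max _ _).symm

/-- A function of linear combinations of the charges. -/
theorem exp_bound_linear {n : ℕ} {H : (Fin n → ℝ) → ℝ} {κ K : ℝ} (hκ : 0 ≤ κ) (hK : 0 ≤ K)
    (hH : ∀ x, |H x| ≤ K * Real.exp (κ * ∑ i, |x i|)) (h : Fin n → ι → ℝ) (t : ι → ℝ) :
    |H fun l => ∑ q, t q * h l q| ≤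
      K * Real.exp ((κ * ∑ l, ∑ q, |h l q|) * ∑ q, |t q|) := by
  refine (hH _).trans (mul_le_mul_of_nonneg_left (Real.exp_le_exp.2 ?_) hK)
  rw [mul_assoc, Finset.sum_mul]
  refine mul_le_mul_of_nonneg_left (Finset.sum_le_sum fun l _ => ?_) hκ
  refine (Finset.abs_sum_le_sum_abs _ _).trans ?_
  rw [Finset.sum_mul]
  refine Finset.sum_le_sum fun q _ => ?_
  rw [abs_mul, mul_comm]
  exact mul_le_mul_of_nonneg_left (Finset.single_le_sum (f := fun q => |t q|)
    (fun q _ => abs_nonneg _) (Finset.mem_univ q)) (abs_nonneg _)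

end FiniteEnergy

section Discretized

variable {d : ℕ} {z C : ℝ} {r : Measure ℝ} {P : Measure (Sample d)} {ν : Measure (Space d)}
  {v : ℝ → ℝ} {b : ℝ} {G : Space d → ℝ}

/-- The FKG inequality for the discretized system. -/
theorem IsPoissonSample.fkg_discretize [IsProbabilityMeasure r] (hP : IsPoissonSample z C r P)
    (hr : r (Set.Icc (-C) C)ᶜ = 0) (n : ℕ)
    (hb : 0 ≤ b) (hv : ∀ s t, |v s - v t| ≤ b * |s - t|) (hv0 : v 0 = 0) (hvm : Measurable v)
    (hvc : ConcaveOn ℝ Set.univ v) (hG : ∀ y, Integrable (fun x => G (x - y)) ν)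
    (hG0 : ∀ x, 0 ≤ G x) {n₁ n₂ : ℕ} {H₁ : (Fin n₁ → ℝ) → ℝ} {H₂ : (Fin n₂ → ℝ) → ℝ}
    {h₁ : Fin n₁ → Space d → ℝ} {h₂ : Fin n₂ → Space d → ℝ}
    (hc₁ : Continuous H₁) (hc₂ : Continuous H₂) (he₁ : ExpBounded H₁) (he₂ : ExpBounded H₂)
    (hm₁ : Monotone H₁) (hm₂ : Monotone H₂) (h0₁ : ∀ l y, 0 ≤ h₁ l y) (h0₂ : ∀ l y, 0 ≤ h₂ l y)
    {ρ S₁ S₂ : Sample d → ℝ}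
    (hρ : ρ = fun w =>
      Real.exp (-kernelEnergy v ν (fun y x => discretize n (fun q => G (x - q)) y) w))
    (hS₁ : S₁ = statistic H₁ fun l => discretize n (h₁ l))
    (hS₂ : S₂ = statistic H₂ fun l => discretize n (h₂ l)) :
    (∫ w, ρ w * S₁ w ∂P) * ∫ w, ρ w * S₂ w ∂P ≤
      (∫ w, ρ w ∂P) * ∫ w, ρ w * (S₁ w * S₂ w) ∂P := by
  have := hP.isProbabilityMeasure
  have hm : ∀ q : CellIndex d n, Measurable fun w : Sample d => cellCharge n w q := fun q =>
    measurable_pi_iff.1 (measurable_cellCharge n) q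
  have : ∀ q : CellIndex d n, IsProbabilityMeasure (P.map fun w => cellCharge n w q) := fun q =>
    Measure.isProbabilityMeasure_map (hm q).aemeasurable
  obtain ⟨κ₁, K₁, hκ₁, hK₁, hB₁⟩ := he₁
  obtain ⟨κ₂, K₂, hκ₂, hK₂, hB₂⟩ := he₂
  set k : CellIndex d n → Space d → ℝ := fun q x => G (x - q) with hk
  have hki : ∀ q, Integrable (k q) ν := fun q => hG q
  set E : (CellIndex d n → ℝ) → ℝ := finiteEnergy v ν k with hE
  have hEc : Continuous E := continuous_finiteEnergy hb hv hv0 hvm hki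
  have hlin : ∀ {n' : ℕ} (h : Fin n' → Space d → ℝ),
      Continuous fun (t : CellIndex d n → ℝ) l => ∑ q, t q * h l q := by
    intro n' h
    fun_prop
  have hmono : ∀ {n' : ℕ} {h : Fin n' → Space d → ℝ}, (∀ l y, 0 ≤ h l y) →
      Monotone fun (t : CellIndex d n → ℝ) l => ∑ q, t q * h l q := by
    intro n' h h0 s t hst l
    exact Finset.sum_le_sum fun q _ => mul_le_mul_of_nonneg_right (hst q) (h0 _ _)
  let Φ₁ : (CellIndex d n → ℝ) → ℝ := H₁ ∘ fun t l => ∑ q, t q * h₁ l q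
  let Φ₂ : (CellIndex d n → ℝ) → ℝ := H₂ ∘ fun t l => ∑ q, t q * h₂ l q
  have hΦ₁ : Continuous Φ₁ := hc₁.comp (hlin h₁)
  have hΦ₂ : Continuous Φ₂ := hc₂.comp (hlin h₂)
  -- The inequality is applied to the product of the laws of the cell charges, which by independence
  -- is their joint law.
  have key := fkg_pi (fun q : CellIndex d n => P.map fun w => cellCharge n w q)
    (fun q κ => hP.integrable_exp_cellCharge n q κ) (ρ := fun t => Real.exp (-E t))
    hΦ₁ hΦ₂ (by fun_prop)
    (hm₁.comp (hmono h0₁)) (hm₂.comp (hmono h0₂)) (fun t => (Real.exp_pos _).le)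
    (fun s t => by
      rw [← Real.exp_add, ← Real.exp_add, Real.exp_le_exp]
      have := finiteEnergy_inf_add_sup_le hv hv0 hvm hvc hki (fun q x => hG0 _) s t
      linarith) hK₁.le hK₂.le zero_le_one (by positivity) (by positivity)
    (mul_nonneg hb (Finset.sum_nonneg fun q _ => integral_nonneg fun _ => abs_nonneg _))
    (exp_bound_linear hκ₁.le hK₁.le hB₁ fun l (q : CellIndex d n) => h₁ l q)
    (exp_bound_linear hκ₂.le hK₂.le hB₂ fun l (q : CellIndex d n) => h₂ l q)
    (fun t => by
      rw [abs_of_pos (Real.exp_pos _), one_mul, Real.exp_le_exp]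
      exact (neg_le_abs _).trans (abs_finiteEnergy_le hb hv hv0 hvm hki t))
  have hae := hP.ae_sum_cellCharge_eq n
  have hρe : ∀ᵐ w ∂P, Real.exp (-E (cellCharge n w)) = ρ w := by
    filter_upwards [hae] with w hw
    simp only [hρ, hE, finiteEnergy, kernelEnergy, hk]
    simp only [fun x => hw fun q => G (x - q)]
  have hS : ∀ {n' : ℕ} (H : (Fin n' → ℝ) → ℝ) (h : Fin n' → Space d → ℝ), ∀ᵐ w ∂P,
      H (fun l => ∑ q : CellIndex d n, cellCharge n w q * h l q) =
        statistic H (fun l => discretize n (h l)) w := by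
    intro n' H h
    filter_upwards [hae] with w hw
    simp only [statistic, fun l => hw (h l)]
  have htr : ∀ {F : (CellIndex d n → ℝ) → ℝ} {S : Sample d → ℝ}, Continuous F →
      (∀ᵐ w ∂P, F (cellCharge n w) = S w) →
      ∫ t, F t ∂(Measure.pi fun q : CellIndex d n => P.map fun w => cellCharge n w q) =
        ∫ w, S w ∂P := by
    intro F S hF hFS
    rw [← hP.map_cellCharge hr n, integral_map (measurable_cellCharge n).aemeasurable
      hF.measurable.aestronglyMeasurable]
    exact integral_congr_ae hFS
  have hρc : Continuous fun t => Real.exp (-E t) := by fun_prop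
  have e₁ := hS H₁ h₁
  have e₂ := hS H₂ h₂
  have i₁ := htr (F := fun t => Real.exp (-E t) * Φ₁ t) (S := fun w => ρ w * S₁ w)
    (hρc.mul hΦ₁) (by
      filter_upwards [hρe, e₁] with w a a₁
      simp only [Φ₁, Function.comp_apply, a, a₁, hS₁])
  have i₂ := htr (F := fun t => Real.exp (-E t) * Φ₂ t) (S := fun w => ρ w * S₂ w)
    (hρc.mul hΦ₂) (by
      filter_upwards [hρe, e₂] with w a a₂
      simp only [Φ₂, Function.comp_apply, a, a₂, hS₂])
  have i₃ := htr (F := fun t => Real.exp (-E t) * (Φ₁ t * Φ₂ t))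
    (S := fun w => ρ w * (S₁ w * S₂ w)) (hρc.mul (hΦ₁.mul hΦ₂)) (by
      filter_upwards [hρe, e₁, e₂] with w a a₁ a₂
      simp only [Φ₁, Φ₂, Function.comp_apply, a, a₁, a₂, hS₁, hS₂])
  rwa [htr hρc hρe, i₁, i₂, i₃] at key

end Discretized
-- Removal of the discretization
section Weight

variable {d : ℕ} {G : Space d → ℝ}

theorem measurable_tempWeight : Measurable (tempWeight d) := by
  unfold tempWeight
  fun_prop

theorem tempWeight_le_one (y : Space d) : tempWeight d y ≤ 1 :=
  Real.rpow_le_one_of_one_le_of_nonpos (by nlinarith [sq_nonneg ‖y‖])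
    (by have := Nat.cast_nonneg (α := ℝ) d; linarith)

theorem integrable_tempWeight : Integrable (tempWeight d) :=
  integrable_rpow_neg_one_add_norm_sq (by simp)

theorem tempWeight_le_of_dist_le {u y : Space d} (h : dist u y ≤ 1) :
    tempWeight d u ≤ 3 ^ (((d : ℝ) + 1) / 2) * tempWeight d y := by
  have h1 : ‖y‖ ≤ ‖u‖ + 1 := by
    have := norm_sub_norm_le y u
    rw [← dist_eq_norm, dist_comm] at this
    linarith
  -- Uses `(‖u‖ + 1) ^ 2 ≤ 2 ‖u‖ ^ 2 + 2`, which is the source of the constant `3`.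
  have h2 : (1 + ‖y‖ ^ 2) / 3 ≤ 1 + ‖u‖ ^ 2 := by
    nlinarith [sq_nonneg (‖u‖ - 1), norm_nonneg y, norm_nonneg u]
  have hp : -((d : ℝ) + 1) / 2 ≤ 0 := by
    have := Nat.cast_nonneg (α := ℝ) d
    linarith
  unfold tempWeight
  refine (Real.rpow_le_rpow_of_nonpos (by positivity) h2 hp).trans_eq ?_
  rw [Real.div_rpow (by positivity) (by norm_num), neg_div, Real.rpow_neg (by norm_num : (0:ℝ) ≤ 3),
    div_inv_eq_mul, mul_comm]

/-- The weight that controls both the observables and the energy. -/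
noncomputable def totalWeight (G : Space d → ℝ) (R : ℝ) (y : Space d) : ℝ :=
  tempWeight d y + windowWeight G R y

theorem measurable_totalWeight (hGm : Measurable G) (R : ℝ) : Measurable (totalWeight G R) :=
  measurable_tempWeight.add (measurable_windowWeight hGm R)

theorem tempWeight_le_totalWeight (h0 : ∀ x, 0 ≤ G x) (R : ℝ) (y : Space d) :
    tempWeight d y ≤ totalWeight G R y := le_add_of_nonneg_right (windowWeight_nonneg h0 R y)

theorem windowWeight_le_totalWeight (R : ℝ) (y : Space d) :
    windowWeight G R y ≤ totalWeight G R y := le_add_of_nonneg_left (tempWeight_pos y).le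

theorem totalWeight_nonneg (h0 : ∀ x, 0 ≤ G x) (R : ℝ) (y : Space d) : 0 ≤ totalWeight G R y :=
  (tempWeight_pos y).le.trans (tempWeight_le_totalWeight h0 R y)

theorem totalWeight_le (hG : Integrable G) (h0 : ∀ x, 0 ≤ G x) (R : ℝ) (y : Space d) :
    totalWeight G R y ≤ 1 + ∫ x, G x :=
  add_le_add (tempWeight_le_one y) (windowWeight_le hG h0 R y)

theorem integrable_totalWeight (hG : Integrable G) (hGm : Measurable G) (h0 : ∀ x, 0 ≤ G x)
    (R : ℝ) : Integrable (totalWeight G R) :=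
  integrable_tempWeight.add (integrable_windowWeight hG hGm h0 R)

end Weight

section Discretization

variable {d : ℕ} {G : Space d → ℝ} {ν : Measure (Space d)}

theorem measurable_discretize (n : ℕ) (a : Space d → ℝ) : Measurable (discretize n a) :=
  ((lattice d n).map a).measurable.indicator (measurableSet_latticeBox n)

theorem tendsto_discretize {a : Space d → ℝ} (ha : Continuous a) (y : Space d) :
    Tendsto (fun n => discretize n a y) atTop (𝓝 (a y)) := by
  refine ((ha.tendsto y).comp (tendsto_lattice y)).congr' ?_
  filter_upwards [eventually_mem_latticeBox y] with n hn
  exact (Set.indicator_of_mem hn fun y => a (lattice d n y)).symm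

/-- Uniform in `n`: inside the box the lattice point is within distance one of `y`, and outside the
function is zero. -/
theorem abs_discretize_le {a : Space d → ℝ} {M : ℝ} (hM0 : 0 ≤ M)
    (hM : ∀ y, |a y| ≤ M * tempWeight d y) (n : ℕ) (y : Space d) :
    |discretize n a y| ≤ (M * 3 ^ (((d : ℝ) + 1) / 2)) * tempWeight d y := by
  by_cases hy : y ∈ latticeBox d n
  · rw [discretize, Set.indicator_of_mem hy, mul_assoc]
    exact (hM _).trans (mul_le_mul_of_nonneg_left (tempWeight_le_of_dist_le hy.2) hM0)
  · rw [discretize, Set.indicator_of_notMem hy, abs_zero]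
    have := tempWeight_pos y
    positivity

/-- The convolution kernel `(y, x) ↦ G (x - y)`, discretized in `y`. -/
noncomputable def discreteKernel (G : Space d → ℝ) (n : ℕ) (y x : Space d) : ℝ :=
  discretize n (fun q => G (x - q)) y

theorem discreteKernel_of_mem {n : ℕ} {y : Space d} (hy : y ∈ latticeBox d n) (x : Space d) :
    discreteKernel G n y x = G (x - lattice d n y) :=
  Set.indicator_of_mem hy fun y => G (x - lattice d n y)

theorem discreteKernel_of_notMem {n : ℕ} {y : Space d} (hy : y ∉ latticeBox d n) (x : Space d) :
    discreteKernel G n y x = 0 :=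
  Set.indicator_of_notMem hy fun y => G (x - lattice d n y)

theorem measurable_discreteKernel (hG : Measurable G) (n : ℕ) :
    Measurable (Function.uncurry (discreteKernel G n)) := by
  have : Function.uncurry (discreteKernel G n) = fun p : Space d × Space d =>
      ∑ q : CellIndex d n, G (p.2 - q) * cellInd n (q : Space d) p.1 := by
    funext p
    exact (sum_cellInd n (fun q => G (p.2 - q)) p.1).symm
  rw [this]
  exact Finset.measurable_fun_sum _ fun q _ => (hG.comp (measurable_snd.sub_const _)).mul
    ((measurable_cellInd n (q : Space d)).comp measurable_fst)

variable {c R : ℝ}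

theorem integrable_discreteKernel
    (hν : ν ≤ ENNReal.ofReal c • volume.restrict (Metric.closedBall 0 R)) (hG : Integrable G)
    (n : ℕ) (y : Space d) : Integrable (discreteKernel G n y) ν := by
  by_cases hy : y ∈ latticeBox d n
  · exact (integrable_translate_cutoff hν hG _).congr
      (.of_forall fun x => (discreteKernel_of_mem hy x).symm)
  · exact (integrable_zero _ _ _).congr (.of_forall fun x => (discreteKernel_of_notMem hy x).symm)

theorem integral_abs_translate_le_totalWeight (hc : 0 ≤ c)
    (hν : ν ≤ ENNReal.ofReal c • volume.restrict (Metric.closedBall 0 R)) (hG : Integrable G)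
    (h0 : ∀ x, 0 ≤ G x) {u y : Space d} (h : dist u y ≤ 1) :
    ∫ x, |G (x - u)| ∂ν ≤ c * totalWeight G (R + 1) y :=
  (integral_abs_translate_le hc hν hG h0 u).trans (mul_le_mul_of_nonneg_left
    ((windowWeight_le_of_dist_le hG h0 R h).trans (windowWeight_le_totalWeight _ _)) hc)

theorem integral_abs_discreteKernel_le (hc : 0 ≤ c)
    (hν : ν ≤ ENNReal.ofReal c • volume.restrict (Metric.closedBall 0 R)) (hG : Integrable G)
    (h0 : ∀ x, 0 ≤ G x) (n : ℕ) (y : Space d) :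
    ∫ x, |discreteKernel G n y x| ∂ν ≤ c * totalWeight G (R + 1) y := by
  by_cases hy : y ∈ latticeBox d n
  · simp only [discreteKernel_of_mem hy]
    exact integral_abs_translate_le_totalWeight hc hν hG h0 hy.2
  · simp only [discreteKernel_of_notMem hy, abs_zero, integral_zero]
    exact mul_nonneg hc (totalWeight_nonneg h0 _ _)

theorem tendsto_integral_discreteKernel (hc : 0 ≤ c)
    (hν : ν ≤ ENNReal.ofReal c • volume.restrict (Metric.closedBall 0 R)) (hG : Integrable G)
    (y : Space d) :
    Tendsto (fun n => ∫ x, |discreteKernel G n y x - G (x - y)| ∂ν) atTop (𝓝 0) := by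
  have h := (tendsto_integral_translation hG y (tendsto_lattice y)).const_mul c
  rw [mul_zero] at h
  refine squeeze_zero' (.of_forall fun n => integral_nonneg fun _ => abs_nonneg _) ?_ h
  filter_upwards [eventually_mem_latticeBox y] with n hn
  simp only [discreteKernel_of_mem hn]
  have hi : Integrable fun x => |G (x - lattice d n y) - G (x - y)| :=
    ((integrable_translate hG _).sub (integrable_translate hG y)).abs
  exact (integral_le_of_measure_le hc hν hi fun _ => abs_nonneg _).trans
    (mul_le_mul_of_nonneg_left (setIntegral_le_integral hi (.of_forall fun _ => abs_nonneg _)) hc)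

variable {v : ℝ → ℝ} {b : ℝ}

/-- The Lipschitz estimate reduces the claim to a series whose terms vanish by `L¹` continuity of
translation. The radius `R + 1` absorbs the displacement of each source to its lattice point, making
the majorant independent of `n`. -/
theorem tendsto_kernelEnergy_discreteKernel (hb : 0 ≤ b) (hv : ∀ s t, |v s - v t| ≤ b * |s - t|)
    (hv0 : v 0 = 0) (hvm : Measurable v) (hc : 0 ≤ c)
    (hν : ν ≤ ENNReal.ofReal c • volume.restrict (Metric.closedBall 0 R)) (hG : Integrable G)
    (h0 : ∀ x, 0 ≤ G x) {w : Sample d}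
    (hw : Summable fun i => |(w i).2| * totalWeight G (R + 1) (w i).1) :
    Tendsto (fun n => kernelEnergy v ν (discreteKernel G n) w) atTop
      (𝓝 (kernelEnergy v ν (fun y x => G (x - y)) w)) := by
  have hT : ∀ y, ∫ x, |G (x - y)| ∂ν ≤ c * totalWeight G (R + 1) y := fun y =>
    integral_abs_translate_le_totalWeight hc hν hG h0 (by simp)
  have hlim : Tendsto (fun n => b * ∑' i, |(w i).2| *
      ∫ x, |discreteKernel G n (w i).1 x - G (x - (w i).1)| ∂ν) atTop (𝓝 0) := by
    have := tendsto_tsum_of_dominated_convergence (𝓕 := atTop)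
      (f := fun n i => |(w i).2| * ∫ x, |discreteKernel G n (w i).1 x - G (x - (w i).1)| ∂ν)
      -- One `c` for the discretized kernel and one for the original kernel.
      (g := fun _ => 0) (hw.mul_left (2 * c))
      (fun i => by
        simpa using (tendsto_integral_discreteKernel hc hν hG (w i).1).const_mul |(w i).2|)
      (.of_forall fun n i => by
        rw [Real.norm_of_nonneg
          (mul_nonneg (abs_nonneg _) (integral_nonneg fun _ => abs_nonneg _)), mul_left_comm]
        refine mul_le_mul_of_nonneg_left ?_ (abs_nonneg _)
        have h1 := integral_abs_discreteKernel_le hc hν hG h0 n (w i).1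
        have h2 := hT (w i).1
        have i1 := integrable_discreteKernel hν hG n (w i).1
        have i2 := integrable_translate_cutoff hν hG (w i).1
        have h3 : ∫ x, |discreteKernel G n (w i).1 x - G (x - (w i).1)| ∂ν ≤
            ∫ x, (|discreteKernel G n (w i).1 x| + |G (x - (w i).1)|) ∂ν :=
          integral_mono (i1.sub i2).abs (i1.abs.add i2.abs) fun x => abs_sub _ _
        rw [integral_add i1.abs i2.abs] at h3
        linarith)
    simpa using this.const_mul b
  refine tendsto_iff_dist_tendsto_zero.2 (squeeze_zero (fun _ => dist_nonneg) (fun n => ?_) hlim)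
  exact abs_kernelEnergy_sub_le hb hv hv0 hvm (integrable_discreteKernel hν hG n)
    (integrable_translate_cutoff hν hG) (integral_abs_discreteKernel_le hc hν hG h0 n) hT hw

theorem tendsto_statistic_discretize {n' : ℕ} {H : (Fin n' → ℝ) → ℝ} (hH : Continuous H)
    {h : Fin n' → Space d → ℝ} (hh : ∀ l, Continuous (h l)) {M : Fin n' → ℝ} (hM0 : ∀ l, 0 ≤ M l)
    (hM : ∀ l y, |h l y| ≤ M l * tempWeight d y) {w : Sample d}
    (hw : Summable fun i => |(w i).2| * tempWeight d (w i).1) :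
    Tendsto (fun n => statistic H (fun l => discretize n (h l)) w) atTop
      (𝓝 (statistic H h w)) := by
  refine (hH.tendsto _).comp (tendsto_pi_nhds.2 fun l => ?_)
  refine tendsto_tsum_of_dominated_convergence
    (hw.mul_left (M l * 3 ^ (((d : ℝ) + 1) / 2)))
    (fun i => (tendsto_discretize (hh l) _).const_mul _) (.of_forall fun n i => ?_)
  rw [norm_mul, Real.norm_eq_abs, Real.norm_eq_abs, mul_left_comm]
  exact mul_le_mul_of_nonneg_left (abs_discretize_le (hM0 l) (hM l) n _) (abs_nonneg _)

end Discretization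

section Limit

variable {d : ℕ} {z C : ℝ} {r : Measure ℝ} {P : Measure (Sample d)} {G : Space d → ℝ}
  {ν : Measure (Space d)} {v : ℝ → ℝ} {b c R : ℝ}

theorem tendsto_integral_of_exp_bound {W : Sample d → ℝ} {κ K : ℝ}
    (hW : Integrable (fun w => Real.exp (κ * W w)) P) {A : ℕ → Sample d → ℝ} {A' : Sample d → ℝ}
    (hm : ∀ n, Measurable (A n)) (hb : ∀ᵐ w ∂P, ∀ n, |A n w| ≤ K * Real.exp (κ * W w))
    (hl : ∀ᵐ w ∂P, Tendsto (fun n => A n w) atTop (𝓝 (A' w))) :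
    Tendsto (fun n => ∫ w, A n w ∂P) atTop (𝓝 (∫ w, A' w ∂P)) :=
  tendsto_integral_of_dominated_convergence _ (fun n => (hm n).aestronglyMeasurable)
    (hW.const_mul K) (fun n => hb.mono fun _ h => h n) hl

theorem abs_mul_le_exp {s t K K' κ κ' W : ℝ} (hK : 0 ≤ K) (hs : |s| ≤ K * Real.exp (κ * W))
    (ht : |t| ≤ K' * Real.exp (κ' * W)) : |s * t| ≤ (K * K') * Real.exp ((κ + κ') * W) := by
  rw [abs_mul, add_mul, Real.exp_add, mul_mul_mul_comm]
  exact mul_le_mul hs ht (abs_nonneg _) (by positivity)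

/-- The FKG inequality for Poisson samples. -/
theorem IsPoissonSample.fkg [IsProbabilityMeasure r] [SFinite ν] (hP : IsPoissonSample z C r P)
    (hr : r (Set.Icc (-C) C)ᶜ = 0)
    (hb : 0 ≤ b) (hv : ∀ s t, |v s - v t| ≤ b * |s - t|) (hv0 : v 0 = 0) (hvm : Measurable v)
    (hvc : ConcaveOn ℝ Set.univ v) (hc : 0 ≤ c)
    (hν : ν ≤ ENNReal.ofReal c • volume.restrict (Metric.closedBall 0 R))
    (hG : Integrable G) (hGm : Measurable G) (h0 : ∀ x, 0 ≤ G x)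
    {n₁ n₂ : ℕ} {H₁ : (Fin n₁ → ℝ) → ℝ} {H₂ : (Fin n₂ → ℝ) → ℝ}
    {h₁ : Fin n₁ → Space d → ℝ} {h₂ : Fin n₂ → Space d → ℝ}
    (hc₁ : Continuous H₁) (hc₂ : Continuous H₂) (he₁ : ExpBounded H₁) (he₂ : ExpBounded H₂)
    (hf₁ : ∀ l, FastFalling (h₁ l)) (hf₂ : ∀ l, FastFalling (h₂ l))
    (hm₁ : Monotone H₁) (hm₂ : Monotone H₂) (h0₁ : ∀ l y, 0 ≤ h₁ l y) (h0₂ : ∀ l y, 0 ≤ h₂ l y)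
    {ρ S₁ S₂ : Sample d → ℝ}
    (hρ : ρ = fun w => Real.exp (-kernelEnergy v ν (fun y x => G (x - y)) w))
    (hS₁ : S₁ = statistic H₁ h₁) (hS₂ : S₂ = statistic H₂ h₂) :
    (∫ w, ρ w * S₁ w ∂P) * ∫ w, ρ w * S₂ w ∂P ≤
      (∫ w, ρ w ∂P) * ∫ w, ρ w * (S₁ w * S₂ w) ∂P := by
  -- A single weight dominates densities and observables for all `n`, so the exponents of products
  -- simply add.
  set m := totalWeight G (R + 1) with hm
  set W : Sample d → ℝ := weightSum m with hW
  set ρ' : ℕ → Sample d → ℝ := fun n w =>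
    Real.exp (-kernelEnergy v ν (discreteKernel G n) w) with hρ'
  set T₁ : ℕ → Sample d → ℝ := fun n => statistic H₁ fun l => discretize n (h₁ l) with hT₁
  set T₂ : ℕ → Sample d → ℝ := fun n => statistic H₂ fun l => discretize n (h₂ l) with hT₂
  have hWi : ∀ {κ : ℝ}, 0 ≤ κ → Integrable (fun w => Real.exp (κ * W w)) P := fun hκ =>
    hP.integrable_exp (measurable_totalWeight hGm _) (totalWeight_nonneg h0 _)
      (totalWeight_le hG h0 _) (integrable_totalWeight hG hGm h0 _) hκ
  have hsum : ∀ᵐ w ∂P, Summable fun i => |(w i).2| * m (w i).1 :=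
    (hP.exp_moment (measurable_totalWeight hGm _) (totalWeight_nonneg h0 _)
      (totalWeight_le hG h0 _) (integrable_totalWeight hG hGm h0 _)).1
  have hρm : ∀ n, Measurable (ρ' n) := fun n =>
    (measurable_kernelEnergy hvm (measurable_discreteKernel hGm n)).neg.exp
  have hρb : ∀ᵐ w ∂P, ∀ n, |ρ' n w| ≤ 1 * Real.exp ((b * c) * W w) := by
    filter_upwards [hsum] with w hw n
    rw [one_mul, abs_of_pos (Real.exp_pos _), Real.exp_le_exp]
    exact (neg_le_abs _).trans (abs_kernelEnergy_le hb hv hv0 hvm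
      (integrable_discreteKernel hν hG n) hc (totalWeight_nonneg h0 _)
      (integral_abs_discreteKernel_le hc hν hG h0 n) hw)
  have hρl : ∀ᵐ w ∂P, Tendsto (fun n => ρ' n w) atTop (𝓝 (ρ w)) := by
    filter_upwards [hsum] with w hw
    rw [hρ]
    exact (Real.continuous_exp.tendsto _).comp
      (tendsto_kernelEnergy_discreteKernel hb hv hv0 hvm hc hν hG h0 hw).neg
  have hstat : ∀ {n' : ℕ} {H : (Fin n' → ℝ) → ℝ} {h : Fin n' → Space d → ℝ}, Continuous H →
      ExpBounded H → (∀ l, FastFalling (h l)) →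
      (∀ n, Measurable (statistic H fun l => discretize n (h l))) ∧
      (∀ᵐ w ∂P, Tendsto (fun n => statistic H (fun l => discretize n (h l)) w) atTop
        (𝓝 (statistic H h w))) ∧ ∃ κ K : ℝ, 0 ≤ κ ∧ 0 ≤ K ∧ ∀ᵐ w ∂P, ∀ n,
        |statistic H (fun l => discretize n (h l)) w| ≤ K * Real.exp (κ * W w) := by
    rintro n' H h hH ⟨κ, K, hκ, hK, hB⟩ hf
    choose M hM0 hM using fun l => (hf l).exists_bound
    refine ⟨fun n => measurable_statistic hH fun l => measurable_discretize n _, ?_,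
      κ * ∑ l, M l * 3 ^ (((d : ℝ) + 1) / 2), K,
      mul_nonneg hκ.le (Finset.sum_nonneg fun l _ => mul_nonneg (hM0 l) (by positivity)), hK.le, ?_⟩
    · filter_upwards [hsum] with w hw
      refine tendsto_statistic_discretize hH (fun l => (hf l).1) hM0 hM
        (Summable.of_nonneg_of_le (fun i => mul_nonneg (abs_nonneg _) (tempWeight_pos _).le)
          (fun i => ?_) hw)
      exact mul_le_mul_of_nonneg_left (tempWeight_le_totalWeight h0 _ _) (abs_nonneg _)
    · filter_upwards [hsum] with w hw n
      refine abs_statistic_le hκ.le hK.le hB (fun l y => ?_) hw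
      exact (abs_discretize_le (hM0 l) (hM l) n y).trans (mul_le_mul_of_nonneg_left
        (tempWeight_le_totalWeight h0 _ _) (mul_nonneg (hM0 l) (by positivity)))
  obtain ⟨hTm₁, hTl₁, κ₁, K₁, hκ₁, hK₁, hTb₁⟩ := hstat hc₁ he₁ hf₁
  obtain ⟨hTm₂, hTl₂, κ₂, K₂, hκ₂, hK₂, hTb₂⟩ := hstat hc₂ he₂ hf₂
  have hbc : 0 ≤ b * c := mul_nonneg hb hc
  have l₀ := tendsto_integral_of_exp_bound (hWi hbc) hρm hρb hρl
  have l₁ := tendsto_integral_of_exp_bound (A := fun n w => ρ' n w * T₁ n w)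
    (A' := fun w => ρ w * S₁ w) (hWi (add_nonneg hbc hκ₁))
    (fun n => (hρm n).mul (hTm₁ n))
    (by filter_upwards [hρb, hTb₁] with w p q n; exact abs_mul_le_exp zero_le_one (p n) (q n))
    (by filter_upwards [hρl, hTl₁] with w p q; rw [hS₁]; exact p.mul q)
  have l₂ := tendsto_integral_of_exp_bound (A := fun n w => ρ' n w * T₂ n w)
    (A' := fun w => ρ w * S₂ w) (hWi (add_nonneg hbc hκ₂))
    (fun n => (hρm n).mul (hTm₂ n))
    (by filter_upwards [hρb, hTb₂] with w p q n; exact abs_mul_le_exp zero_le_one (p n) (q n))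
    (by filter_upwards [hρl, hTl₂] with w p q; rw [hS₂]; exact p.mul q)
  have l₃ := tendsto_integral_of_exp_bound (A := fun n w => ρ' n w * (T₁ n w * T₂ n w))
    (A' := fun w => ρ w * (S₁ w * S₂ w)) (hWi (add_nonneg hbc (add_nonneg hκ₁ hκ₂)))
    (fun n => (hρm n).mul ((hTm₁ n).mul (hTm₂ n)))
    (by
      filter_upwards [hρb, hTb₁, hTb₂] with w p q q' n
      exact abs_mul_le_exp zero_le_one (p n) (abs_mul_le_exp hK₁ (q n) (q' n)))
    (by filter_upwards [hρl, hTl₁, hTl₂] with w p q q'; rw [hS₁, hS₂]; exact p.mul (q.mul q'))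
  exact le_of_tendsto_of_tendsto' (l₁.mul l₂) (l₀.mul l₃) fun n =>
    hP.fkg_discretize hr n hb hv hv0 hvm hvc (integrable_translate_cutoff hν hG) h0 hc₁ hc₂ he₁ he₂
      hm₁ hm₂ h0₁ h0₂ rfl rfl rfl

end Limit
-- The field and the energy on configurations
section Field

variable {d : ℕ} {z C : ℝ} {r : Measure ℝ} {P : Measure (Sample d)} {G G' : Space d → ℝ}

theorem ae_eq_translate (h : G =ᵐ[volume] G') (y : Space d) :
    (fun x => G (x - y)) =ᵐ[volume] fun x => G' (x - y) :=
  (measurePreserving_sub_right volume y).quasiMeasurePreserving.ae_eq_comp h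

theorem windowWeight_congr (h : G =ᵐ[volume] G') (R : ℝ) : windowWeight G R = windowWeight G' R :=
  funext fun y => integral_congr_ae (ae_restrict_of_ae (ae_eq_translate h y))

/-- An integrable kernel is only almost everywhere measurable, whereas joint measurability in
sources and field points calls for a Borel version. -/
theorem exists_measurable_ae_eq (hG : Integrable G) (h0 : ∀ x, 0 ≤ G x) :
    ∃ G' : Space d → ℝ, Measurable G' ∧ (∀ x, 0 ≤ G' x) ∧ Integrable G' ∧ G =ᵐ[volume] G' := by
  have h : G =ᵐ[volume] fun x => max 0 (hG.1.mk G x) := by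
    filter_upwards [hG.1.ae_eq_mk] with x hx
    rw [← hx, max_eq_right (h0 x)]
  exact ⟨_, measurable_const.max hG.1.stronglyMeasurable_mk.measurable, fun x => le_max_left _ _,
    hG.congr h, h⟩

/-- Well-definedness of the field, in terms of a sample. -/
theorem field_wellDefined (hC : 0 ≤ C) (hG : Integrable G) (h0 : ∀ x, 0 ≤ G x) (w : Sample d)
    (hw : ∀ n : ℕ, Summable fun i =>
      |(cleanSample C w i).2| * windowWeight G n (cleanSample C w i).1) :
    (∀ᵐ x, Summable fun y => charge (config hC w) y * G (x - y)) ∧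
      LocallyIntegrable (field G (config hC w)) volume := by
  have hi : ∀ i, Integrable fun x => (cleanSample C w i).2 * G (x - (cleanSample C w i).1) :=
    fun i => (integrable_translate hG _).const_mul _
  have key := fun n : ℕ => integrable_tsum_of_summable
    (ν := volume.restrict (Metric.closedBall (0 : Space d) n)) (fun i => (hi i).integrableOn)
    (by
      simp only [integral_abs_const_mul, abs_of_nonneg (h0 _)]
      exact hw n)
  constructor
  · have h1 : ∀ᵐ x, ∀ n : ℕ, x ∈ Metric.closedBall (0 : Space d) n →
        Summable fun i => (cleanSample C w i).2 * G (x - (cleanSample C w i).1) :=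
      ae_all_iff.2 fun n => (ae_restrict_iff' measurableSet_closedBall).1 (key n).1
    filter_upwards [h1] with x hx
    rw [charge_config]
    refine (summable_sampleCharge_iff (cleanSample_mem hC w)
      (g := fun y s => s * G (x - y)) (by simp)).2 ?_
    obtain ⟨n, hn⟩ := exists_nat_ge ‖x‖
    exact hx n (by simpa using hn)
  · refine locallyIntegrable_iff.2 fun K hK => ?_
    obtain ⟨R, hR⟩ := hK.isBounded.subset_closedBall (0 : Space d)
    obtain ⟨n, hn⟩ := exists_nat_ge R
    have e : field G (config hC w) =
        fun x => ∑' i, (cleanSample C w i).2 * G (x - (cleanSample C w i).1) :=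
      funext fun x => pairing_config hC w _
    rw [e]
    exact IntegrableOn.mono_set (key n).2.1 (hR.trans (Metric.closedBall_subset_closedBall hn))

theorem IsPoissonSample.ae_field_wellDefined (hP : IsPoissonSample z C r P) (hC : 0 ≤ C)
    (hG : Integrable G) (h0 : ∀ x, 0 ≤ G x) :
    ∀ᵐ η ∂P.map (config hC), (∀ᵐ x, Summable fun y => charge η y * G (x - y)) ∧
      LocallyIntegrable (field G η) volume := by
  obtain ⟨G', hGm', h0', hG', hGG'⟩ := exists_measurable_ae_eq hG h0
  -- The almost sure statement is reduced to this measurable set of configurations, since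
  -- well-definedness of the field is not evidently a measurable condition.
  set A : Set (Γ d C) :=
    {η | ∀ n : ℕ, Summable fun y => |charge η y| * windowWeight G n y} with hA
  have hpre : ∀ w, config hC w ∈ A ↔ ∀ n : ℕ, Summable fun i =>
      |(cleanSample C w i).2| * windowWeight G n (cleanSample C w i).1 := by
    intro w
    refine forall_congr' fun n => ?_
    rw [charge_config]
    exact summable_sampleCharge_iff (cleanSample_mem hC w)
      (g := fun y s => |s| * windowWeight G n y) (by simp)
  have hAm : MeasurableSet A := by
    refine ((measurable_config hC).measurableSet_preimage_iff_of_surjective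
      (config_surjective hC)).1 ?_
    have e : config hC ⁻¹' A = cleanSample C ⁻¹' ⋂ n : ℕ, {w | Summable fun i =>
        |(w i).2| * windowWeight G n (w i).1} := by
      ext w
      simp only [Set.mem_preimage, hpre, Set.mem_iInter, Set.mem_ofPred_eq]
    rw [e]
    refine measurable_cleanSample (MeasurableSet.iInter fun n => measurableSet_summable_real
      fun i => (measurable_charge i).abs.mul ?_)
    rw [windowWeight_congr hGG']
    exact (measurable_windowWeight hGm' n).comp (measurable_position i)
  have hAe : ∀ᵐ η ∂P.map (config hC), η ∈ A := by
    refine (ae_map_iff (measurable_config hC).aemeasurable hAm).2 ?_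
    have h1 : ∀ᵐ w ∂P, ∀ n : ℕ, Summable fun i => |(w i).2| * windowWeight G n (w i).1 := by
      refine ae_all_iff.2 fun n => ?_
      rw [windowWeight_congr hGG']
      exact (hP.exp_moment (measurable_windowWeight hGm' n) (windowWeight_nonneg h0' n)
        (windowWeight_le hG' h0' n) (integrable_windowWeight hG' hGm' h0' n)).1
    filter_upwards [h1, hP.ae_cleanSample_eq] with w hw hcw
    refine (hpre w).2 ?_
    rw [hcw]
    exact hw
  refine hAe.mono fun η hη => ?_
  obtain ⟨w, rfl⟩ := config_surjective hC η
  exact field_wellDefined hC hG h0 w ((hpre w).1 hη)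

/-- A sample involves only countably many translates of the kernel, so for almost every `x` they all
agree with those of the Borel version. The identity therefore holds for every sample. -/
theorem energy_config (hC : 0 ≤ C) (hGG' : G =ᵐ[volume] G') {g : Space d → ℝ} (hg : Continuous g)
    (hg0 : ∀ x, 0 ≤ g x) (v : ℝ → ℝ) (w : Sample d) :
    energy G v g (config hC w) =
      kernelEnergy v (cutoffMeasure g) (fun y x => G' (x - y)) (cleanSample C w) := by
  rw [kernelEnergy, integral_cutoffMeasure hg hg0]
  refine integral_congr_ae ?_
  have h1 : ∀ᵐ x, ∀ i, G (x - (cleanSample C w i).1) = G' (x - (cleanSample C w i).1) :=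
    ae_all_iff.2 fun i => ae_eq_translate hGG' _
  filter_upwards [h1] with x hx
  rw [field, pairing_config]
  simp only [hx]

theorem observable_config (hC : 0 ≤ C) {n : ℕ} {H : (Fin n → ℝ) → ℝ} {h : Fin n → Space d → ℝ}
    {F : Γ d C → ℝ} (hF : ∀ η, F η = H fun l => pairing η (h l)) (w : Sample d) :
    F (config hC w) = statistic H h (cleanSample C w) := by
  simp only [hF, pairing_config, statistic]

end Field

/-! ### The Gibbs measure: integrability and the FKG inequality -/

section Gibbs

variable {d : ℕ} {z C : ℝ} {r : Measure ℝ} {P : Measure (Sample d)} {G : Space d → ℝ}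
  {v : ℝ → ℝ} {b : ℝ} {g : Space d → ℝ}

theorem measurable_energy (hC : 0 ≤ C) (hv : Measurable v) (hG : Integrable G)
    (h0 : ∀ x, 0 ≤ G x) (hg : Continuous g) (hg0 : ∀ x, 0 ≤ g x) :
    Measurable fun η : Γ d C => energy G v g η := by
  obtain ⟨G', hGm', -, -, hGG'⟩ := exists_measurable_ae_eq hG h0
  have : SFinite (cutoffMeasure g) := by
    unfold cutoffMeasure
    infer_instance
  refine (measurable_comp_config_iff hC).1 ?_
  have e : (fun η : Γ d C => energy G v g η) ∘ config hC =
      kernelEnergy v (cutoffMeasure g) (fun y x => G' (x - y)) ∘ cleanSample C :=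
    funext fun w => energy_config hC hGG' hg hg0 v w
  rw [e]
  exact (measurable_kernelEnergy (γ := fun y x => G' (x - y)) hv (hGm'.comp (measurable_snd.sub measurable_fst))).comp
    measurable_cleanSample

theorem IsObservable.measurable (hC : 0 ≤ C) {F : Γ d C → ℝ} (hF : IsObservable F) :
    Measurable F := by
  obtain ⟨n, H, h, hH, -, hh, hF⟩ := hF
  refine (measurable_comp_config_iff hC).1 ?_
  have e : F ∘ config hC = statistic H h ∘ cleanSample C := funext (observable_config hC hF)
  rw [e]
  exact (measurable_statistic hH fun l => (hh l).1.measurable).comp measurable_cleanSample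

theorem IsIncreasingObservable.isObservable {F : Γ d C → ℝ} (hF : IsIncreasingObservable F) :
    IsObservable F := by
  obtain ⟨n, H, h, hH, he, hh, -, -, hF⟩ := hF
  exact ⟨n, H, h, hH, he, hh, hF⟩

/-- Exponential domination of the energy and of the observables. -/
theorem IsPoissonSample.exists_domination (hP : IsPoissonSample z C r P) (hC : 0 ≤ C) (hb : 0 ≤ b)
    (hv : ∀ s t, |v s - v t| ≤ b * |s - t|) (hv0 : v 0 = 0) (hvm : Measurable v)
    (hG : Integrable G) (h0 : ∀ x, 0 ≤ G x) (hg : Continuous g) (hgs : HasCompactSupport g)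
    (hg0 : ∀ x, 0 ≤ g x) :
    ∃ W : Sample d → ℝ, (∀ κ, 0 ≤ κ → Integrable (fun w => Real.exp (κ * W w)) P) ∧
      (∃ κ, 0 ≤ κ ∧ ∀ᵐ w ∂P, |Real.exp (-energy G v g (config hC w))| ≤ 1 * Real.exp (κ * W w)) ∧
      ∀ F : Γ d C → ℝ, IsObservable F → ∃ κ K, 0 ≤ κ ∧ 0 ≤ K ∧
        ∀ᵐ w ∂P, |F (config hC w)| ≤ K * Real.exp (κ * W w) := by
  obtain ⟨G', hGm', h0', hG', hGG'⟩ := exists_measurable_ae_eq hG h0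
  obtain ⟨c, R, hc, hν⟩ := exists_cutoffMeasure_le hg hgs
  have hsum : ∀ᵐ w ∂P, Summable fun i => |(w i).2| * totalWeight G' (R + 1) (w i).1 :=
    (hP.exp_moment (measurable_totalWeight hGm' _) (totalWeight_nonneg h0' _)
      (totalWeight_le hG' h0' _) (integrable_totalWeight hG' hGm' h0' _)).1
  refine ⟨weightSum (totalWeight G' (R + 1)), fun κ hκ =>
    hP.integrable_exp (measurable_totalWeight hGm' _) (totalWeight_nonneg h0' _)
      (totalWeight_le hG' h0' _) (integrable_totalWeight hG' hGm' h0' _) hκ,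
    ⟨b * c, mul_nonneg hb hc, ?_⟩, ?_⟩
  · filter_upwards [hsum, hP.ae_cleanSample_eq] with w hw hcw
    rw [one_mul, abs_of_pos (Real.exp_pos _), Real.exp_le_exp, energy_config hC hGG' hg hg0, hcw]
    exact (neg_le_abs _).trans (abs_kernelEnergy_le hb hv hv0 hvm
      (integrable_translate_cutoff hν hG') hc (totalWeight_nonneg h0' _)
      (fun y => integral_abs_translate_le_totalWeight hc hν hG' h0' (by simp)) hw)
  · rintro F ⟨n, H, h, hH, ⟨κ, K, hκ, hK, hB⟩, hh, hF⟩
    choose M hM0 hM using fun l => (hh l).exists_bound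
    refine ⟨κ * ∑ l, M l, K, mul_nonneg hκ.le (Finset.sum_nonneg fun l _ => hM0 l), hK.le, ?_⟩
    filter_upwards [hsum, hP.ae_cleanSample_eq] with w hw hcw
    rw [observable_config hC hF, hcw]
    exact abs_statistic_le hκ.le hK.le hB (fun l y => (hM l y).trans
      (mul_le_mul_of_nonneg_left (tempWeight_le_totalWeight h0' _ _) (hM0 l))) hw

/-- The FKG inequality before normalization. -/
theorem IsPoissonSample.fkg_config [IsProbabilityMeasure r] (hP : IsPoissonSample z C r P)
    (hC : 0 ≤ C) (hr : r (Set.Icc (-C) C)ᶜ = 0) (hb : 0 ≤ b)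
    (hv : ∀ s t, |v s - v t| ≤ b * |s - t|) (hv0 : v 0 = 0) (hvm : Measurable v)
    (hvc : ConcaveOn ℝ Set.univ v)
    (hG : Integrable G) (h0 : ∀ x, 0 ≤ G x) (hg : Continuous g) (hgs : HasCompactSupport g)
    (hg0 : ∀ x, 0 ≤ g x) {F₁ F₂ : Γ d C → ℝ} (hF₁ : IsIncreasingObservable F₁)
    (hF₂ : IsIncreasingObservable F₂) {ρ : Γ d C → ℝ}
    (hρ : ρ = fun η => Real.exp (-energy G v g η)) :
    (∫ η, ρ η * F₁ η ∂P.map (config hC)) * ∫ η, ρ η * F₂ η ∂P.map (config hC) ≤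
      (∫ η, ρ η ∂P.map (config hC)) * ∫ η, ρ η * (F₁ η * F₂ η) ∂P.map (config hC) := by
  obtain ⟨G', hGm', h0', hG', hGG'⟩ := exists_measurable_ae_eq hG h0
  obtain ⟨c, R, hc, hν⟩ := exists_cutoffMeasure_le hg hgs
  have : SFinite (cutoffMeasure g) := by
    unfold cutoffMeasure
    infer_instance
  have hρm : Measurable ρ := by
    rw [hρ]
    exact (measurable_energy hC hvm hG h0 hg hg0).neg.exp
  have hFm₁ := hF₁.isObservable.measurable hC
  have hFm₂ := hF₂.isObservable.measurable hC
  obtain ⟨n₁, H₁, h₁, hH₁, he₁, hh₁, hp₁, hm₁, hF₁⟩ := hF₁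
  obtain ⟨n₂, H₂, h₂, hH₂, he₂, hh₂, hp₂, hm₂, hF₂⟩ := hF₂
  have htr : ∀ {A : Γ d C → ℝ} {S : Sample d → ℝ}, Measurable A →
      (∀ w, A (config hC w) = S (cleanSample C w)) →
      ∫ η, A η ∂P.map (config hC) = ∫ w, S w ∂P := by
    intro A S hA hAS
    rw [integral_map (measurable_config hC).aemeasurable hA.aestronglyMeasurable]
    refine integral_congr_ae ?_
    filter_upwards [hP.ae_cleanSample_eq] with w hw
    rw [hAS, hw]
  set ρ' : Sample d → ℝ := fun w =>
    Real.exp (-kernelEnergy v (cutoffMeasure g) (fun y x => G' (x - y)) w) with hρ'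
  have hρe : ∀ w, ρ (config hC w) = ρ' (cleanSample C w) := fun w => by
    simp only [hρ, hρ', energy_config hC hGG' hg hg0]
  have e₁ := observable_config hC hF₁
  have e₂ := observable_config hC hF₂
  have key := hP.fkg hr hb hv hv0 hvm hvc hc hν hG' hGm' h0' hH₁ hH₂ he₁ he₂ hh₁ hh₂ hm₁ hm₂
    hp₁ hp₂ hρ' rfl rfl
  rwa [htr (A := fun η => ρ η * F₁ η) (S := fun w => ρ' w * statistic H₁ h₁ w) (hρm.mul hFm₁)
      fun w => by simp only [hρe, e₁],
    htr (A := fun η => ρ η * F₂ η) (S := fun w => ρ' w * statistic H₂ h₂ w) (hρm.mul hFm₂)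
      fun w => by simp only [hρe, e₂],
    htr (A := fun η => ρ η * (F₁ η * F₂ η))
      (S := fun w => ρ' w * (statistic H₁ h₁ w * statistic H₂ h₂ w)) (hρm.mul (hFm₁.mul hFm₂))
      fun w => by simp only [hρe, e₁, e₂],
    htr hρm hρe]

theorem IsPoissonSample.gibbs_properties [IsProbabilityMeasure r] (hP : IsPoissonSample z C r P)
    (hC : 0 ≤ C) (hr : r (Set.Icc (-C) C)ᶜ = 0) (hb : 0 ≤ b)
    (hv : ∀ s t, |v s - v t| ≤ b * |s - t|) (hv0 : v 0 = 0) (hvm : Measurable v)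
    (hvc : ConcaveOn ℝ Set.univ v)
    (hG : Integrable G) (h0 : ∀ x, 0 ≤ G x) (hg : Continuous g) (hgs : HasCompactSupport g)
    (hg0 : ∀ x, 0 ≤ g x) :
    IsProbabilityMeasure (gibbs (P.map (config hC)) G v g) ∧
      (∀ F : Γ d C → ℝ, IsObservable F → MemLp F 2 (gibbs (P.map (config hC)) G v g)) ∧
      SatisfiesFKG (gibbs (P.map (config hC)) G v g) := by
  have := hP.isProbabilityMeasure
  have : IsProbabilityMeasure (P.map (config hC)) :=
    Measure.isProbabilityMeasure_map (measurable_config hC).aemeasurable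
  obtain ⟨W, hW, ⟨κ, hκ, hE⟩, hO⟩ :=
    hP.exists_domination hC hb hv hv0 hvm hG h0 hg hgs hg0
  have hρm : Measurable fun η : Γ d C => Real.exp (-energy G v g η) :=
    (measurable_energy hC hvm hG h0 hg hg0).neg.exp
  have hint : ∀ {A : Γ d C → ℝ}, Measurable A → ∀ κ K, 0 ≤ κ →
      (∀ᵐ w ∂P, |A (config hC w)| ≤ K * Real.exp (κ * W w)) → Integrable A (P.map (config hC)) := by
    intro A hA κ K hκ hAb
    rw [integrable_map_measure hA.aestronglyMeasurable (measurable_config hC).aemeasurable]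
    exact ((hW κ hκ).const_mul K).mono' (hA.comp (measurable_config hC)).aestronglyMeasurable hAb
  have hρi : Integrable (fun η => Real.exp (-energy G v g η)) (P.map (config hC)) :=
    hint hρm κ 1 hκ hE
  refine ⟨isProbabilityMeasure_tilted hρi, fun F hF => ?_, fun F₁ F₂ hF₁ hF₂ => ?_⟩
  · have hFm := hF.measurable hC
    rw [memLp_two_iff_integrable_sq hFm.aestronglyMeasurable, gibbs, integrable_tilted_iff hρi]
    obtain ⟨κ', K, hκ', hK, hFb⟩ := hO F hF
    -- The exponent `κ` belongs to `e^{-U}` and the two copies of `κ'` to the square of `F`.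
    refine hint (hρm.mul (hFm.pow_const 2)) (κ + (κ' + κ')) (1 * (K * K))
      (add_nonneg hκ (add_nonneg hκ' hκ')) ?_
    filter_upwards [hE, hFb] with w p q
    rw [smul_eq_mul, sq]
    exact abs_mul_le_exp zero_le_one p (abs_mul_le_exp hK q q)
  · have key := hP.fkg_config hC hr hb hv hv0 hvm hvc hG h0 hg hgs hg0 hF₁ hF₂ rfl
    have hZ := integral_exp_pos hρi
    have e : ∀ A : Γ d C → ℝ, ∫ η, A η ∂gibbs (P.map (config hC)) G v g =
        (∫ η, Real.exp (-energy G v g η) * A η ∂P.map (config hC)) /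
          ∫ η, Real.exp (-energy G v g η) ∂P.map (config hC) := by
      intro A
      simp only [gibbs, integral_tilted, smul_eq_mul, div_mul_eq_mul_div, integral_div]
    -- After division by the squared partition function, the unnormalized inequality is the claim.
    rw [e, e, e, div_mul_div_comm, div_le_div_iff₀ (mul_pos hZ hZ) hZ]
    calc _ ≤ _ := mul_le_mul_of_nonneg_right key hZ.le
      _ = _ := by ring

end Gibbs
end ParticleSystem

/-! ### The main theorem -/

theorem theorem3p1 (d : ℕ) (hd : 0 < d)
    -- activity and charge distribution
    (z : ℝ) (hz : 0 < z) (C : ℝ) (hC : 0 < C)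
    (r : Measure ℝ) (hr : IsProbabilityMeasure r)
    (hr_supp : r (Set.Icc (-C) C)ᶜ = 0) (hr_zero : r {0} = 0)
    -- interaction kernel
    (G : ParticleSystem.Space d → ℝ) (hG : Integrable G volume)
    (hG_symm : ∀ x, G (-x) = G x) (hG_nonneg : ∀ x, 0 ≤ G x)
    -- energy density
    (v : ℝ → ℝ) (hv_zero : v 0 = 0) (hv : ContDiff ℝ 2 v)
    (b : ℝ) (hb : 0 < b) (hv_deriv : ∀ φ, |deriv v φ| < b)
    (hv_concave : ConcaveOn ℝ Set.univ v)
    -- infrared cut-off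
    (g : ParticleSystem.Space d → ℝ) (hg : Continuous g) (hg_supp : HasCompactSupport g)
    (hg_nonneg : ∀ x, 0 ≤ g x) :
    -- the free measure exists on tempered distributions and is unique,
    (∃! μ₀ : Measure (ParticleSystem.TempDist d), ParticleSystem.IsFreeMeasure z r μ₀) ∧
    ∀ μ₀ : Measure (ParticleSystem.TempDist d), ParticleSystem.IsFreeMeasure z r μ₀ →
      -- it is carried by the configuration space,
      (∃! μΓ : Measure (ParticleSystem.Γ d C), μΓ.map Subtype.val = μ₀) ∧
      ∀ μΓ : Measure (ParticleSystem.Γ d C), μΓ.map Subtype.val = μ₀ →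
        -- field and energy are well defined for almost every configuration,
        (∀ᵐ η ∂μΓ,
          (∀ᵐ x, Summable fun y => ParticleSystem.charge η y * G (x - y)) ∧
          LocallyIntegrable (ParticleSystem.field G η) volume) ∧
        -- the Gibbs measure is a probability measure, observables are square integrable,
        IsProbabilityMeasure (ParticleSystem.gibbs μΓ G v g) ∧
        (∀ F : ParticleSystem.Γ d C → ℝ, ParticleSystem.IsObservable F →
          MemLp F 2 (ParticleSystem.gibbs μΓ G v g)) ∧
        -- and the FKG inequality holds
        ParticleSystem.SatisfiesFKG (ParticleSystem.gibbs μΓ G v g) := by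
  obtain ⟨P, hP⟩ := ParticleSystem.exists_isPoissonSample hd hz hC.le hr_supp
  have hfree := hP.isFreeMeasure hC.le
  refine ⟨⟨_, hfree, fun μ hμ => hμ.eq hfree⟩, fun μ₀ hμ₀ => ?_⟩
  -- Uniqueness replaces an arbitrary free measure, and below its lift to `Γ`, by the image of the
  -- Poisson sample.
  obtain rfl := hμ₀.eq hfree
  refine ⟨⟨_, rfl, fun μ hμ => ParticleSystem.measure_config_ext hμ⟩, fun μΓ hμΓ => ?_⟩
  obtain rfl := ParticleSystem.measure_config_ext hμΓ
  exact ⟨hP.ae_field_wellDefined hC.le hG hG_nonneg,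
    hP.gibbs_properties hC.le hr_supp hb.le (ParticleSystem.lipschitz_of_deriv_lt hv hv_deriv)
      hv_zero hv.continuous.measurable hv_concave hG hG_nonneg hg hg_supp hg_nonneg⟩
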